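/- **Setting.** Parties $\mathcal A$, $\mathcal B$, $\mathcal M$ ($\mathcal M$ stands for all miners), a security parameter $\mu$, one session (session ids are omitted), redeem paths $\text{dep-}\mathcal A,\text{dep-}\mathcal B,\text{dep-}\mathcal M,\text{col-}\mathcal B,\text{col-}\mathcal M$. Say that a path *uses $a$* if it is $\text{dep-}\mathcal A$, $\text{dep-}\mathcal M$ or $\text{col-}\mathcal M$, and *uses $b$* if it is $\text{dep-}\mathcal B$, $\text{dep-}\mathcal M$ or $\text{col-}\mathcal M$. The relaxed contract predicate (no timeouts, no conflicts) is $$\mathrm{rPredicate}(path,\mathcal P,h_a,h_b)=\begin{cases}(\mathcal P=\mathcal A)\wedge h_a& path=\text{dep-}\mathcal A\\(\mathcal P=\mathcal B)\wedge h_b& path=\text{dep-}\mathcal B\\ h_a\wedge h_b& path\in\{\text{dep-}\mathcal M,\text{col-}\mathcal M\}\\ \mathcal P=\mathcal B& path=\text{col-}\mathcal B.\end{cases}$$ **Hybrid world.** $\mathcal H$ is a lazily sampled random oracle $\{0,1\}^*\to\{0,1\}^\mu$, open to the parties, $\mathcal G_{mbp}$ and the adversary. The mempool-and-blockchain functionality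 $\mathcal G_{mbp}$ keeps digests $dig_1,dig_2$, an initiating transaction $tx$, and bits $publish$, $init$, $p_a$, $p_b$, all initially unset. It accepts, and ignores everything else: (setup-B, $d_1,d_2$) from $\mathcal B$ if no digests are set: it sets them, leaks them to the adversary and notifies $\mathcal A$; (setup-A) from $\mathcal A$ if the digests are set: it creates $tx=(dig_1,dig_2)$, leaks (setup-A), and sends $tx$ to $\mathcal A,\mathcal B$; (publish, $tx$) from $\mathcal A$ or $\mathcal B$ if $publish=0$, and (init, $tx$) from $\mathcal M$ if $publish=1$: it sets $publish$, respectively $init$, leaks the message and sends it to all parties; (redeem, $tx,x_1,x_2,path$) from any $\mathcal P$ if $init=1$, where each $x_i$ is a bit string or $\bot$: it sets $p_a\leftarrow p_a\vee(x_1\ne\bot\wedge\mathcal H(x_1)=dig_1)$ and $p_b\leftarrow p_b\vee(x_2\ne\bot\wedge\mathcal H(x_2)=dig_2)$, computes $res=\mathrm{rPredicate}(path,\mathcal P,p_a,p_b)$, leaks $(x_1,x_2,dig_1,dig_2,path,\mathcal P,p_a,p_b,res)$ and returns $res$ to $\mathcal P$. The redeeming transaction is *valid* if $res=1$. **Protocol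 $\Pi_{rmh}$**, driven by inputs of the environment $\mathcal Z$. $\mathcal A,\mathcal B$ start in phase setup and $\mathcal M$ in phase initiation; messages and inputs not expected in the current phase are ignored. On the first input setup-B, $\mathcal B$ draws uniform $a_{pre},b_{pre}\in\{0,1\}^\mu$ and sends (setup-B, $\mathcal H(a_{pre}),\mathcal H(b_{pre})$) to $\mathcal G_{mbp}$. On input setup-A, after being notified of the digests, $\mathcal A$ sends (setup-A). $\mathcal A$ and $\mathcal B$ enter phase initiation on receiving $tx$ and phase redeeming on receiving (init, $tx$). In phase initiation: on its first input share, $\mathcal B$ sends $a_{pre}$ to $\mathcal A$ over a secure channel (the adversary sees only that a message was sent), and $\mathcal A$ stores a received $x$ iff $\mathcal H(x)=dig_1$; on input publish, $\mathcal A$ or $\mathcal B$ sends (publish, $tx$); $\mathcal M$, having received (publish, $tx$), on input init sends (init, $tx$) and enters phase redeeming. In phase redeeming: on input (redeem, $path$), $\mathcal P$ sends (redeem, $tx,x_1,x_2,path$), where $x_1$ is its stored $a_{pre}$ if $path$ uses $a$ and it has stored one, and $\bot$ otherwise, and likewise $x_2$ with $b_{pre}$ and $b$; it outputs the result. **Ideal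 functionality $\mathcal F_{rmh}$.** Bits $setup_a,setup_b,shared,published,init,p_1,p_2$, initially $0$. It accepts setup-B from $\mathcal B$ if $setup_b=0$; setup-A from $\mathcal A$ if $setup_b=1$, $setup_a=0$; share from $\mathcal B$ if $setup_a=1$, $shared=0$, $init=0$; publish from $\mathcal A$ or $\mathcal B$ if $setup_a=1$, $published=0$; init from $\mathcal M$ if $published=1$, $init=0$. In each case it sets the corresponding bit and leaks the name of the message to the simulator. If $init=1$, on (redeem, $path$) from $\mathcal P$ it sets $p_1\leftarrow p_1\vee(\mathcal P=\mathcal A\wedge shared\wedge path\text{ uses }a)\vee(\mathcal P=\mathcal B\wedge path\text{ uses }a)$ and $p_2\leftarrow p_2\vee(\mathcal P=\mathcal B\wedge path\text{ uses }b)$, leaks (redeem, $path,\mathcal P$), and returns $\mathrm{rPredicate}(path,\mathcal P,p_1,p_2)$ to $\mathcal P$. On (update, $i$), $i\in\{1,2\}$, from the simulator it sets $p_i\leftarrow1$. In the ideal world honest parties forward inputs to $\mathcal F_{rmh}$ and output its results; there is no $\mathcal H$ or $\mathcal G_{mbp}$; the simulator acts for the corrupted parties. **Executions.** Communication is immediate.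 In each turn $\mathcal Z$ gives an input to a party (inputs to corrupted parties go to the adversary) or a message to the adversary; then the adversary, who gets all leakage and all messages to corrupted parties, is activated, may query $\mathcal H$ and act for the corrupted parties, and answers $\mathcal Z$, who also gets the output of the honest party. At the end $\mathcal Z$ outputs a bit. Machines are probabilistic and polynomial time: $\mathcal Z$ (with an arbitrary auxiliary input) in $\mu$, adversaries and simulators in $\mu$ plus the total length of the messages from $\mathcal Z$ (at least one per activation). **Indicators.** In the hybrid world $p_a,p_b$ are the bits of $\mathcal G_{mbp}$, and $shared$ says that $\mathcal B$ shared $a_{pre}$ with $\mathcal A$ (honest $\mathcal A$ has accepted a value, or honest $\mathcal B$ has sent it to corrupted $\mathcal A$; if both are corrupted, $shared=1$). Define $\mathrm{Can}(\mathcal P,path)$, given $p_a,p_b,shared$: - $\mathcal B$: true exactly for $\text{dep-}\mathcal B,\text{dep-}\mathcal M,\text{col-}\mathcal B,\text{col-}\mathcal M$; - $\mathcal A$: $p_a\vee shared$ for $\text{dep-}\mathcal A$; $(p_a\vee shared)\wedge p_b$ for $\text{dep-}\mathcal M,\text{col-}\mathcal M$; false otherwise; - $\mathcal M$: $p_a\wedge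 p_b$ for $\text{dep-}\mathcal M,\text{col-}\mathcal M$; false otherwise. **Theorem.** For every set $C\subseteq\{\mathcal A,\mathcal B,\mathcal M\}$ of statically corrupted parties: 1. $\Pi_{rmh}$ in the $(\mathcal H,\mathcal G_{mbp})$-hybrid world UC-realises $\mathcal F_{rmh}$: for every PPT adversary $\mathsf{Adv}$ there is a PPT simulator $\mathsf{Sim}$ such that for every PPT environment $\mathcal Z$ and all auxiliary inputs, the difference of the probabilities that $\mathcal Z$ outputs $1$ in the hybrid world with $\mathsf{Adv}$ and in the ideal world with $\mathsf{Sim}$ is negligible in $\mu$. 2. For all PPT $\mathcal Z$, $\mathsf{Adv}$ and all auxiliary inputs, except with negligible probability every valid redeeming transaction published in the hybrid world, by $\mathcal P$ with $path$, satisfies $\mathrm{Can}(\mathcal P,path)$ with the indicators just before it, or $\mathcal P\in C$, $path\in\{\text{dep-}\mathcal M,\text{col-}\mathcal M\}$ and $\mathrm{Can}(\mathcal Q,path)$ for some $\mathcal Q\in C$ (corrupted parties may pool their knowledge). 3. For all $\mathcal Z$, $\mathsf{Adv}$, in every reachable state of the hybrid world with $init=1$, an honest $\mathcal P$ with input (redeem,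 $path$) publishes a transaction that is valid if and only if $\mathrm{Can}(\mathcal P,path)$; if it is valid, it sets $p_a\leftarrow1$ if $path$ uses $a$, sets $p_b\leftarrow1$ if $path$ uses $b$, and changes neither indicator otherwise. In every execution, every redeeming transaction by an honest $\mathcal P$ is valid if and only if $\mathrm{Can}(\mathcal P,path)$ with the indicators just before it, and every valid redeeming transaction, by any party, leaves $p_a=1$ if its path uses $a$ and $p_b=1$ if its path uses $b$. If $tx$ has been created, $init=0$ and $\mathcal B$ is honest, then input share to $\mathcal B$ results in $shared=1$. -/

import Mathlib

namespace MadHtlc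

/-! ## Data and probabilistic interactive programs -/

/-- Binary trees: the data (and messages) handled by all machines. -/
inductive Val where
  | nil : Val
  | node : Val → Val → Val
  deriving DecidableEq

namespace Val

def fst : Val → Val
  | nil => nil
  | node l _ => l

def snd : Val → Val
  | nil => nil
  | node _ r => r

def size : Val → ℕ
  | nil => 1
  | node l r => l.size + r.size + 1

def ofBool : Bool → Val
  | false => nil
  | true => node nil nil

/-- Everything except `nil` counts as true. -/
def toBool : Val → Bool
  | nil => false
  | node _ _ => true

/-- Unary numerals; also used for `1^μ`. -/
def ofNat : ℕ → Val
  | 0 => nil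
  | n + 1 => node nil (ofNat n)

/-- Length of the right spine. -/
def len : Val → ℕ
  | nil => 0
  | node _ r => r.len + 1

def ofList : List Val → Val
  | [] => nil
  | v :: vs => node v (ofList vs)

/-- A value with a numeric tag in front. -/
def tag (n : ℕ) (v : Val) : Val := node (ofNat n) v

end Val

/-- Bit strings, `{0,1}^*`. -/
abbrev Bits := List Bool

namespace Val

def ofBits : Bits → Val
  | [] => nil
  | b :: bs => node (ofBool b) (ofBits bs)

/-- Every value can be read as a bit string; `bits (ofBits x) = x`. -/
def bits : Val → Bits
  | nil => []
  | node b r => b.toBool :: r.bits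

def ofOptBits : Option Bits → Val
  | none => nil
  | some x => node (ofBits x) nil

def optBits : Val → Option Bits
  | nil => none
  | node x _ => some x.bits

end Val

theorem Val.bits_ofBits (x : Bits) : (Val.ofBits x).bits = x := by
  induction x with
  | nil => rfl
  | cons b bs ih => cases b <;> simp [Val.ofBits, Val.bits, Val.ofBool, Val.toBool, ih]

/-- A (finite) interactive probabilistic computation: it may flip fair coins, and send a message
to the outside and wait for the answer. -/
inductive Prog (α : Type) where
  | ret : α → Prog α
  | coin : (Bool → Prog α) → Prog α
  | call : Val → (Val → Prog α) → Prog α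

namespace Prog

variable {α β σ : Type}

def bind : Prog α → (α → Prog β) → Prog β
  | ret a, f => f a
  | coin k, f => coin fun b => (k b).bind f
  | call q k, f => call q fun r => (k r).bind f

/-- Sequencing of computations that may run out of time (`none`). -/
def bindO (p : Prog (Option α)) (f : α → Prog (Option β)) : Prog (Option β) :=
  p.bind fun o => match o with
    | none => ret none
    | some a => f a

/-- The result satisfies `P` whatever the coins and whatever the answers from outside. -/
def AllResults (P : α → Prop) : Prog α → Prop
  | ret a => P a
  | coin k => ∀ b, (k b).AllResults P
  | call _ k => ∀ r, (k r).AllResults P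

end Prog

noncomputable def fairCoin : PMF Bool := PMF.uniformOfFintype Bool

/-- Run a computation against a stateful randomized responder. -/
noncomputable def Prog.interp {α σ : Type} (O : σ → Val → PMF (Val × σ)) :
    Prog α → σ → PMF (α × σ)
  | .ret a, s => pure (a, s)
  | .coin k, s => do
      let b ← fairCoin
      (k b).interp O s
  | .call q k, s => do
      let rs ← O s q
      (k rs.1).interp O rs.2

/-! ## The machine model: WHILE programs over trees

Jones' WHILE language, with a coin-tossing command and a command for sending a message and
receiving the answer. Its polynomial time (with the unit costs below) is that of probabilistic
interactive Turing machines. -/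

inductive Expr where
  | var : ℕ → Expr
  | nil : Expr
  | cons : Expr → Expr → Expr
  | hd : Expr → Expr
  | tl : Expr → Expr
  | eq : Expr → Expr → Expr

abbrev Store := ℕ → Val

def Expr.eval (s : Store) : Expr → Val
  | var n => s n
  | nil => .nil
  | cons e f => .node (e.eval s) (f.eval s)
  | hd e => (e.eval s).fst
  | tl e => (e.eval s).snd
  | eq e f => .ofBool (decide (e.eval s = f.eval s))

inductive Cmd where
  | assign : ℕ → Expr → Cmd
  | seq : Cmd → Cmd → Cmd
  | ite : Expr → Cmd → Cmd → Cmd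
  | loop : Expr → Cmd → Cmd
  | coin : ℕ → Cmd
  | call : ℕ → Expr → Cmd

/-- `while test do body`, for at most `k` tests; the last argument is the remaining time, of which
every test takes one unit. -/
def whileLoop (test : Store → Bool) (body : Store → ℕ → Prog (Option (Store × ℕ))) :
    ℕ → Store → ℕ → Prog (Option (Store × ℕ))
  | 0, _, _ => .ret none
  | _ + 1, _, 0 => .ret none
  | k + 1, s, t + 1 =>
      if test s then (body s t).bindO fun r => whileLoop test body k r.1 r.2
      else .ret (some (s, t))

/-- `c.run s t` executes `c` on the store `s` with `t` units of time. The result is the final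
store together with the time left, or `none` if the time does not suffice. Assignments, tests and
coins take one unit each, and sending a message takes one unit plus the size of the message. -/
def Cmd.run : Cmd → Store → ℕ → Prog (Option (Store × ℕ))
  | assign _ _, _, 0 => .ret none
  | assign x e, s, t + 1 => .ret (some (Function.update s x (e.eval s), t))
  | seq c d, s, t => (c.run s t).bindO fun r => d.run r.1 r.2
  | ite _ _ _, _, 0 => .ret none
  | ite e c d, s, t + 1 => if (e.eval s).toBool then c.run s t else d.run s t
  | loop e c, s, t => whileLoop (fun s => (e.eval s).toBool) (fun s t => c.run s t) t s t
  | coin _, _, 0 => .ret none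
  | coin x, s, t + 1 => .coin fun b => .ret (some (Function.update s x (.ofBool b), t))
  | call x e, s, t =>
      if (e.eval s).size + 1 ≤ t then
        .call (e.eval s) fun r =>
          .ret (some (Function.update s x r, t - ((e.eval s).size + 1)))
      else .ret none

/-- Initially variable `1` holds the security parameter in unary, variable `0` holds the input. -/
def initStore (μ : ℕ) (x : Val) : Store :=
  fun n => if n = 0 then x else if n = 1 then .ofNat μ else .nil

/-- What a reactive machine (adversary or simulator) finds in variable `0` when it is activated:
a message of the environment, if there is one, and the notifications from the network. -/
def activationVal (m : Option Val) (notes : Val) : Val :=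
  .node (match m with | none => .nil | some v => .node .nil v) notes

/-- A sequence of activations of a reactive machine; its store persists. -/
def Cmd.runAll (c : Cmd) : List (Option Val × Val) → Store → ℕ → Prog (Option (Store × ℕ))
  | [], s, t => .ret (some (s, t))
  | a :: as, s, t =>
      (c.run (Function.update s 0 (activationVal a.1 a.2)) t).bindO fun r =>
        c.runAll as r.1 r.2

/-- The length of what the environment sends in one activation (at least one). -/
def envLength (a : Option Val × Val) : ℕ :=
  match a.1 with
  | none => 1
  | some v => v.size + 1

/-- PPT adversaries and simulators: the total running time in every sequence of activations, for
all coins and all answers from the network, is at most polynomial in the security parameter plus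
the total length of what the environment has sent. -/
def Cmd.IsPPT (c : Cmd) : Prop :=
  ∃ p : Polynomial ℕ, ∀ (μ : ℕ) (acts : List (Option Val × Val)),
    (c.runAll acts (initStore μ .nil) (p.eval (μ + (acts.map envLength).sum))).AllResults
      fun o => o.isSome = true

/-- PPT environments: they run once, from the start to the end of the whole execution, and their
total running time is at most polynomial in the security parameter. -/
def Cmd.IsPPTEnv (c : Cmd) : Prop :=
  ∃ p : Polynomial ℕ, ∀ (μ : ℕ) (z : Bits),
    (c.run (initStore μ (.ofBits z)) (p.eval μ)).AllResults fun o => o.isSome = true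

/-! ## Parties, redeem paths, inputs -/

inductive Party where
  | A | B | M
  deriving DecidableEq

inductive RPath where
  | depA | depB | depM | colB | colM
  deriving DecidableEq

/-- Inputs that the environment gives to parties. -/
inductive PInput where
  | setupB | setupA | share | publish | init
  | redeem (path : RPath)

/-- Whether the path involves the preimage of the first digest. -/
def RPath.usesA : RPath → Bool
  | depA | depM | colM => true
  | depB | colB => false

/-- Whether the path involves the preimage of the second digest. -/
def RPath.usesB : RPath → Bool
  | depB | depM | colM => true
  | depA | colB => false

/-- The contract predicate without timeouts: `ha`, `hb` say whether suitable preimages are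
available. -/
def rPredicate (path : RPath) (P : Party) (ha hb : Bool) : Bool :=
  match path with
  | .depA => decide (P = .A) && ha
  | .depB => decide (P = .B) && hb
  | .depM | .colM => ha && hb
  | .colB => decide (P = .B)

/-- The transaction that initiates the contract with the two given digests. -/
structure Tx where
  dig1 : Bits
  dig2 : Bits
  deriving DecidableEq

/-! Wire format (total decoding, so that there are no malformed messages). -/

def Party.toVal : Party → Val
  | A => .ofNat 0
  | B => .ofNat 1
  | M => .ofNat 2

def Party.ofVal (v : Val) : Party :=
  match v.len with
  | 0 => A
  | 1 => B
  | _ => M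

def RPath.toVal : RPath → Val
  | depA => .ofNat 0
  | depB => .ofNat 1
  | depM => .ofNat 2
  | colB => .ofNat 3
  | colM => .ofNat 4

def RPath.ofVal (v : Val) : RPath :=
  match v.len with
  | 0 => depA
  | 1 => depB
  | 2 => depM
  | 3 => colB
  | _ => colM

def PInput.toVal : PInput → Val
  | setupB => .tag 0 .nil
  | setupA => .tag 1 .nil
  | share => .tag 2 .nil
  | publish => .tag 3 .nil
  | init => .tag 4 .nil
  | redeem path => .tag 5 path.toVal

def PInput.ofVal (v : Val) : PInput :=
  match v.fst.len with
  | 0 => setupB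
  | 1 => setupA
  | 2 => share
  | 3 => publish
  | 4 => init
  | _ => redeem (.ofVal v.snd)

def Tx.toVal (t : Tx) : Val := .node (.ofBits t.dig1) (.ofBits t.dig2)

def Tx.ofVal (v : Val) : Tx := ⟨v.fst.bits, v.snd.bits⟩

/-! ## The random oracle -/

/-- `n` independent fair bits: the uniform distribution on `{0,1}^n`. -/
noncomputable def drawBits : ℕ → PMF Bits
  | 0 => pure []
  | n + 1 => do
      let b ← fairCoin
      let bs ← drawBits n
      pure (b :: bs)

/-- The query/response pairs fixed so far. -/
abbrev Table := List (Bits × Bits)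

/-- The random oracle with outputs of length `μ`, sampled lazily. -/
noncomputable def hash (μ : ℕ) (T : Table) (q : Bits) : PMF (Bits × Table) :=
  match T.lookup q with
  | some r => pure (r, T)
  | none => do
      let r ← drawBits μ
      pure (r, (q, r) :: T)

/-- `x ≠ ⊥` and the oracle maps `x` to `d`. -/
noncomputable def isPreimage (μ : ℕ) (T : Table) (x : Option Bits) (d : Bits) :
    PMF (Bool × Table) :=
  match x with
  | none => pure (false, T)
  | some x => do
      let rT ← hash μ T x
      pure (decide (rT.1 = d), rT.2)

/-! ## The hybrid world: the mempool and blockchain projection, and the protocol -/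

/-- Requests to the mempool and blockchain projection functionality. -/
inductive GReq where
  | setupB (d1 d2 : Bits)
  | setupA
  | publish (tx : Tx)
  | init (tx : Tx)
  | redeem (tx : Tx) (pre1 pre2 : Option Bits) (path : RPath)

def GReq.ofVal (v : Val) : GReq :=
  match v.fst.len with
  | 0 => setupB v.snd.fst.bits v.snd.snd.bits
  | 1 => setupA
  | 2 => publish (.ofVal v.snd)
  | 3 => init (.ofVal v.snd)
  | _ => redeem (.ofVal v.snd.fst) v.snd.snd.fst.optBits v.snd.snd.snd.fst.optBits
      (.ofVal v.snd.snd.snd.snd)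

/-- Messages of the functionality to the parties. -/
inductive GMsg where
  | setupB (d1 d2 : Bits)
  | tx (t : Tx)
  | publish (t : Tx)
  | init (t : Tx)
  | res (b : Bool)

/-- Leakage of the functionality to the adversary. -/
inductive Leak where
  | setupB (d1 d2 : Bits)
  | setupA
  | publish (t : Tx)
  | init (t : Tx)
  | redeem (pre1 pre2 : Option Bits) (d1 d2 : Bits) (path : RPath) (P : Party)
      (pub1 pub2 res : Bool)

/-- What the adversary of the hybrid world gets to see: leakage, messages to corrupted parties
from the functionality or from honest `B`, the mere fact that honest `B` sends a message to honest
`A`, and inputs to corrupted parties. -/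
inductive Note where
  | leak (l : Leak)
  | toParty (P : Party) (m : GMsg)
  | share (pre : Bits)
  | sent
  | input (P : Party) (i : PInput)

def GMsg.toVal : GMsg → Val
  | setupB d1 d2 => .tag 0 (.node (.ofBits d1) (.ofBits d2))
  | tx t => .tag 1 t.toVal
  | publish t => .tag 2 t.toVal
  | init t => .tag 3 t.toVal
  | res b => .tag 4 (.ofBool b)

def Leak.toVal : Leak → Val
  | setupB d1 d2 => .tag 0 (.node (.ofBits d1) (.ofBits d2))
  | setupA => .tag 1 .nil
  | publish t => .tag 2 t.toVal
  | init t => .tag 3 t.toVal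
  | redeem pre1 pre2 d1 d2 path P pub1 pub2 res =>
      .tag 4 (.ofList [.ofOptBits pre1, .ofOptBits pre2, .ofBits d1, .ofBits d2, path.toVal,
        P.toVal, .ofBool pub1, .ofBool pub2, .ofBool res])

def Note.toVal : Note → Val
  | leak l => .tag 0 l.toVal
  | toParty P m => .tag 1 (.node P.toVal m.toVal)
  | share pre => .tag 2 (.ofBits pre)
  | sent => .tag 3 .nil
  | input P i => .tag 4 (.node P.toVal i.toVal)

def notesVal (ns : List Note) : Val := .ofList (ns.map Note.toVal)

/-- State of the mempool and blockchain projection; `pubA`, `pubB` indicate whether the preimages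
of the two digests were published. -/
structure GState where
  dig : Option (Bits × Bits)
  tx : Option Tx
  published : Bool
  init : Bool
  pubA : Bool
  pubB : Bool

inductive Phase where
  | setup | initiation | redeeming
  deriving DecidableEq

structure AState where
  phase : Phase
  digs : Option (Bits × Bits)
  tx : Option Tx
  pre : Option Bits

structure BState where
  phase : Phase
  pre : Option (Bits × Bits)
  tx : Option Tx
  shared : Bool

structure MState where
  phase : Phase
  tx : Option Tx

/-- Record of a redeeming transaction: publisher, path, the indicators just before it, its
validity, and the indicators just after it. -/
structure RedeemTx where
  party : Party
  path : RPath
  pubA : Bool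
  pubB : Bool
  shared : Bool
  valid : Bool
  pubAAfter : Bool
  pubBAfter : Bool

/-- State of the hybrid world. `log` is the list of redeeming transactions published so far; it
is never read by any party or functionality. The states of corrupted parties are not used. -/
structure HState where
  table : Table
  g : GState
  a : AState
  b : BState
  m : MState
  log : List RedeemTx

def HState.start : HState where
  table := []
  g := ⟨none, none, false, false, false, false⟩
  a := ⟨.setup, none, none, none⟩
  b := ⟨.setup, none, none, false⟩
  m := ⟨.initiation, none⟩
  log := []

/-- The indicator whether `B` shared the first preimage with `A`: honest `A` has accepted it, or
honest `B` has sent it to corrupted `A`. If both are corrupted, it counts as shared. -/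
def HState.shared (corr : Finset Party) (s : HState) : Bool :=
  if Party.A ∈ corr then (if Party.B ∈ corr then true else s.b.shared) else s.a.pre.isSome

/-- The mempool and blockchain projection: new state, leakage, messages to parties. -/
noncomputable def gStep (corr : Finset Party) (μ : ℕ) (s : HState) (P : Party) :
    GReq → PMF (HState × List Leak × List (Party × GMsg))
  | .setupB d1 d2 =>
      if P = .B ∧ s.g.dig = none then
        pure ({ s with g := { s.g with dig := some (d1, d2) } },
          [.setupB d1 d2], [(.A, .setupB d1 d2)])
      else pure (s, [], [])
  | .setupA =>
      match s.g.dig with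
      | none => pure (s, [], [])
      | some (d1, d2) =>
          if P = .A then
            pure ({ s with g := { s.g with tx := some ⟨d1, d2⟩ } },
              [.setupA], [(.A, .tx ⟨d1, d2⟩), (.B, .tx ⟨d1, d2⟩)])
          else pure (s, [], [])
  | .publish t =>
      if (P = .A ∨ P = .B) ∧ s.g.tx = some t ∧ s.g.published = false then
        pure ({ s with g := { s.g with published := true } },
          [.publish t], [(.A, .publish t), (.B, .publish t), (.M, .publish t)])
      else pure (s, [], [])
  | .init t =>
      if P = .M ∧ s.g.tx = some t ∧ s.g.published = true then
        pure ({ s with g := { s.g with init := true } },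
          [.init t], [(.A, .init t), (.B, .init t), (.M, .init t)])
      else pure (s, [], [])
  | .redeem t pre1 pre2 path =>
      match s.g.dig with
      | none => pure (s, [], [])
      | some (d1, d2) =>
          if s.g.tx = some t ∧ s.g.init = true then do
            let h1 ← isPreimage μ s.table pre1 d1
            let h2 ← isPreimage μ h1.2 pre2 d2
            let pubA := s.g.pubA || h1.1
            let pubB := s.g.pubB || h2.1
            let res := rPredicate path P pubA pubB
            pure ({ s with
                table := h2.2
                g := { s.g with pubA := pubA, pubB := pubB }
                log := ⟨P, path, s.g.pubA, s.g.pubB, s.shared corr, res, pubA, pubB⟩ :: s.log },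
              [.redeem pre1 pre2 d1 d2 path P pubA pubB res], [(P, .res res)])
          else pure (s, [], [])

/-- An honest party receives a message of the functionality; the result contains its output to
the environment, if any. Messages that are not expected in the current phase are ignored. -/
def receive (s : HState) : Party → GMsg → HState × Option Bool
  | .A, .setupB d1 d2 =>
      if s.a.phase = .setup then ({ s with a := { s.a with digs := some (d1, d2) } }, none)
      else (s, none)
  | .A, .tx t =>
      if s.a.phase = .setup then
        ({ s with a := { s.a with tx := some t, phase := .initiation } }, none)
      else (s, none)
  | .B, .tx t =>
      if s.b.phase = .setup then
        ({ s with b := { s.b with tx := some t, phase := .initiation } }, none)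
      else (s, none)
  | .M, .publish t =>
      if s.m.phase = .initiation then ({ s with m := { s.m with tx := some t } }, none)
      else (s, none)
  | .A, .init _ =>
      if s.a.phase = .initiation then ({ s with a := { s.a with phase := .redeeming } }, none)
      else (s, none)
  | .B, .init _ =>
      if s.b.phase = .initiation then ({ s with b := { s.b with phase := .redeeming } }, none)
      else (s, none)
  | _, .res b => (s, some b)
  | _, _ => (s, none)

/-- Delivery of messages of the functionality: to the adversary if the receiver is corrupted. -/
def deliver (corr : Finset Party) : List (Party × GMsg) → HState → HState × Option Bool × List Note
  | [], s => (s, none, [])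
  | (P, m) :: ms, s =>
      if P ∈ corr then
        let r := deliver corr ms s
        (r.1, r.2.1, .toParty P m :: r.2.2)
      else
        let q := receive s P m
        let r := deliver corr ms q.1
        (r.1, q.2.or r.2.1, r.2.2)

/-- Party `P` sends a request to the functionality, and everything that follows from it: output of
an honest party, what the adversary sees, new state. -/
noncomputable def send (corr : Finset Party) (μ : ℕ) (s : HState) (P : Party) (r : GReq) :
    PMF (Option Bool × List Note × HState) := do
  let x ← gStep corr μ s P r
  let d := deliver corr x.2.2 x.1
  pure (d.2.1, x.2.1.map Note.leak ++ d.2.2, d.1)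

/-- Honest `A` receives a value from `B` over the secure channel. -/
noncomputable def receiveShare (μ : ℕ) (s : HState) (x : Bits) : PMF HState :=
  match s.a.phase, s.a.digs with
  | .initiation, some (d1, _) => do
      let h ← isPreimage μ s.table (some x) d1
      pure { s with
        table := h.2
        a := { s.a with pre := if h.1 then some x else s.a.pre } }
  | _, _ => pure s

def HState.phase (s : HState) : Party → Phase
  | .A => s.a.phase
  | .B => s.b.phase
  | .M => s.m.phase

def HState.tx (s : HState) : Party → Option Tx
  | .A => s.a.tx
  | .B => s.b.tx
  | .M => s.m.tx

/-- The first preimage, as far as the honest party has stored it. -/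
def HState.preA (s : HState) : Party → Option Bits
  | .A => s.a.pre
  | .B => s.b.pre.map Prod.fst
  | .M => none

/-- The second preimage, as far as the honest party has stored it. -/
def HState.preB (s : HState) : Party → Option Bits
  | .B => s.b.pre.map Prod.snd
  | _ => none

/-- The protocol: an honest party receives an input from the environment. -/
noncomputable def protocolInput (corr : Finset Party) (μ : ℕ) (s : HState) :
    Party → PInput → PMF (Option Bool × List Note × HState)
  | .B, .setupB =>
      if s.b.phase = .setup ∧ s.b.pre = none then do
        let a ← drawBits μ
        let b ← drawBits μ
        let ha ← hash μ s.table a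
        let hb ← hash μ ha.2 b
        send corr μ { s with table := hb.2, b := { s.b with pre := some (a, b) } } .B
          (.setupB ha.1 hb.1)
      else pure (none, [], s)
  | .A, .setupA =>
      if s.a.phase = .setup ∧ s.a.digs ≠ none then send corr μ s .A .setupA
      else pure (none, [], s)
  | .B, .share =>
      match s.b.phase, s.b.shared, s.b.pre with
      | .initiation, false, some (a, _) =>
          if Party.A ∈ corr then
            pure (none, [.share a], { s with b := { s.b with shared := true } })
          else do
            let s' ← receiveShare μ { s with b := { s.b with shared := true } } a
            pure (none, [.sent], s')
      | _, _, _ => pure (none, [], s)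
  | .A, .publish =>
      match s.a.phase, s.a.tx with
      | .initiation, some t => send corr μ s .A (.publish t)
      | _, _ => pure (none, [], s)
  | .B, .publish =>
      match s.b.phase, s.b.tx with
      | .initiation, some t => send corr μ s .B (.publish t)
      | _, _ => pure (none, [], s)
  | .M, .init =>
      match s.m.phase, s.m.tx with
      | .initiation, some t =>
          send corr μ { s with m := { s.m with phase := .redeeming } } .M (.init t)
      | _, _ => pure (none, [], s)
  | P, .redeem path =>
      match s.phase P, s.tx P with
      | .redeeming, some t =>
          send corr μ s P (.redeem t (if path.usesA then s.preA P else none)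
            (if path.usesB then s.preB P else none) path)
      | _, _ => pure (none, [], s)
  | _, _ => pure (none, [], s)

/-- What the adversary can do in the hybrid world: query the random oracle, send a request to the
functionality as a corrupted party, send a value to honest `A` as corrupted `B`. -/
inductive AdvReq where
  | hash (q : Bits)
  | send (P : Party) (r : GReq)
  | share (x : Bits)

def AdvReq.ofVal (v : Val) : AdvReq :=
  match v.fst.len with
  | 0 => hash v.snd.bits
  | 1 => send (.ofVal v.snd.fst) (.ofVal v.snd.snd)
  | _ => share v.snd.bits

noncomputable def hybridCall (corr : Finset Party) (μ : ℕ) (s : HState) (v : Val) :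
    PMF (Val × HState) :=
  match AdvReq.ofVal v with
  | .hash q => do
      let h ← hash μ s.table q
      pure (.ofBits h.1, { s with table := h.2 })
  | .send P r =>
      if P ∈ corr then do
        let x ← send corr μ s P r
        pure (notesVal x.2.1, x.2.2)
      else pure (.nil, s)
  | .share x =>
      if Party.B ∈ corr ∧ Party.A ∉ corr then do
        let s' ← receiveShare μ s x
        pure (.nil, s')
      else pure (.nil, s)

/-- An interactive system: reactions to inputs of the environment to the parties (output to the
environment, what the adversary sees, new state), and to calls of the adversary. -/
structure World (σ : Type) where
  start : σ
  input : σ → Party → PInput → PMF (Option Bool × Val × σ)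
  call : σ → Val → PMF (Val × σ)

/-- The hybrid world with security parameter `μ`, in which the parties in `corr` are corrupted. -/
noncomputable def hybridWorld (corr : Finset Party) (μ : ℕ) : World HState where
  start := .start
  input s P i :=
    if P ∈ corr then pure (none, notesVal [.input P i], s)
    else do
      let x ← protocolInput corr μ s P i
      pure (x.1, notesVal x.2.1, x.2.2)
  call := hybridCall corr μ

/-! ## The ideal world -/

structure FState where
  setupA : Bool
  setupB : Bool
  shared : Bool
  published : Bool
  init : Bool
  pubA : Bool
  pubB : Bool

def FState.start : FState := ⟨false, false, false, false, false, false, false⟩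

/-- Leakage of the ideal functionality to the simulator. -/
inductive FLeak where
  | setupB | setupA | share | publish | init
  | redeem (path : RPath) (P : Party)

/-- The ideal functionality receives an input from a party: leakage, result returned to the
party, new state. -/
def fStep (s : FState) : Party → PInput → List FLeak × Option Bool × FState
  | .B, .setupB =>
      if s.setupB = false then ([.setupB], none, { s with setupB := true }) else ([], none, s)
  | .A, .setupA =>
      if s.setupB = true ∧ s.setupA = false then ([.setupA], none, { s with setupA := true })
      else ([], none, s)
  | .B, .share =>
      if s.setupA = true ∧ s.shared = false ∧ s.init = false then
        ([.share], none, { s with shared := true })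
      else ([], none, s)
  | .A, .publish | .B, .publish =>
      if s.setupA = true ∧ s.published = false then
        ([.publish], none, { s with published := true })
      else ([], none, s)
  | .M, .init =>
      if s.published = true ∧ s.init = false then ([.init], none, { s with init := true })
      else ([], none, s)
  | P, .redeem path =>
      if s.init = true then
        let pubA := s.pubA || (decide (P = .A) && s.shared && path.usesA)
          || (decide (P = .B) && path.usesA)
        let pubB := s.pubB || (decide (P = .B) && path.usesB)
        ([.redeem path P], some (rPredicate path P pubA pubB),
          { s with pubA := pubA, pubB := pubB })
      else ([], none, s)
  | _, _ => ([], none, s)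

/-- What the simulator gets to see: leakage, results for corrupted parties, inputs to corrupted
parties. -/
inductive FNote where
  | leak (l : FLeak)
  | res (b : Bool)
  | input (P : Party) (i : PInput)

def FLeak.toVal : FLeak → Val
  | setupB => .tag 0 .nil
  | setupA => .tag 1 .nil
  | share => .tag 2 .nil
  | publish => .tag 3 .nil
  | init => .tag 4 .nil
  | redeem path P => .tag 5 (.node path.toVal P.toVal)

def FNote.toVal : FNote → Val
  | leak l => .tag 0 l.toVal
  | res b => .tag 1 (.ofBool b)
  | input P i => .tag 2 (.node P.toVal i.toVal)

def fNotesVal (ns : List FNote) : Val := .ofList (ns.map FNote.toVal)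

/-- What the simulator can do in the ideal world: give inputs to the functionality as a corrupted
party, and use the influence port to set one of the two publication indicators. -/
inductive SimReq where
  | input (P : Party) (i : PInput)
  | updateA
  | updateB

def SimReq.ofVal (v : Val) : SimReq :=
  match v.fst.len with
  | 0 => input (.ofVal v.snd.fst) (.ofVal v.snd.snd)
  | 1 => updateA
  | _ => updateB

def idealCall (corr : Finset Party) (s : FState) (v : Val) : Val × FState :=
  match SimReq.ofVal v with
  | .input P i =>
      if P ∈ corr then
        let x := fStep s P i
        (fNotesVal (x.1.map FNote.leak ++ (x.2.1.map FNote.res).toList), x.2.2)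
      else (.nil, s)
  | .updateA => (.nil, { s with pubA := true })
  | .updateB => (.nil, { s with pubB := true })

/-- The ideal world: honest parties forward their inputs to the functionality and output what it
returns. -/
noncomputable def idealWorld (corr : Finset Party) : World FState where
  start := .start
  input s P i :=
    if P ∈ corr then pure (none, fNotesVal [.input P i], s)
    else
      let x := fStep s P i
      pure (x.2.1, fNotesVal (x.1.map FNote.leak), x.2.2)
  call s v := pure (idealCall corr s v)

/-! ## Executions and UC-realization -/

/-- In each turn the environment gives an input to a party or a message to the adversary. -/
inductive EnvReq where
  | adv (m : Val)
  | input (P : Party) (i : PInput)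

def EnvReq.ofVal (v : Val) : EnvReq :=
  match v.fst with
  | .nil => adv v.snd
  | .node _ _ => input (.ofVal v.snd.fst) (.ofVal v.snd.snd)

def outputVal : Option Bool → Val
  | none => .nil
  | some b => .node .nil (.ofBool b)

section
variable {σ : Type}

/-- Activate the adversary (with time limit `t`), which may interact with the world and then
answers to the environment; the environment also gets the output `out` of the honest party. -/
noncomputable def activate (W : World σ) (adv : Cmd) (t : ℕ) (w : σ) (st : Store)
    (m : Option Val) (notes : Val) (out : Option Bool) : PMF (Val × Option (σ × Store)) := do
  let x ← (adv.run (Function.update st 0 (activationVal m notes)) t).interp W.call w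
  match x.1 with
  | none => pure (.nil, none)
  | some r => pure (.node (outputVal out) (r.1 0), some (x.2, r.1))

/-- One turn. The state is the state of the world and of the adversary, or `none` once the time
limit `t` has been exceeded. -/
noncomputable def turn (W : World σ) (adv : Cmd) (t : ℕ) :
    Option (σ × Store) → Val → PMF (Val × Option (σ × Store))
  | none, _ => pure (.nil, none)
  | some (w, st), v =>
      match EnvReq.ofVal v with
      | .adv m => activate W adv t w st (some m) .nil none
      | .input P i => do
          let x ← W.input w P i
          activate W adv t x.2.2 st none x.2.1 x.1

/-- The execution with environment `env` (whose auxiliary input is `z`) and adversary `adv`: the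
bit that the environment outputs and the final state of the world, or `none` if the environment,
or the adversary in one of its activations, does not halt within time `t`. -/
noncomputable def exec (W : World σ) (env adv : Cmd) (μ : ℕ) (z : Bits) (t : ℕ) :
    PMF (Option (Bool × σ)) := do
  let x ← (env.run (initStore μ (.ofBits z)) t).interp (turn W adv t)
    (some (W.start, initStore μ .nil))
  match x.1, x.2 with
  | some r, some ws => pure (some ((r.1 0).toBool, ws.1))
  | _, _ => pure none

/-- The probability that the execution halts with an output bit and a final state satisfying `E`:
the supremum (and limit) over all time limits. -/
noncomputable def execProb (W : World σ) (env adv : Cmd) (μ : ℕ) (z : Bits)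
    (E : Bool → σ → Prop) : ℝ :=
  (⨆ t : ℕ, (exec W env adv μ z t).toOuterMeasure {o | ∃ b w, o = some (b, w) ∧ E b w}).toReal

end

def Negligible (f : ℕ → ℝ) : Prop :=
  Asymptotics.SuperpolynomialDecay Filter.atTop (fun μ : ℕ => (μ : ℝ)) f

/-- Under static corruption of the parties in `corr`, the protocol in the hybrid world UC-realizes
the ideal functionality. -/
def UCRealizes (corr : Finset Party) : Prop :=
  ∀ adv : Cmd, adv.IsPPT → ∃ sim : Cmd, sim.IsPPT ∧
    ∀ env : Cmd, env.IsPPTEnv → ∀ z : ℕ → Bits,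
      Negligible fun μ =>
        |execProb (hybridWorld corr μ) env adv μ (z μ) (fun b _ => b = true)
          - execProb (idealWorld corr) env sim μ (z μ) (fun b _ => b = true)|

/-! ## Which redeeming transactions the parties can publish -/

/-- The condition under which party `P` can publish a valid redeeming transaction with the given
path, when the indicators are `pubA`, `pubB` and `shared`. -/
def canRedeem (pubA pubB shared : Bool) : Party → RPath → Bool
  | .B, .depB | .B, .depM | .B, .colB | .B, .colM => true
  | .A, .depA => pubA || shared
  | .A, .depM | .A, .colM => (pubA || shared) && pubB
  | .M, .depM | .M, .colM => pubA && pubB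
  | _, _ => false

/-- The transaction is one that its publisher can publish according to `canRedeem`; or it uses one
of the paths open to everybody, the publisher is corrupted, and another corrupted party, with
whom it may pool its knowledge, can publish it according to `canRedeem`. -/
def RedeemTx.Permitted (corr : Finset Party) (r : RedeemTx) : Prop :=
  canRedeem r.pubA r.pubB r.shared r.party r.path = true ∨
    ((r.path = .depM ∨ r.path = .colM) ∧ r.party ∈ corr ∧
      ∃ Q ∈ corr, canRedeem r.pubA r.pubB r.shared Q r.path = true)

end MadHtlc

/-! The proof rests on one state space, `Red`: the stage of the session, the oracle table, the
digests, the preimages drawn by honest B, what honest A has accepted, the publication bits and the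
log. Both the state of the hybrid world (`Red.expand`) and the state of the ideal functionality
(`Red.ideal`) are functions of it. The computations `redCall` (a message of the adversary) and
`redInput` (an input of the environment, seen through what the ideal world lets the simulator see)
act on this space. They answer as the hybrid world does, and on the way they send the ideal
functionality whatever concerns it. Read with these messages ignored, they have the law of the
hybrid world (`expect_hybridCall`, `expect_hybrid_input`); run against the functionality, they keep
it in the state `Red.ideal` (`expect_interp_redCall`, `Red.Inv.redWorldInput`).

Hence a simulator that runs the adversary inside the reduced world is perfect: the two probabilities
in the first claim are equal (`execProb_ideal_eq`). No error term appears because the simulator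
plays the oracle and draws the preimages of honest B itself, and because every preimage that a
corrupted party publishes, whether known or guessed, is reported through the update port. Honest
redeeming transactions need no such report: by the invariant `Red.Inv` the values that honest
parties have stored are in the oracle table with the right digests, so their effect is the one the
functionality computes.

The simulator must also be a WHILE program of polynomial running time. `Realizes` is a small
compiler calculus, in which the transitions of the reduced world become commands; `Cmd.shift`
inlines such a command at every message of the adversary. The oracle table grows by at most two
entries per message, and a message costs the adversary at least one unit of time, so the table stays
polynomial and each inlined command takes polynomial time (`Cmd.run_shift_tracks`, `simCmd_isPPT`).

In the second claim a guess does matter. If B is corrupted, every valid transaction is permitted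
outright. If B is honest, a violation requires that a corrupted party publishes a preimage not yet
disclosed (`RedeemTx.Exact.permitted`). Its probability is bounded by counting. As long as the
secret is undisclosed, everything the adversary sees is the same for all candidates `x` in a set
`L`, and probabilities multiplied by `2 ^ μ` become sums over `L`. An oracle query deletes at most
one candidate, and a fresh answer coincides with the digest at a cost of at most one more
(`HiddenIn.sum_hashP_le`). `Bounds` is the resulting potential, pulled backwards through the
execution; in the end a polynomial times `2 ^ (-μ)` remains (`two_pow_mul_avg_redExec_le`).

For the third claim, every reachable state is the expansion of a reduced state satisfying the
invariant (`exists_red_of_mem_support`), and there the contract predicate of an honest transaction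
is literally `canRedeem` (`Red.rPredicate_honest`). -/

namespace MadHtlc
open scoped ENNReal

/-! ### Algebra of interactive computations -/

namespace Prog

variable {α β γ σ ρ : Type}

@[simp] theorem ret_bind (a : α) (f : α → Prog β) : (ret a).bind f = f a := rfl
@[simp] theorem coin_bind (k : Bool → Prog α) (f : α → Prog β) :
    (coin k).bind f = coin fun b => (k b).bind f := rfl
@[simp] theorem call_bind (v : Val) (k : Val → Prog α) (f : α → Prog β) :
    (call v k).bind f = call v fun r => (k r).bind f := rfl

theorem bind_assoc (p : Prog α) (f : α → Prog β) (g : β → Prog γ) :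
    (p.bind f).bind g = p.bind fun a => (f a).bind g := by
  induction p with
  | ret a => rfl
  | coin k ih => simp [ih]
  | call v k ih => simp [ih]

@[simp] theorem bind_ret (p : Prog α) : p.bind ret = p := by
  induction p with
  | ret a => rfl
  | coin k ih => simp [ih]
  | call v k ih => simp [ih]

@[simp] theorem ret_none_bindO (f : α → Prog (Option β)) : (ret none).bindO f = ret none := rfl
@[simp] theorem ret_some_bindO (a : α) (f : α → Prog (Option β)) :
    (ret (some a)).bindO f = f a := rfl
@[simp] theorem coin_bindO (k : Bool → Prog (Option α)) (f : α → Prog (Option β)) :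
    (coin k).bindO f = coin fun b => (k b).bindO f := rfl
@[simp] theorem call_bindO (v : Val) (k : Val → Prog (Option α)) (f : α → Prog (Option β)) :
    (call v k).bindO f = call v fun r => (k r).bindO f := rfl

theorem bindO_assoc (p : Prog (Option α)) (f : α → Prog (Option β)) (g : β → Prog (Option γ)) :
    (p.bindO f).bindO g = p.bindO fun a => (f a).bindO g := by
  induction p with
  | ret a => cases a <;> rfl
  | coin k ih => simp [ih]
  | call v k ih => simp [ih]

/-- A computation that does not run out of time. -/
def total (p : Prog α) : Prog (Option α) := p.bind fun a => ret (some a)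

@[simp] theorem total_ret (a : α) : (ret a).total = ret (some a) := rfl
@[simp] theorem total_coin (k : Bool → Prog α) : (coin k).total = coin fun b => (k b).total := rfl
@[simp] theorem total_call (v : Val) (k : Val → Prog α) :
    (call v k).total = call v fun r => (k r).total := rfl

theorem total_bindO (p : Prog α) (f : α → Prog (Option β)) : p.total.bindO f = p.bind f := by
  induction p with
  | ret a => rfl
  | coin k ih => simp [ih]
  | call v k ih => simp [ih]

theorem total_bind (p : Prog α) (f : α → Prog β) :
    (p.bind f).total = p.total.bindO fun a => (f a).total := by
  rw [total_bindO, total, bind_assoc]; rfl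

/-! ### Properties of all results -/

theorem AllResults.mono {P Q : α → Prop} {p : Prog α} (h : p.AllResults P) (hPQ : ∀ a, P a → Q a) :
    p.AllResults Q := by
  induction p with
  | ret a => exact hPQ a h
  | coin k ih => exact fun b => ih b (h b)
  | call v k ih => exact fun r => ih r (h r)

theorem allResults_of_forall {P : α → Prop} (p : Prog α) (h : ∀ a, P a) : p.AllResults P := by
  induction p with
  | ret a => exact h a
  | coin k ih => exact fun b => ih b
  | call v k ih => exact fun r => ih r

theorem allResults_bind {P : β → Prop} {p : Prog α} {f : α → Prog β} :
    (p.bind f).AllResults P ↔ p.AllResults fun a => (f a).AllResults P := by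
  induction p with
  | ret a => rfl
  | coin k ih => simp [AllResults, ih]
  | call v k ih => simp [AllResults, ih]

/-- Coins and answers are universally quantified, and universal quantifiers commute. `Cmd.Live.run`
uses this to move the quantifier over all future activations past the present one. -/
theorem allResults_forall {ι : Sort*} {P : ι → α → Prop} {p : Prog α} :
    p.AllResults (fun a => ∀ i, P i a) ↔ ∀ i, p.AllResults (P i) := by
  induction p with
  | ret a => rfl
  | coin k ih => simp only [AllResults, ih]; exact forall_comm
  | call v k ih => simp only [AllResults, ih]; exact forall_comm

theorem allResults_and {P Q : α → Prop} {p : Prog α} :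
    p.AllResults (fun a => P a ∧ Q a) ↔ p.AllResults P ∧ p.AllResults Q := by
  induction p with
  | ret a => rfl
  | coin k ih => simp only [AllResults, ih]; exact forall_and
  | call v k ih => simp only [AllResults, ih]; exact forall_and

theorem allResults_bindO {P : Option β → Prop} {p : Prog (Option α)} {f : α → Prog (Option β)} :
    (p.bindO f).AllResults P ↔
      p.AllResults fun o => match o with
        | none => P none
        | some a => (f a).AllResults P := by
  induction p with
  | ret a => cases a <;> rfl
  | coin k ih => simp [AllResults, ih]
  | call v k ih => simp [AllResults, ih]

theorem allResults_total {P : Option α → Prop} {p : Prog α} :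
    p.total.AllResults P ↔ p.AllResults fun a => P (some a) := by
  induction p with
  | ret a => rfl
  | coin k ih => simp [AllResults, ih]
  | call v k ih => simp [AllResults, ih]

/-! ### Averages over the coins -/

/-- The expectation of `h` when the coins are fair and all messages are answered by `nil`. -/
noncomputable def avg (h : α → ℝ≥0∞) : Prog α → ℝ≥0∞
  | ret a => h a
  | coin k => ((k true).avg h + (k false).avg h) / 2
  | call _ k => (k .nil).avg h

@[simp] theorem avg_ret (h : α → ℝ≥0∞) (a : α) : (ret a).avg h = h a := rfl
@[simp] theorem avg_coin (h : α → ℝ≥0∞) (k : Bool → Prog α) :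
    (coin k).avg h = ((k true).avg h + (k false).avg h) / 2 := rfl
@[simp] theorem avg_call (h : α → ℝ≥0∞) (v : Val) (k : Val → Prog α) :
    (call v k).avg h = (k .nil).avg h := rfl

theorem avg_bind (h : β → ℝ≥0∞) (p : Prog α) (f : α → Prog β) :
    (p.bind f).avg h = p.avg fun a => (f a).avg h := by
  induction p with
  | ret a => rfl
  | coin k ih => simp [ih]
  | call v k ih => simp [ih]

theorem avg_bindO (h : Option β → ℝ≥0∞) (p : Prog (Option α)) (f : α → Prog (Option β)) :
    (p.bindO f).avg h = p.avg fun o => match o with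
      | none => h none
      | some a => (f a).avg h := by
  induction p with
  | ret a => cases a <;> rfl
  | coin k ih => simp [ih]
  | call v k ih => simp [ih]

theorem avg_mono_of_allResults {h h' : α → ℝ≥0∞} {p : Prog α}
    (H : p.AllResults fun a => h a ≤ h' a) : p.avg h ≤ p.avg h' := by
  induction p with
  | ret a => exact H
  | coin k ih => simp only [avg_coin]; gcongr <;> exact ih _ (H _)
  | call v k ih => exact ih _ (H _)

theorem avg_mono {h h' : α → ℝ≥0∞} (p : Prog α) (H : ∀ a, h a ≤ h' a) : p.avg h ≤ p.avg h' :=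
  avg_mono_of_allResults (allResults_of_forall p H)

theorem avg_congr_of_allResults {h h' : α → ℝ≥0∞} {p : Prog α}
    (H : p.AllResults fun a => h a = h' a) : p.avg h = p.avg h' :=
  le_antisymm (avg_mono_of_allResults (H.mono fun _ e => e.le))
    (avg_mono_of_allResults (H.mono fun _ e => e.ge))

theorem avg_const (p : Prog α) (c : ℝ≥0∞) : (p.avg fun _ => c) = c := by
  induction p with
  | ret a => rfl
  | coin k ih => simp [ih, ENNReal.add_div]
  | call v k ih => simp [ih]

theorem avg_add (p : Prog α) (h h' : α → ℝ≥0∞) :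
    (p.avg fun a => h a + h' a) = p.avg h + p.avg h' := by
  induction p with
  | ret a => rfl
  | coin k ih => simp only [avg_coin, ih, ← ENNReal.add_div]; ring_nf
  | call v k ih => simp [ih]

/-- Used in the counting argument to fix random choices that are independent of the secret before
summing over the candidates for it. -/
theorem avg_sum {ι : Type*} (p : Prog α) (L : Finset ι) (h : ι → α → ℝ≥0∞) :
    (p.avg fun a => ∑ x ∈ L, h x a) = ∑ x ∈ L, p.avg (h x) := by
  classical
  induction L using Finset.induction_on with
  | empty => simpa using avg_const p 0
  | insert x L hx ih => simp only [Finset.sum_insert hx, avg_add, ih]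

theorem avg_eq_zero {h : α → ℝ≥0∞} {p : Prog α} (H : p.AllResults fun a => h a = 0) :
    p.avg h = 0 := by
  rw [avg_congr_of_allResults (h' := fun _ => 0) H, avg_const]

/-! ### Expectations -/

end Prog

/-- The expectation of an extended nonnegative function. -/
noncomputable def expect {α : Type} (p : PMF α) (h : α → ℝ≥0∞) : ℝ≥0∞ := ∑' a, p a * h a

section expect
variable {α β : Type}

@[simp] theorem expect_pure (a : α) (h : α → ℝ≥0∞) : expect (pure a) h = h a := by
  classical
  change ∑' b, PMF.pure a b * h b = h a
  rw [tsum_eq_single a] <;> simp +contextual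

theorem expect_bind (p : PMF α) (f : α → PMF β) (h : β → ℝ≥0∞) :
    expect (p >>= f) h = expect p fun a => expect (f a) h := by
  change ∑' b, (p.bind f) b * h b = ∑' a, p a * ∑' b, f a b * h b
  simp only [PMF.bind_apply, ← ENNReal.tsum_mul_right, ← ENNReal.tsum_mul_left]
  rw [ENNReal.tsum_comm]
  simp only [mul_assoc]

@[simp] theorem expect_map (f : α → β) (p : PMF α) (h : β → ℝ≥0∞) :
    expect (f <$> p) h = expect p fun a => h (f a) := by
  rw [← bind_pure_comp, expect_bind]
  simp

theorem expect_fairCoin (h : Bool → ℝ≥0∞) : expect fairCoin h = (h true + h false) / 2 := by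
  simp [expect, fairCoin, ENNReal.div_eq_inv_mul, mul_add, add_comm]

theorem expect_mono (p : PMF α) {h h' : α → ℝ≥0∞} (H : ∀ a, h a ≤ h' a) :
    expect p h ≤ expect p h' :=
  ENNReal.tsum_le_tsum fun a => by gcongr; exact H a

theorem toOuterMeasure_eq_expect (p : PMF α) (s : Set α) :
    p.toOuterMeasure s = expect p (s.indicator 1) := by
  rw [PMF.toOuterMeasure_apply, expect]
  congr 1; ext a
  by_cases h : a ∈ s <;> simp [h]

theorem eq_zero_of_expect_eq_zero {p : PMF α} {h : α → ℝ≥0∞} (H : expect p h = 0) {a : α}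
    (ha : a ∈ p.support) : h a = 0 := by
  have := ENNReal.tsum_eq_zero.1 H a
  rcases mul_eq_zero.1 this with h0 | h0
  · exact absurd h0 ha
  · exact h0

/-- If `p` has the law of the computation `q`, mapped by `e`, then what holds for all results of
`q` holds on the support of `p`. -/
theorem forall_mem_support_of_avg {p : PMF α} {q : Prog β} {e : β → α} {Q : α → Prop}
    (h : ∀ h : α → ℝ≥0∞, expect p h = q.avg fun b => h (e b))
    (hQ : q.AllResults fun b => Q (e b)) : ∀ a ∈ p.support, Q a := by
  classical
  intro a ha
  by_contra hna
  -- The law is tested on the indicator of failure; its expectation vanishes on the side of `q`, so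
  -- it vanishes at every point of the support.
  have := h fun a => if Q a then 0 else 1
  rw [Prog.avg_eq_zero (hQ.mono fun b hb => if_pos hb)] at this
  simpa [hna] using eq_zero_of_expect_eq_zero this ha

end expect

/-! ### Computations run against a responder, and their comparison -/

namespace Prog

variable {α β γ σ ρ τ : Type}

section interp
variable (O : σ → Val → PMF (Val × σ))

@[simp] theorem expect_interp_ret (a : α) (s : σ) (h : α × σ → ℝ≥0∞) :
    expect ((ret a).interp O s) h = h (a, s) := expect_pure _ _

@[simp] theorem expect_interp_coin (k : Bool → Prog α) (s : σ) (h : α × σ → ℝ≥0∞) :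
    expect ((coin k).interp O s) h
      = (expect ((k true).interp O s) h + expect ((k false).interp O s) h) / 2 := by
  rw [interp, expect_bind, expect_fairCoin]

@[simp] theorem expect_interp_call (v : Val) (k : Val → Prog α) (s : σ) (h : α × σ → ℝ≥0∞) :
    expect ((call v k).interp O s) h
      = expect (O s v) fun r => expect ((k r.1).interp O r.2) h := by
  rw [interp, expect_bind]

theorem expect_interp_bind (p : Prog α) (f : α → Prog β) (s : σ) (h : β × σ → ℝ≥0∞) :
    expect ((p.bind f).interp O s) h
      = expect (p.interp O s) fun x => expect ((f x.1).interp O x.2) h := by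
  induction p generalizing s with
  | ret a => simp
  | coin k ih => simp [ih]
  | call v k ih => simp [ih]

end interp

/-! ### Refinement -/

/-- The second computation has the same shape as the first one, as long as the first one does not
run out of time, and the corresponding results satisfy `R`. -/
def Refines (R : β → α → Prop) : Prog (Option β) → Prog (Option α) → Prop
  | ret none, _ => True
  | ret (some b), p => ∃ a, p = ret (some a) ∧ R b a
  | coin k, p => ∃ k', p = coin k' ∧ ∀ b, Refines R (k b) (k' b)
  | call v k, p => ∃ k', p = call v k' ∧ ∀ r, Refines R (k r) (k' r)

theorem Refines.bindO {R : β → α → Prop} {β' α' : Type} {R' : β' → α' → Prop}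
    {q : Prog (Option β)} {p : Prog (Option α)} {g : β → Prog (Option β')}
    {f : α → Prog (Option α')} (h : Refines R q p) (hfg : ∀ b a, R b a → Refines R' (g b) (f a)) :
    Refines R' (q.bindO g) (p.bindO f) := by
  induction q generalizing p with
  | ret o =>
    cases o with
    | none => trivial
    | some b =>
      obtain ⟨a, rfl, hab⟩ := h
      exact hfg b a hab
  | coin k ih =>
    obtain ⟨k', rfl, hk⟩ := h
    exact ⟨_, rfl, fun b => ih b (hk b)⟩
  | call v k ih =>
    obtain ⟨k', rfl, hk⟩ := h
    exact ⟨_, rfl, fun b => ih b (hk b)⟩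

theorem Refines.mono {R R' : β → α → Prop} {q : Prog (Option β)} {p : Prog (Option α)}
    (h : Refines R q p) (hR : ∀ b a, R b a → R' b a) : Refines R' q p := by
  induction q generalizing p with
  | ret o =>
    cases o with
    | none => trivial
    | some b =>
      obtain ⟨a, rfl, hab⟩ := h
      exact ⟨a, rfl, hR _ _ hab⟩
  | coin k ih =>
    obtain ⟨k', rfl, hk⟩ := h
    exact ⟨_, rfl, fun b => ih b (hk b)⟩
  | call v k ih =>
    obtain ⟨k', rfl, hk⟩ := h
    exact ⟨_, rfl, fun b => ih b (hk b)⟩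

/-- `Refines` says nothing about branches where `q` times out. Since `q` never does, each branch of
`p` has a partner. -/
theorem Refines.allResults {R : β → α → Prop} {q : Prog (Option β)} {p : Prog (Option α)}
    (h : Refines R q p) {P : β → Prop} (hq : q.AllResults fun o => ∃ b, o = some b ∧ P b) :
    p.AllResults fun o => ∃ b a, o = some a ∧ R b a ∧ P b := by
  induction q generalizing p with
  | ret o =>
    obtain ⟨b, rfl, hb⟩ := hq
    obtain ⟨a, rfl, hab⟩ := h
    exact ⟨b, a, rfl, hab, hb⟩
  | coin k ih =>
    obtain ⟨k', rfl, hk⟩ := h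
    exact fun b => ih b (hk b) (hq b)
  | call v k ih =>
    obtain ⟨k', rfl, hk⟩ := h
    exact fun b => ih b (hk b) (hq b)

theorem allResults_isSome_iff {p : Prog (Option α)} :
    (p.AllResults fun o => o.isSome = true) ↔ p.AllResults fun o => ∃ a, o = some a ∧ True := by
  simp [Option.isSome_iff_exists]

theorem Refines.isSome {R : β → α → Prop} {q : Prog (Option β)} {p : Prog (Option α)}
    (h : Refines R q p) (hq : q.AllResults fun o => o.isSome = true) :
    p.AllResults fun o => o.isSome = true :=
  (h.allResults (allResults_isSome_iff.1 hq)).mono fun _ ⟨_, a, ho, _⟩ => by simp [ho]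

/-- Lifting of a function to computations that may run out of time (where it is `0`). -/
noncomputable def liftO (h : α → ℝ≥0∞) : Option α → ℝ≥0∞
  | none => 0
  | some a => h a

@[simp] theorem liftO_none (h : α → ℝ≥0∞) : liftO h none = 0 := rfl
@[simp] theorem liftO_some (h : α → ℝ≥0∞) (a : α) : liftO h (some a) = h a := rfl

/-- `liftO` counts a timeout as `0`, so branches of `q` without partner only help. This is the
source of monotonicity in the time limit. -/
theorem Refines.expect_le (O : σ → Val → PMF (Val × σ)) {R : β → α → Prop} {q : Prog (Option β)}
    {p : Prog (Option α)} (h : Refines R q p) {H : β → σ → ℝ≥0∞} {H' : α → σ → ℝ≥0∞}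
    (hH : ∀ b a, R b a → ∀ s, H b s ≤ H' a s) (s : σ) :
    expect (q.interp O s) (fun x => liftO (fun b => H b x.2) x.1)
      ≤ expect (p.interp O s) (fun x => liftO (fun a => H' a x.2) x.1) := by
  induction q generalizing p s with
  | ret o =>
    cases o with
    | none => simp
    | some b =>
      obtain ⟨a, rfl, hab⟩ := h
      simpa using hH _ _ hab s
  | coin k ih =>
    obtain ⟨k', rfl, hk⟩ := h
    simp only [expect_interp_coin]
    gcongr <;> exact ih _ (hk _) s
  | call v k ih =>
    obtain ⟨k', rfl, hk⟩ := h
    simp only [expect_interp_call]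
    exact expect_mono _ fun r => ih _ (hk _) _

/-! ### Answering the messages by a stateful computation -/

/-- Answer the messages of a computation by the handler `h`, which keeps a state. -/
def simulate (h : ρ → Val → Prog (Option (Val × ρ))) : Prog (Option α) → ρ → Prog (Option (α × ρ))
  | ret o, s => ret (o.map fun a => (a, s))
  | coin k, s => coin fun b => (k b).simulate h s
  | call v k, s => (h s v).bindO fun r => (k r.1).simulate h r.2

theorem simulate_bindO (h : ρ → Val → Prog (Option (Val × ρ))) (p : Prog (Option α))
    (f : α → Prog (Option β)) (s : ρ) :
    (p.bindO f).simulate h s = (p.simulate h s).bindO fun r => (f r.1).simulate h r.2 := by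
  induction p generalizing s with
  | ret o => cases o <;> rfl
  | coin k ih => simp [simulate, ih]
  | call v k ih => simp [simulate, ih, bindO_assoc]

/-- If the responder `O`, started in `e s`, has the law of the handler started in `s`, then the
same holds for the responses to a computation. -/
theorem expect_interp_eq_avg_simulate {O : σ → Val → PMF (Val × σ)} {e : ρ → σ} {I : ρ → Prop}
    {h : ρ → Val → Prog (Val × ρ)}
    (hI : ∀ s v, I s → (h s v).AllResults fun r => I r.2)
    (hO : ∀ s v, I s → ∀ H : Val × σ → ℝ≥0∞,
      expect (O (e s) v) H = (h s v).avg fun r => H (r.1, e r.2))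
    (p : Prog (Option α)) {s : ρ} (hs : I s) (H : α × σ → ℝ≥0∞) :
    expect (p.interp O (e s)) (fun x => liftO (fun a => H (a, x.2)) x.1)
      = (p.simulate (fun s v => (h s v).total) s).avg (liftO fun r => H (r.1, e r.2)) := by
  induction p generalizing s with
  | ret o => cases o <;> simp [simulate]
  | coin k ih => simp [simulate, ih _ hs]
  | call v k ih =>
    rw [simulate, expect_interp_call, total_bindO, avg_bind, hO s v hs]
    exact avg_congr_of_allResults ((hI s v hs).mono fun r hr => ih _ hr)

theorem allResults_simulate {h : ρ → Val → Prog (Option (Val × ρ))} {I : ρ → Prop}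
    (hI : ∀ s v, I s → (h s v).AllResults fun o => ∀ r, o = some r → I r.2)
    (p : Prog (Option α)) {s : ρ} (hs : I s) :
    (p.simulate h s).AllResults fun o => ∀ r, o = some r → I r.2 := by
  induction p generalizing s with
  | ret o => cases o <;> simp [simulate, AllResults, hs]
  | coin k ih => exact fun b => ih b hs
  | call v k ih =>
    rw [simulate, allResults_bindO]
    refine (hI s v hs).mono fun o ho => ?_
    cases o with
    | none => simp
    | some r => exact ih _ (ho r rfl)

/-- What holds for all results of `p` holds for the results of `p` with simulated answers. -/
theorem AllResults.simulate {h : ρ → Val → Prog (Val × ρ)} {P : α → Prop}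
    {p : Prog (Option α)} (hp : p.AllResults fun o => ∃ a, o = some a ∧ P a) (s : ρ) :
    (p.simulate (fun s v => (h s v).total) s).AllResults fun o => ∃ r, o = some r ∧ P r.1 := by
  induction p generalizing s with
  | ret o =>
    obtain ⟨a, rfl, ha⟩ := hp
    exact ⟨_, rfl, ha⟩
  | coin k ih => exact fun b => ih b (hp b) s
  | call v k ih =>
    rw [Prog.simulate, total_bindO, allResults_bind]
    exact allResults_of_forall _ fun r => ih r.1 (hp r.1) r.2

end Prog
end MadHtlc

namespace MadHtlc
open scoped ENNReal
open Prog

/-! ## The machine model: time limits -/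

/-- The remaining time after every result is at most the time at the beginning, minus what was
spent on messages, where a message of size `n` costs `n + 1`. -/
def Prog.Spends {α : Type} (Q : ℕ → α → Prop) : ℕ → Prog α → Prop
  | n, ret a => Q n a
  | n, coin k => ∀ b, (k b).Spends Q n
  | n, call v k => v.size + 1 ≤ n ∧ ∀ r, (k r).Spends Q (n - (v.size + 1))

theorem Prog.Spends.mono {α : Type} {Q Q' : ℕ → α → Prop} {n m : ℕ} {p : Prog α}
    (h : p.Spends Q n) (hnm : n ≤ m) (hQ : ∀ a n m, n ≤ m → Q n a → Q' m a) : p.Spends Q' m := by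
  induction p generalizing n m with
  | ret a => exact hQ _ _ _ hnm h
  | coin k ih => exact fun b => ih b (h b) hnm
  | call v k ih => exact ⟨h.1.trans hnm, fun r => ih r (h.2 r) (by omega)⟩

theorem Prog.Spends.bindO {α β : Type} {Q : ℕ → Option α → Prop} {Q' : ℕ → Option β → Prop}
    {n : ℕ} {p : Prog (Option α)} {f : α → Prog (Option β)} (h : p.Spends Q n)
    (hn : ∀ n, Q' n none) (hf : ∀ n a, Q n (some a) → (f a).Spends Q' n) :
    (p.bindO f).Spends Q' n := by
  induction p generalizing n with
  | ret o =>
    cases o with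
    | none => exact hn _
    | some a => exact hf _ _ h
  | coin k ih => exact fun b => ih b (h b)
  | call v k ih => exact ⟨h.1, fun r => ih r (h.2 r)⟩

/-- The remaining time is at most `n`. -/
def TimeLeft (n : ℕ) (o : Option (Store × ℕ)) : Prop := ∀ r, o = some r → r.2 ≤ n

theorem TimeLeft.mono {n m : ℕ} {o : Option (Store × ℕ)} (h : TimeLeft n o) (hnm : n ≤ m) :
    TimeLeft m o := fun r hr => (h r hr).trans hnm

theorem whileLoop_spends {test : Store → Bool} {body : Store → ℕ → Prog (Option (Store × ℕ))}
    (hb : ∀ s t, (body s t).Spends TimeLeft t) (k : ℕ) (s : Store) (t : ℕ) :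
    (whileLoop test body k s t).Spends TimeLeft t := by
  induction k generalizing s t with
  | zero => simp [whileLoop, Spends, TimeLeft]
  | succ k ih =>
    cases t with
    | zero => simp [whileLoop, Spends, TimeLeft]
    | succ t =>
      rw [whileLoop]
      split
      · refine ((hb s t).bindO (Q' := TimeLeft) (by simp [TimeLeft]) fun n a ha => ?_).mono
          t.le_succ fun _ _ _ h h' => h'.mono h
        exact (ih a.1 a.2).mono (ha _ rfl) fun _ _ _ h h' => h'.mono h
      · simp [Spends, TimeLeft]

theorem Cmd.run_spends (c : Cmd) (s : Store) (t : ℕ) : (c.run s t).Spends TimeLeft t := by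
  induction c generalizing s t with
  | assign x e => cases t <;> simp [Cmd.run, Spends, TimeLeft]
  | seq c d ihc ihd =>
    refine (ihc s t).bindO (by simp [TimeLeft]) fun n a ha => ?_
    exact (ihd a.1 a.2).mono (ha _ rfl) fun _ _ _ h h' => h'.mono h
  | ite e c d ihc ihd =>
    cases t with
    | zero => simp [Cmd.run, Spends, TimeLeft]
    | succ t =>
      rw [Cmd.run]
      split
      · exact (ihc s t).mono t.le_succ fun _ _ _ h h' => h'.mono h
      · exact (ihd s t).mono t.le_succ fun _ _ _ h h' => h'.mono h
  | loop e c ih => exact whileLoop_spends ih _ _ _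
  | coin x => cases t <;> simp [Cmd.run, Spends, TimeLeft]
  | call x e =>
    rw [Cmd.run]
    split
    · exact ⟨‹_›, fun r => by simp [Spends, TimeLeft]⟩
    · simp [Spends, TimeLeft]

/-- A run with a generous time limit sends the same messages as the short run that already halts. So
the message budget of the short run, which is polynomial, also bounds the long one. -/
theorem Prog.Refines.spends {α β : Type} {R : β → α → Prop} {q : Prog (Option β)}
    {p : Prog (Option α)} (h : Refines R q p) (hq : q.AllResults fun o => o.isSome = true)
    {Q : ℕ → Option β → Prop} {n : ℕ} (hs : q.Spends Q n) :
    p.Spends (fun n o => ∃ b a, o = some a ∧ R b a ∧ Q n (some b)) n := by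
  induction q generalizing p n with
  | ret o =>
    cases o with
    | none => simp [AllResults] at hq
    | some b =>
      obtain ⟨a, rfl, hab⟩ := h
      exact ⟨b, a, rfl, hab, hs⟩
  | coin k ih =>
    obtain ⟨k', rfl, hk⟩ := h
    exact fun b => ih b (hk b) (hq b) (hs b)
  | call v k ih =>
    obtain ⟨k', rfl, hk⟩ := h
    exact ⟨hs.1, fun b => ih b (hk b) (hq b) (hs.2 b)⟩

/-- The same store, and `k` more units of time. -/
def Shift (k : ℕ) (r r' : Store × ℕ) : Prop := r'.1 = r.1 ∧ r'.2 = r.2 + k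

/-- The loop has two limits, on tests and on time. Both may be raised, since the shorter run has
left the loop before either was reached. -/
theorem whileLoop_shift {test : Store → Bool} {body : Store → ℕ → Prog (Option (Store × ℕ))} {k : ℕ}
    (hb : ∀ s t, Refines (Shift k) (body s t) (body s (t + k))) (n m : ℕ) (hnm : n ≤ m)
    (s : Store) (t : ℕ) :
    Refines (Shift k) (whileLoop test body n s t) (whileLoop test body m s (t + k)) := by
  induction n generalizing m s t with
  | zero => trivial
  | succ n ih =>
    obtain ⟨m, rfl⟩ : ∃ m', m = m' + 1 := ⟨m - 1, by omega⟩
    cases t with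
    | zero => trivial
    | succ t =>
      rw [Nat.add_right_comm, whileLoop, whileLoop]
      split
      · refine (hb s t).bindO fun r r' hr => ?_
        rw [hr.1, hr.2]
        exact ih m (by omega) _ _
      · exact ⟨_, rfl, rfl, rfl⟩

theorem Cmd.run_shift (c : Cmd) (k : ℕ) (s : Store) (t : ℕ) :
    Refines (Shift k) (c.run s t) (c.run s (t + k)) := by
  induction c generalizing s t with
  | assign x e =>
    cases t with
    | zero => trivial
    | succ t =>
      rw [Nat.add_right_comm]
      exact ⟨_, rfl, rfl, rfl⟩
  | seq c d ihc ihd =>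
    refine (ihc s t).bindO fun r r' hr => ?_
    rw [hr.1, hr.2]
    exact ihd _ _
  | ite e c d ihc ihd =>
    cases t with
    | zero => trivial
    | succ t =>
      rw [Nat.add_right_comm, Cmd.run, Cmd.run]
      split
      · exact ihc s t
      · exact ihd s t
  | loop e c ih => exact whileLoop_shift ih _ _ (by omega) _ _
  | coin x =>
    cases t with
    | zero => trivial
    | succ t =>
      rw [Nat.add_right_comm]
      exact ⟨_, rfl, fun b => ⟨_, rfl, rfl, rfl⟩⟩
  | call x e =>
    rw [Cmd.run, Cmd.run]
    split
    · rw [if_pos (by omega)]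
      exact ⟨_, rfl, fun r => ⟨_, rfl, rfl, by simp; omega⟩⟩
    · trivial

theorem Cmd.run_refines_of_le (c : Cmd) (s : Store) {t t' : ℕ} (h : t ≤ t') :
    Refines (fun r r' => r'.1 = r.1 ∧ r.2 ≤ r'.2) (c.run s t) (c.run s t') := by
  obtain ⟨k, rfl⟩ := Nat.exists_eq_add_of_le h
  exact (c.run_shift k s t).mono fun r r' hr => ⟨hr.1, by rw [hr.2]; omega⟩

theorem Cmd.runAll_refines_of_le (c : Cmd) (acts : List (Option Val × Val)) (s : Store) {t t' : ℕ}
    (h : t ≤ t') :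
    Refines (fun r r' => r'.1 = r.1 ∧ r.2 ≤ r'.2) (c.runAll acts s t) (c.runAll acts s t') := by
  induction acts generalizing s t t' with
  | nil => exact ⟨_, rfl, rfl, h⟩
  | cons a as ih =>
    refine (c.run_refines_of_le _ h).bindO fun r r' hr => ?_
    rw [hr.1]
    exact ih _ hr.2

/-- With the store `s`, the machine halts in time `T` altogether, when the environment sends
messages of total length at most `n`. -/
def Cmd.Live (c : Cmd) (T n : ℕ) (s : Store) : Prop :=
  ∀ acts : List (Option Val × Val), (acts.map envLength).sum ≤ n →
    (c.runAll acts s T).AllResults fun o => o.isSome = true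

/-- Every continuation after `a`, preceded by `a`, is again an admissible sequence, so it halts in
the time that is left. That time is at most `T`, and more time does no harm; so the allowance is
reset to `T`, and only the message allowance shrinks. -/
theorem Cmd.Live.run {c : Cmd} {T n : ℕ} {s : Store} (h : c.Live T n s) (a : Option Val × Val)
    (ha : envLength a ≤ n) :
    (c.run (Function.update s 0 (activationVal a.1 a.2)) T).AllResults
      fun o => ∃ r, o = some r ∧ c.Live T (n - envLength a) r.1 := by
  have key : (c.run (Function.update s 0 (activationVal a.1 a.2)) T).AllResults
      fun o => ∀ acts : {acts : List (Option Val × Val) //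
        (acts.map envLength).sum ≤ n - envLength a},
        match o with
        | none => False
        | some r => (c.runAll acts.1 r.1 r.2).AllResults fun o => o.isSome = true := by
    rw [allResults_forall]
    rintro ⟨acts, hacts⟩
    have := h (a :: acts) (by simp; omega)
    rw [runAll, allResults_bindO] at this
    refine this.mono fun o ho => ?_
    cases o with
    | none => simp at ho
    | some r => exact ho
  have hle : (c.run (Function.update s 0 (activationVal a.1 a.2)) T).AllResults
      fun o => ∀ r, o = some r → r.2 ≤ T := by
    have := c.run_spends (Function.update s 0 (activationVal a.1 a.2)) T
    generalize c.run (Function.update s 0 (activationVal a.1 a.2)) T = p at this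
    have gen : ∀ (p : Prog (Option (Store × ℕ))) (m : ℕ), m ≤ T → p.Spends TimeLeft m →
        p.AllResults fun o => ∀ r, o = some r → r.2 ≤ T := by
      intro p
      induction p with
      | ret o => exact fun m hm h r hr => (h r hr).trans hm
      | coin k ih => exact fun m hm h b => ih b m hm (h b)
      | call v k ih => exact fun m hm h b => ih b _ (by omega) (h.2 b)
    exact gen p T le_rfl this
  refine (allResults_and.2 ⟨key, hle⟩).mono fun o ho => ?_
  cases o with
  -- The empty continuation already excludes a timeout in the present activation.
  | none => exact (ho.1 ⟨[], by simp⟩).elim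
  | some r =>
    refine ⟨r, rfl, fun acts hacts => ?_⟩
    exact (c.runAll_refines_of_le acts r.1 (ho.2 r rfl)).isSome (ho.1 ⟨acts, hacts⟩)

theorem Cmd.Live.run_of_le {c : Cmd} {T n : ℕ} {s : Store} (h : c.Live T n s)
    (a : Option Val × Val) (ha : envLength a ≤ n) {t : ℕ} (ht : T ≤ t) :
    (c.run (Function.update s 0 (activationVal a.1 a.2)) t).AllResults
      fun o => ∃ r, o = some r ∧ c.Live T (n - envLength a) r.1 := by
  have h1 : (c.run (Function.update s 0 (activationVal a.1 a.2)) T).AllResults fun o =>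
      ∃ r, o = some r ∧ c.Live T (n - envLength a) r.1 := h.run a ha
  refine ((c.run_refines_of_le _ ht).allResults h1).mono ?_
  rintro o ⟨b, r, rfl, ⟨hr, -⟩, hl⟩
  exact ⟨r, rfl, hr ▸ hl⟩

theorem eval_mono (p : Polynomial ℕ) {a b : ℕ} (h : a ≤ b) : p.eval a ≤ p.eval b := by
  induction p using Polynomial.induction_on' with
  | add p q hp hq => simpa using add_le_add hp hq
  | monomial n c => simpa using Nat.mul_le_mul le_rfl (Nat.pow_le_pow_left h n)

theorem Cmd.IsPPT.exists_live {c : Cmd} (h : c.IsPPT) :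
    ∃ p : Polynomial ℕ, ∀ μ n, c.Live (p.eval (μ + n)) n (initStore μ .nil) := by
  obtain ⟨p, hp⟩ := h
  refine ⟨p, fun μ n acts hacts => ?_⟩
  exact (c.runAll_refines_of_le acts _ (eval_mono p (by omega))).isSome (hp μ acts)

/-! ## Executions and time limits -/

section
variable {σ : Type} (W : World σ)

/-- The state `none` is absorbing, so after a timeout nothing contributes any more. -/
theorem expect_interp_turn_none (adv : Cmd) (t : ℕ) {β : Type} (q : Prog β)
    (h : β × Option (σ × Store) → ℝ≥0∞) (h0 : ∀ b, h (b, none) = 0) :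
    expect (q.interp (turn W adv t) none) h = 0 := by
  induction q with
  | ret a => simp [h0]
  | coin k ih => simp [ih]
  | call v k ih => simp [turn, ih]

theorem expect_activate (adv : Cmd) (t : ℕ) (w : σ) (st : Store) (m : Option Val) (notes : Val)
    (out : Option Bool) (f : Val × Option (σ × Store) → ℝ≥0∞) (hf : f (.nil, none) = 0) :
    expect (activate W adv t w st m notes out) f
      = expect ((adv.run (Function.update st 0 (activationVal m notes)) t).interp W.call w)
          fun x => liftO (fun r : Store × ℕ =>
            f (.node (outputVal out) (r.1 0), some (x.2, r.1))) x.1 := by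
  rw [activate, expect_bind]
  congr 1; ext x
  rcases x with ⟨_ | r, w'⟩ <;> simp [hf]

theorem expect_turn_mono (adv : Cmd) {t t' : ℕ} (ht : t ≤ t') (x : Option (σ × Store)) (v : Val)
    {f f' : Val × Option (σ × Store) → ℝ≥0∞} (hf : ∀ r, f (r, none) = 0)
    (hf' : ∀ r, f' (r, none) = 0) (hff : ∀ a, f a ≤ f' a) :
    expect (turn W adv t x v) f ≤ expect (turn W adv t' x v) f' := by
  have hact : ∀ w st m notes out, expect (activate W adv t w st m notes out) f
      ≤ expect (activate W adv t' w st m notes out) f' := by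
    intro w st m notes out
    rw [expect_activate _ _ _ _ _ _ _ _ _ (hf _), expect_activate _ _ _ _ _ _ _ _ _ (hf' _)]
    refine (adv.run_refines_of_le _ ht).expect_le
      (H := fun r w' => f (.node (outputVal out) (r.1 0), some (w', r.1)))
      (H' := fun r w' => f' (.node (outputVal out) (r.1 0), some (w', r.1))) _ ?_ _
    intro r r' hr s
    rw [hr.1]
    exact hff _
  cases x with
  | none => simp [turn, hf]
  | some x =>
    obtain ⟨w, st⟩ := x
    simp only [turn]
    split
    · exact hact _ _ _ _ _
    · rw [expect_bind, expect_bind]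
      exact expect_mono _ fun _ => hact _ _ _ _ _

theorem expect_interp_turn_mono (adv : Cmd) {t t' : ℕ} (ht : t ≤ t') {α β : Type}
    {R : β → α → Prop} {q : Prog (Option β)} {p : Prog (Option α)} (h : Refines R q p)
    {H : β → σ × Store → ℝ≥0∞} {H' : α → σ × Store → ℝ≥0∞}
    (hH : ∀ b a, R b a → ∀ s, H b s ≤ H' a s) (x : Option (σ × Store)) :
    expect (q.interp (turn W adv t) x) (fun y => liftO (fun b => liftO (H b) y.2) y.1)
      ≤ expect (p.interp (turn W adv t') x) (fun y => liftO (fun b => liftO (H' b) y.2) y.1) := by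
  have hz : ∀ {γ : Type} (K : γ → σ × Store → ℝ≥0∞) (b : Option γ),
      liftO (fun b => liftO (K b) (none : Option (σ × Store))) b = 0 := by
    intro γ K b; cases b <;> rfl
  induction q generalizing p x with
  | ret o =>
    cases o with
    | none => simp
    | some b =>
      obtain ⟨a, rfl, hab⟩ := h
      cases x with
      | none => simp
      | some x => simpa using hH _ _ hab x
  | coin k ih =>
    obtain ⟨k', rfl, hk⟩ := h
    simp only [expect_interp_coin]
    gcongr <;> exact ih _ (hk _) x
  | call v k ih =>
    obtain ⟨k', rfl, hk⟩ := h
    simp only [expect_interp_call]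
    refine expect_turn_mono W adv ht x v ?_ ?_ ?_
    · exact fun r => expect_interp_turn_none W adv t _ _ (hz _)
    · exact fun r => expect_interp_turn_none W adv t' _ _ (hz _)
    · exact fun a => ih _ (hk _) _

theorem expect_exec (env adv : Cmd) (μ : ℕ) (z : Bits) (t : ℕ) (H : Bool × σ → ℝ≥0∞) :
    expect (exec W env adv μ z t) (liftO H)
      = expect ((env.run (initStore μ (.ofBits z)) t).interp (turn W adv t)
          (some (W.start, initStore μ .nil)))
          fun y => liftO (fun r : Store × ℕ => liftO (fun ws : σ × Store =>
            H ((r.1 0).toBool, ws.1)) y.2) y.1 := by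
  rw [exec, expect_bind]
  congr 1; ext x
  rcases x with ⟨_ | r, _ | ws⟩ <;> simp

theorem expect_exec_mono (env adv : Cmd) (μ : ℕ) (z : Bits) (H : Bool × σ → ℝ≥0∞) :
    Monotone fun t => expect (exec W env adv μ z t) (liftO H) := by
  intro t t' ht
  simp only [expect_exec]
  exact expect_interp_turn_mono W adv ht (env.run_refines_of_le _ ht)
    (H := fun r ws => H ((r.1 0).toBool, ws.1)) (H' := fun r ws => H ((r.1 0).toBool, ws.1))
    (fun b a hab s => by rw [hab.1]) _

open Classical in
theorem toOuterMeasure_exec (env adv : Cmd) (μ : ℕ) (z : Bits) (t : ℕ) (E : Bool → σ → Prop) :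
    (exec W env adv μ z t).toOuterMeasure {o | ∃ b w, o = some (b, w) ∧ E b w}
      = expect (exec W env adv μ z t) (liftO fun x => if E x.1 x.2 then 1 else 0) := by
  rw [toOuterMeasure_eq_expect]
  congr 1; ext o
  rcases o with _ | ⟨_ | _, w⟩ <;> simp [Set.indicator_apply]

-- The expectations increase with the time limit, so omitting finitely many limits does not change
-- the supremum. This permits choosing `T` beyond the running times of all machines involved.
open Classical in
theorem execProb_eq_iSup (env adv : Cmd) (μ : ℕ) (z : Bits) (E : Bool → σ → Prop) (T : ℕ) :
    execProb W env adv μ z E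
      = (⨆ t : ℕ, expect (exec W env adv μ z (t + T))
          (liftO fun x => if E x.1 x.2 then 1 else 0)).toReal := by
  rw [execProb]
  congr 1
  simp only [toOuterMeasure_exec]
  exact ((expect_exec_mono W env adv μ z _).iSup_nat_add T).symm

end
end MadHtlc

set_option linter.unusedSimpArgs false
namespace MadHtlc
open scoped ENNReal
open Prog

/-! ## The reduced world -/

/-- How far the session has proceeded. -/
inductive Stage where
  | start | digests | created | published | initiated
  deriving DecidableEq

namespace Stage

def hasDig : Stage → Bool
  | start => false
  | _ => true

def hasTx : Stage → Bool
  | start | digests => false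
  | _ => true

def hasPub : Stage → Bool
  | published | initiated => true
  | _ => false

def hasInit : Stage → Bool
  | initiated => true
  | _ => false

/-- Honest A and honest B change phase at the same moments, because the functionality notifies both
at once. M follows a rule of its own in `Red.expand`. -/
def phase : Stage → Phase
  | start | digests => .setup
  | created | published => .initiation
  | initiated => .redeeming

/-- The stage after (another) creation of the transaction. -/
def afterSetupA : Stage → Stage
  | digests => created
  | s => s

end Stage

/-- The part of the state of the hybrid world from which everything else can be computed: `d1`,
`d2` are the digests (from stage `digests` on), `pa`, `pb` the preimages drawn by honest `B`, and
`apre` is what honest `A` has accepted. -/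
structure Red where
  mu : ℕ
  table : Table
  stage : Stage
  d1 : Bits
  d2 : Bits
  pa : Bits
  pb : Bits
  shared : Bool
  apre : Option Bits
  pubA : Bool
  pubB : Bool
  log : List RedeemTx

namespace Red

def start (μ : ℕ) : Red where
  mu := μ
  table := []
  stage := .start
  d1 := []
  d2 := []
  pa := []
  pb := []
  shared := false
  apre := none
  pubA := false
  pubB := false
  log := []

def digO (s : Red) : Option (Bits × Bits) := if s.stage.hasDig then some (s.d1, s.d2) else none

def txO (s : Red) : Option Tx := if s.stage.hasTx then some ⟨s.d1, s.d2⟩ else none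

/-- The indicator whether the first preimage was shared. -/
def sharedInd (corr : Finset Party) (s : Red) : Bool :=
  if Party.A ∈ corr then (if Party.B ∈ corr then true else s.shared) else s.apre.isSome

/-- The state of the hybrid world. -/
def expand (corr : Finset Party) (s : Red) : HState where
  table := s.table
  g := ⟨s.digO, s.txO, s.stage.hasPub, s.stage.hasInit, s.pubA, s.pubB⟩
  a := if Party.A ∈ corr then ⟨.setup, none, none, s.apre⟩
    else ⟨s.stage.phase, s.digO, s.txO, s.apre⟩
  b := if Party.B ∈ corr then ⟨.setup, none, none, s.shared⟩
    else ⟨s.stage.phase, if s.stage.hasDig then some (s.pa, s.pb) else none, s.txO, s.shared⟩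
  m := if Party.M ∈ corr then ⟨.initiation, none⟩
    else ⟨if s.stage.hasInit then .redeeming else .initiation,
      if s.stage.hasPub then s.txO else none⟩
  log := s.log

/-- The corresponding state of the ideal functionality. -/
def ideal (corr : Finset Party) (s : Red) : FState where
  setupA := s.stage.hasTx
  setupB := s.stage.hasDig
  shared := if Party.A ∈ corr then s.shared else s.apre.isSome
  published := s.stage.hasPub
  init := s.stage.hasInit
  pubA := s.pubA
  pubB := s.pubB

/-- The first preimage, as far as the honest party has it. -/
def preA (s : Red) : Party → Option Bits
  | .A => s.apre
  | .B => some s.pa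
  | .M => none

/-- The second preimage, as far as the honest party has it. -/
def preB (s : Red) : Party → Option Bits
  | .B => some s.pb
  | _ => none

/-- The effect of a redeeming transaction. -/
def redeem (corr : Finset Party) (s : Red) (P : Party) (path : RPath) (h1 h2 : Bool) : Red :=
  { s with
    pubA := s.pubA || h1
    pubB := s.pubB || h2
    log := ⟨P, path, s.pubA, s.pubB, s.sharedInd corr,
      rPredicate path P (s.pubA || h1) (s.pubB || h2), s.pubA || h1, s.pubB || h2⟩ :: s.log }

end Red

/-- Sampling of bits. -/
def drawP : ℕ → Prog Bits
  | 0 => .ret []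
  | n + 1 => .coin fun b => (drawP n).bind fun bs => .ret (b :: bs)

/-- The random oracle. -/
def hashP (μ : ℕ) (T : Table) (q : Bits) : Prog (Bits × Table) :=
  match T.lookup q with
  | some r => .ret (r, T)
  | none => (drawP μ).bind fun r => .ret (r, (q, r) :: T)

/-- The test whether an optional value is a preimage. -/
def preimageP (μ : ℕ) (T : Table) (x : Option Bits) (d : Bits) : Prog (Bool × Table) :=
  match x with
  | none => .ret (false, T)
  | some x => (hashP μ T x).bind fun r => .ret (decide (r.1 = d), r.2)

/-- The messages to the corrupted parties. -/
def toCorrupt (corr : Finset Party) : List (Party × GMsg) → List Note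
  | [] => []
  | x :: xs => if x.1 ∈ corr then .toParty x.1 x.2 :: toCorrupt corr xs else toCorrupt corr xs

/-- What the adversary sees when the functionality leaks `l` and sends the messages `ms`. -/
def noteVal (corr : Finset Party) (l : Leak) (ms : List (Party × GMsg)) : Val :=
  notesVal (.leak l :: toCorrupt corr ms)

def setupBNote (corr : Finset Party) (d1 d2 : Bits) : Val :=
  noteVal corr (.setupB d1 d2) [(.A, .setupB d1 d2)]

def setupANote (corr : Finset Party) (t : Tx) : Val :=
  noteVal corr .setupA [(.A, .tx t), (.B, .tx t)]

def publishNote (corr : Finset Party) (t : Tx) : Val :=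
  noteVal corr (.publish t) [(.A, .publish t), (.B, .publish t), (.M, .publish t)]

def initNote (corr : Finset Party) (t : Tx) : Val :=
  noteVal corr (.init t) [(.A, .init t), (.B, .init t), (.M, .init t)]

def redeemNote (corr : Finset Party) (p1 p2 : Option Bits) (d1 d2 : Bits) (path : RPath)
    (P : Party) (pubA pubB : Bool) : Val :=
  noteVal corr (.redeem p1 p2 d1 d2 path P pubA pubB (rPredicate path P pubA pubB))
    [(P, .res (rPredicate path P pubA pubB))]

def inputReq (P : Party) (i : PInput) : Val := .tag 0 (.node P.toVal i.toVal)

/-- Send a message and forget the answer. -/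
def tell (v : Val) : Prog Unit := .call v fun _ => .ret ()

def tellIf (b : Bool) (v : Val) : Prog Unit := if b then tell v else .ret ()

def updateAReq : Val := .tag 1 .nil
def updateBReq : Val := .tag 2 .nil

section
variable (corr : Finset Party)

/-- A redeeming transaction by a corrupted party. -/
def redRedeem (s : Red) (P : Party) (t : Tx) (p1 p2 : Option Bits) (path : RPath) :
    Prog (Val × Red) :=
  if s.stage = .initiated ∧ t = ⟨s.d1, s.d2⟩ then
    (preimageP s.mu s.table p1 s.d1).bind fun h1 =>
    (preimageP s.mu h1.2 p2 s.d2).bind fun h2 =>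
    (tellIf (s.pubA || h1.1) updateAReq).bind fun _ =>
    (tellIf (s.pubB || h2.1) updateBReq).bind fun _ =>
    .ret (redeemNote corr p1 p2 s.d1 s.d2 path P (s.pubA || h1.1) (s.pubB || h2.1),
      { s with table := h2.2 }.redeem corr P path h1.1 h2.1)
  else .ret (.nil, s)

/-- A request of a corrupted party to the functionality in the reduced world. What concerns the
ideal functionality is forwarded to it. -/
def redSend (s : Red) (P : Party) : GReq → Prog (Val × Red)
  | .setupB d1 d2 =>
      if P = .B ∧ s.stage = .start then
        (tell (inputReq .B .setupB)).bind fun _ =>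
        .ret (setupBNote corr d1 d2, { s with stage := .digests, d1 := d1, d2 := d2 })
      else .ret (.nil, s)
  | .setupA =>
      if P = .A ∧ s.stage ≠ .start then
        (tell (inputReq .A .setupA)).bind fun _ =>
        .ret (setupANote corr ⟨s.d1, s.d2⟩, { s with stage := s.stage.afterSetupA })
      else .ret (.nil, s)
  | .publish t =>
      if P ≠ .M ∧ s.stage = .created ∧ t = ⟨s.d1, s.d2⟩ then
        (tell (inputReq P .publish)).bind fun _ =>
        .ret (publishNote corr t, { s with stage := .published })
      else .ret (.nil, s)
  | .init t =>
      if P = .M ∧ s.stage.hasPub = true ∧ t = ⟨s.d1, s.d2⟩ then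
        (tell (inputReq .M .init)).bind fun _ =>
        .ret (initNote corr t, { s with stage := .initiated })
      else .ret (.nil, s)
  | .redeem t p1 p2 path => redRedeem corr s P t p1 p2 path

/-- Corrupted `B` sends a value to honest `A`. -/
def redShare (s : Red) (x : Bits) : Prog (Val × Red) :=
  if s.stage.phase = .initiation then
    (hashP s.mu s.table x).bind fun r =>
    (tellIf (decide (r.1 = s.d1)) (inputReq .B .share)).bind fun _ =>
    .ret (.nil, { s with table := r.2, apre := if r.1 = s.d1 then some x else s.apre })
  else .ret (.nil, s)

def redHash (s : Red) (q : Bits) : Prog (Val × Red) :=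
  (hashP s.mu s.table q).bind fun r => .ret (.ofBits r.1, { s with table := r.2 })

/-- A message of the adversary in the reduced world. -/
def redCall (s : Red) (v : Val) : Prog (Val × Red) :=
  match AdvReq.ofVal v with
  | .hash q => redHash s q
  | .send P r => if P ∈ corr then redSend corr s P r else .ret (.nil, s)
  | .share x => if Party.B ∈ corr ∧ Party.A ∉ corr then redShare s x else .ret (.nil, s)

def FLeak.ofVal (v : Val) : FLeak :=
  match v.fst.len with
  | 0 => setupB
  | 1 => setupA
  | 2 => share
  | 3 => publish
  | 4 => init
  | _ => redeem (.ofVal v.snd.fst) (.ofVal v.snd.snd)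

/-- Honest `B` draws the preimages. -/
def redSetupB (s : Red) : Prog (Val × Red) :=
  (drawP s.mu).bind fun a =>
  (drawP s.mu).bind fun b =>
  (hashP s.mu s.table a).bind fun ha =>
  (hashP s.mu ha.2 b).bind fun hb =>
  .ret (setupBNote corr ha.1 hb.1,
    { s with table := hb.2, stage := .digests, d1 := ha.1, d2 := hb.1, pa := a, pb := b })

/-- A redeeming transaction by an honest party. -/
def redHonestRedeem (s : Red) (path : RPath) (P : Party) : Val × Red :=
  let p1 := if path.usesA then s.preA P else none
  let p2 := if path.usesB then s.preB P else none
  (redeemNote corr p1 p2 s.d1 s.d2 path P (s.pubA || p1.isSome) (s.pubB || p2.isSome),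
    s.redeem corr P path p1.isSome p2.isSome)

/-- What an input to an honest party causes in the reduced world, given what the ideal
functionality leaks. -/
def redLeak (s : Red) : FLeak → Prog (Val × Red)
  | .setupB => redSetupB corr s
  | .setupA => .ret (setupANote corr ⟨s.d1, s.d2⟩, { s with stage := .created })
  | .share =>
      if Party.A ∈ corr then .ret (notesVal [.share s.pa], { s with shared := true })
      else .ret (notesVal [.sent], { s with shared := true, apre := some s.pa })
  | .publish => .ret (publishNote corr ⟨s.d1, s.d2⟩, { s with stage := .published })
  | .init => .ret (initNote corr ⟨s.d1, s.d2⟩, { s with stage := .initiated })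
  | .redeem path P => .ret (redHonestRedeem corr s path P)

/-- An activation of the adversary in the reduced world, given the notes of the ideal world. -/
def redInput (s : Red) (notes : Val) : Prog (Val × Red) :=
  if notes = .nil then .ret (.nil, s)
  else if notes.fst.fst = .nil then redLeak corr s (FLeak.ofVal notes.fst.snd)
  else .ret (.node (.tag 4 notes.fst.snd) .nil, s)

end

/-! ### Laws of the sampling routines -/

theorem expect_drawBits (n : ℕ) (h : Bits → ℝ≥0∞) : expect (drawBits n) h = (drawP n).avg h := by
  induction n generalizing h with
  | zero => simp [drawBits, drawP]
  | succ n ih => simp [drawBits, drawP, expect_bind, expect_fairCoin, ih, avg_bind]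

theorem expect_hash (μ : ℕ) (T : Table) (q : Bits) (h : Bits × Table → ℝ≥0∞) :
    expect (hash μ T q) h = (hashP μ T q).avg h := by
  unfold hash hashP
  cases T.lookup q <;> simp [expect_bind, expect_drawBits, avg_bind]

theorem expect_isPreimage (μ : ℕ) (T : Table) (x : Option Bits) (d : Bits)
    (h : Bool × Table → ℝ≥0∞) :
    expect (isPreimage μ T x d) h = (preimageP μ T x d).avg h := by
  cases x <;> simp [isPreimage, preimageP, expect_bind, expect_hash, avg_bind]

section
variable {σ : Type} (O : σ → Val → PMF (Val × σ))

theorem expect_interp_drawP (n : ℕ) (f : σ) (h : Bits × σ → ℝ≥0∞) :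
    expect ((drawP n).interp O f) h = (drawP n).avg fun b => h (b, f) := by
  induction n generalizing h with
  | zero => simp [drawP]
  | succ n ih => simp [drawP, expect_interp_bind, ih, avg_bind]

theorem expect_interp_hashP (μ : ℕ) (T : Table) (q : Bits) (f : σ)
    (h : (Bits × Table) × σ → ℝ≥0∞) :
    expect ((hashP μ T q).interp O f) h = (hashP μ T q).avg fun r => h (r, f) := by
  unfold hashP
  cases T.lookup q <;> simp [expect_interp_bind, expect_interp_drawP, avg_bind]

theorem expect_interp_preimageP (μ : ℕ) (T : Table) (x : Option Bits) (d : Bits) (f : σ)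
    (h : (Bool × Table) × σ → ℝ≥0∞) :
    expect ((preimageP μ T x d).interp O f) h = (preimageP μ T x d).avg fun r => h (r, f) := by
  cases x <;> simp [preimageP, expect_interp_bind, expect_interp_hashP, avg_bind]

end

/-! ### The adversary's messages in the hybrid world -/

section
variable (corr : Finset Party)

theorem Red.expand_shared (s : Red) : (s.expand corr).shared corr = s.sharedInd corr := by
  by_cases hA : Party.A ∈ corr <;> by_cases hB : Party.B ∈ corr <;>
    simp [expand, HState.shared, sharedInd, hA, hB]

theorem expect_send_setupB (μ : ℕ) (s : Red) (P : Party) (hP : P ∈ corr) (d1 d2 : Bits)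
    (H : Val × HState → ℝ≥0∞) :
    expect (send corr μ (s.expand corr) P (.setupB d1 d2)) (fun x => H (notesVal x.2.1, x.2.2))
      = (redSend corr s P (.setupB d1 d2)).avg fun r => H (r.1, r.2.expand corr) := by
  obtain ⟨mu, T, st, e1, e2, pa, pb, sh, apre, pubA, pubB, log⟩ := s
  cases P <;> cases st <;> by_cases hA : Party.A ∈ corr <;>
    simp_all [send, gStep, expect_bind, redSend, Red.expand, Red.digO, Red.txO, Stage.hasDig,
      Stage.hasTx, Stage.hasPub, Stage.hasInit, Stage.phase, deliver, receive, tell, setupBNote,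
      noteVal, toCorrupt, notesVal, Val.ofList]

theorem expect_send_setupA (μ : ℕ) (s : Red) (P : Party) (hP : P ∈ corr)
    (H : Val × HState → ℝ≥0∞) :
    expect (send corr μ (s.expand corr) P .setupA) (fun x => H (notesVal x.2.1, x.2.2))
      = (redSend corr s P .setupA).avg fun r => H (r.1, r.2.expand corr) := by
  obtain ⟨mu, T, st, e1, e2, pa, pb, sh, apre, pubA, pubB, log⟩ := s
  cases P <;> cases st <;> by_cases hA : Party.A ∈ corr <;> by_cases hB : Party.B ∈ corr <;>
    simp_all [send, gStep, expect_bind, redSend, Red.expand, Red.digO, Red.txO, Stage.hasDig,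
      Stage.hasTx, Stage.hasPub, Stage.hasInit, Stage.phase, deliver, receive, tell, setupANote,
      noteVal, toCorrupt, notesVal, Val.ofList, Stage.afterSetupA]

theorem expect_send_publish (μ : ℕ) (s : Red) (P : Party) (hP : P ∈ corr) (t : Tx)
    (H : Val × HState → ℝ≥0∞) :
    expect (send corr μ (s.expand corr) P (.publish t)) (fun x => H (notesVal x.2.1, x.2.2))
      = (redSend corr s P (.publish t)).avg fun r => H (r.1, r.2.expand corr) := by
  obtain ⟨mu, T, st, e1, e2, pa, pb, sh, apre, pubA, pubB, log⟩ := s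
  by_cases ht : t = ⟨e1, e2⟩
  · subst ht
    cases P <;> cases st <;> by_cases hA : Party.A ∈ corr <;> by_cases hB : Party.B ∈ corr <;>
      by_cases hM : Party.M ∈ corr <;>
      simp_all [send, gStep, expect_bind, redSend, Red.expand, Red.digO, Red.txO, Stage.hasDig,
        Stage.hasTx, Stage.hasPub, Stage.hasInit, Stage.phase, deliver, receive, tell, publishNote,
        noteVal, toCorrupt, notesVal, Val.ofList]
  · have ht' : ¬ (⟨e1, e2⟩ : Tx) = t := fun h => ht h.symm
    cases st <;> simp [send, gStep, expect_bind, redSend, Red.expand, Red.txO, ht, ht', deliver,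
      notesVal, Val.ofList, Stage.hasTx]

theorem expect_send_init (μ : ℕ) (s : Red) (P : Party) (hP : P ∈ corr) (t : Tx)
    (H : Val × HState → ℝ≥0∞) :
    expect (send corr μ (s.expand corr) P (.init t)) (fun x => H (notesVal x.2.1, x.2.2))
      = (redSend corr s P (.init t)).avg fun r => H (r.1, r.2.expand corr) := by
  obtain ⟨mu, T, st, e1, e2, pa, pb, sh, apre, pubA, pubB, log⟩ := s
  by_cases ht : t = ⟨e1, e2⟩
  · subst ht
    cases P <;> cases st <;> by_cases hA : Party.A ∈ corr <;> by_cases hB : Party.B ∈ corr <;>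
      by_cases hM : Party.M ∈ corr <;>
      simp_all [send, gStep, expect_bind, redSend, Red.expand, Red.digO, Red.txO, Stage.hasDig,
        Stage.hasTx, Stage.hasPub, Stage.hasInit, Stage.phase, deliver, receive, tell, initNote,
        noteVal, toCorrupt, notesVal, Val.ofList]
  · have ht' : ¬ (⟨e1, e2⟩ : Tx) = t := fun h => ht h.symm
    cases st <;> simp [send, gStep, expect_bind, redSend, Red.expand, Red.txO, ht, ht', deliver,
      notesVal, Val.ofList, Stage.hasTx]

theorem avg_tellIf (b : Bool) (v : Val) (h : Unit → ℝ≥0∞) : (tellIf b v).avg h = h () := by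
  cases b <;> rfl

theorem expect_send_redeem (μ : ℕ) (s : Red) (hs : s.mu = μ) (P : Party) (hP : P ∈ corr) (t : Tx)
    (p1 p2 : Option Bits) (path : RPath) (H : Val × HState → ℝ≥0∞) :
    expect (send corr μ (s.expand corr) P (.redeem t p1 p2 path))
        (fun x => H (notesVal x.2.1, x.2.2))
      = (redSend corr s P (.redeem t p1 p2 path)).avg fun r => H (r.1, r.2.expand corr) := by
  have hsh := s.expand_shared corr
  obtain ⟨mu, T, st, e1, e2, pa, pb, sh, apre, pubA, pubB, log⟩ := s
  subst hs
  by_cases ht : t = ⟨e1, e2⟩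
  · subst ht
    cases st
    case initiated =>
      simp only [send, gStep, redSend, redRedeem, hsh, expect_bind, avg_bind, avg_tellIf]
      simp only [Red.expand, Red.digO, Red.txO, Stage.hasDig, Stage.hasTx, Stage.hasPub,
        Stage.hasInit, Stage.phase, if_true, and_self, expect_bind, expect_isPreimage, expect_pure,
        avg_bind, avg_tellIf, avg_ret, deliver, hP, List.map_cons, List.map_nil, redeemNote,
        noteVal, toCorrupt, Red.redeem, Red.sharedInd, List.cons_append, List.nil_append]
    all_goals
      simp [send, gStep, expect_bind, redSend, redRedeem, Red.expand, Red.txO, Red.digO, deliver,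
        notesVal, Val.ofList, Stage.hasTx, Stage.hasInit, Stage.hasDig]
  · have ht' : ¬ (⟨e1, e2⟩ : Tx) = t := fun h => ht h.symm
    cases st <;> simp [send, gStep, expect_bind, redSend, redRedeem, Red.expand, Red.txO, Red.digO,
      ht, ht', deliver, notesVal, Val.ofList, Stage.hasTx, Stage.hasDig]

theorem expect_send (μ : ℕ) (s : Red) (hs : s.mu = μ) (P : Party) (hP : P ∈ corr) (r : GReq)
    (H : Val × HState → ℝ≥0∞) :
    expect (send corr μ (s.expand corr) P r) (fun x => H (notesVal x.2.1, x.2.2))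
      = (redSend corr s P r).avg fun r => H (r.1, r.2.expand corr) := by
  cases r with
  | setupB d1 d2 => exact expect_send_setupB corr μ s P hP d1 d2 H
  | setupA => exact expect_send_setupA corr μ s P hP H
  | publish t => exact expect_send_publish corr μ s P hP t H
  | init t => exact expect_send_init corr μ s P hP t H
  | redeem t p1 p2 path => exact expect_send_redeem corr μ s hs P hP t p1 p2 path H

/-- The messages that `redCall` sends to the ideal functionality are sent by `tell`, which discards
the answers. So `avg`, which answers them by `nil`, gives the genuine law of the hybrid world. -/
theorem expect_hybridCall (μ : ℕ) (s : Red) (hs : s.mu = μ) (v : Val) (H : Val × HState → ℝ≥0∞) :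
    expect (hybridCall corr μ (s.expand corr) v) H
      = (redCall corr s v).avg fun r => H (r.1, r.2.expand corr) := by
  unfold hybridCall redCall
  cases AdvReq.ofVal v with
  | hash q => simp [redHash, expect_bind, expect_hash, avg_bind, hs, Red.expand, Red.digO, Red.txO]
  | send P r =>
    by_cases hP : P ∈ corr
    · simp only [hP, if_true, expect_bind, expect_pure]
      exact expect_send corr μ s hs P hP r H
    · simp [hP]
  | share x =>
    by_cases h : Party.B ∈ corr ∧ Party.A ∉ corr
    · obtain ⟨hB, hA⟩ := h
      obtain ⟨mu, T, st, e1, e2, pa, pb, sh, apre, pubA, pubB, log⟩ := s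
      subst hs
      cases st <;> simp [hA, hB, redShare, receiveShare, Red.expand, expect_bind, avg_bind,
        avg_tellIf, Red.digO, Red.txO, Stage.phase, Stage.hasDig, Stage.hasTx, Stage.hasPub,
        Stage.hasInit, expect_isPreimage, preimageP]
    · simp [h]

end
end MadHtlc

set_option linter.unusedSimpArgs false
namespace MadHtlc
open scoped ENNReal
open Prog

/-! ### The invariant -/

/-- What holds for all recorded redeeming transactions. -/
structure RedeemTx.Exact (corr : Finset Party) (r : RedeemTx) : Prop where
  valid : r.valid = rPredicate r.path r.party r.pubAAfter r.pubBAfter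
  shared : Party.A ∈ corr → Party.B ∈ corr → r.shared = true
  honest : r.party ∉ corr → r.valid = canRedeem r.pubA r.pubB r.shared r.party r.path

/-- `preB` and `preA` make the oracle checks of honest parties deterministic. `early` keeps `preA`
vacuous while the digests can still be set. `shared` identifies the flag of honest B with acceptance
by honest A, which is the bit that `Red.ideal` reads. The exactness of the log is not needed for the
simulation; the second and third claims use it. -/
structure Red.Inv (corr : Finset Party) (μ : ℕ) (s : Red) : Prop where
  mu : s.mu = μ
  early : s.stage.hasTx = false → s.apre = none ∧ s.shared = false
  preB : Party.B ∉ corr → s.stage.hasDig = true →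
    s.table.lookup s.pa = some s.d1 ∧ s.table.lookup s.pb = some s.d2
  preA : Party.A ∉ corr → ∀ x, s.apre = some x → s.table.lookup x = some s.d1
  shared : Party.A ∉ corr → Party.B ∉ corr → s.apre = if s.shared then some s.pa else none
  log : ∀ r ∈ s.log, r.Exact corr

/-- The second table answers at least what the first one answers, and has at most `k` more
entries. -/
structure Table.Extends (T T' : Table) (k : ℕ) : Prop where
  lookup : ∀ x d, T.lookup x = some d → T'.lookup x = some d
  length : T'.length ≤ T.length + k

theorem Table.Extends.refl (T : Table) (k : ℕ) : T.Extends T k := ⟨fun _ _ h => h, by omega⟩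

theorem Table.Extends.trans {T T' T'' : Table} {k l : ℕ} (h : T.Extends T' k)
    (h' : T'.Extends T'' l) : T.Extends T'' (k + l) :=
  ⟨fun x d hx => h'.lookup x d (h.lookup x d hx), by have := h.length; have := h'.length; omega⟩

theorem hashP_results (μ : ℕ) (T : Table) (q : Bits) :
    (hashP μ T q).AllResults fun r => r.2.lookup q = some r.1 ∧ T.Extends r.2 1 := by
  unfold hashP
  cases h : T.lookup q with
  | some r => exact ⟨h, .refl _ _⟩
  | none =>
    rw [allResults_bind]
    refine allResults_of_forall _ fun r => ⟨by simp [List.lookup], ⟨fun x d hx => ?_, by simp⟩⟩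
    have : (x == q) = false := by
      rw [beq_eq_false_iff_ne]
      rintro rfl
      simp [h] at hx
    simp [List.lookup, this, hx]

theorem preimageP_results (μ : ℕ) (T : Table) (x : Option Bits) (d : Bits) :
    (preimageP μ T x d).AllResults fun r => T.Extends r.2 1 := by
  cases x with
  | none => exact .refl _ _
  | some x =>
    rw [preimageP, allResults_bind]
    exact (hashP_results μ T x).mono fun r hr => hr.2

theorem allResults_tell {P : Unit → Prop} {v : Val} : (tell v).AllResults P ↔ P () :=
  ⟨fun h => h .nil, fun h _ => h⟩

theorem allResults_tellIf {P : Unit → Prop} {b : Bool} {v : Val} :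
    (tellIf b v).AllResults P ↔ P () := by
  cases b
  · exact Iff.rfl
  · exact allResults_tell

section
variable {corr : Finset Party}

theorem Red.Inv.start (μ : ℕ) : (Red.start μ).Inv corr μ := by
  constructor <;> simp [Red.start, Stage.hasTx, Stage.hasDig]

theorem Red.Inv.extend {μ : ℕ} {s : Red} (h : s.Inv corr μ) {T : Table} {k : ℕ}
    (hT : Table.Extends s.table T k) : ({ s with table := T } : Red).Inv corr μ where
  mu := h.mu
  early := h.early
  preB hB hd := ⟨hT.lookup _ _ (h.preB hB hd).1, hT.lookup _ _ (h.preB hB hd).2⟩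
  preA hA x hx := hT.lookup _ _ (h.preA hA x hx)
  shared := h.shared
  log := h.log

theorem Red.Inv.redeem {μ : ℕ} {s : Red} (h : s.Inv corr μ) {P : Party} {path : RPath}
    {h1 h2 : Bool} (hP : P ∉ corr → rPredicate path P (s.pubA || h1) (s.pubB || h2)
      = canRedeem s.pubA s.pubB (s.sharedInd corr) P path) :
    (s.redeem corr P path h1 h2).Inv corr μ where
  mu := h.mu
  early := h.early
  preB := h.preB
  preA := h.preA
  shared := h.shared
  log := by
    simp only [Red.redeem, List.mem_cons, forall_eq_or_imp]
    refine ⟨⟨rfl, fun hA hB => ?_, hP⟩, h.log⟩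
    simp [Red.sharedInd, hA, hB]

theorem redSend_inv {μ : ℕ} {s : Red} (h : s.Inv corr μ) {P : Party} (hP : P ∈ corr) (r : GReq) :
    (redSend corr s P r).AllResults fun r => r.2.Inv corr μ := by
  cases r with
  | setupB d1 d2 =>
    rw [redSend]
    split
    next hs =>
      rw [allResults_bind, allResults_tell]
      obtain ⟨rfl, hs⟩ := hs
      -- A has accepted nothing before the transaction exists, so changing the digests cannot
      -- invalidate a stored value.
      obtain ⟨h1, h2⟩ := h.early (by simp [hs, Stage.hasTx])
      exact ⟨h.mu, fun _ => ⟨h1, h2⟩, fun hB => absurd hP hB,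
        fun hA x hx => by simp [h1] at hx, fun _ hB => absurd hP hB, h.log⟩
    · exact h
  | setupA =>
    rw [redSend]
    split
    next hs =>
      rw [allResults_bind, allResults_tell]
      refine ⟨h.mu, ?_, fun hB _ => h.preB hB ?_, h.preA, h.shared, h.log⟩
      · have := hs.2
        cases hst : s.stage <;> simp_all [Stage.hasTx, Stage.afterSetupA]
      · have := hs.2
        cases hst : s.stage <;> simp_all [Stage.hasDig]
    · exact h
  | publish t =>
    rw [redSend]
    split
    next hs =>
      rw [allResults_bind, allResults_tell]
      exact ⟨h.mu, by simp [Stage.hasTx], fun hB _ => h.preB hB (by simp [hs.2.1, Stage.hasDig]),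
        h.preA, h.shared, h.log⟩
    · exact h
  | init t =>
    rw [redSend]
    split
    next hs =>
      rw [allResults_bind, allResults_tell]
      refine ⟨h.mu, by simp [Stage.hasTx], fun hB _ => h.preB hB ?_, h.preA, h.shared, h.log⟩
      have := hs.2.1
      cases hst : s.stage <;> simp_all [Stage.hasDig, Stage.hasPub]
    · exact h
  | redeem t p1 p2 path =>
    rw [redSend, redRedeem]
    split
    · simp only [allResults_bind, allResults_tellIf]
      refine (preimageP_results _ _ _ _).mono fun r1 hr1 => ?_
      refine (preimageP_results _ _ _ _).mono fun r2 hr2 => ?_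
      exact (h.extend (hr1.trans hr2)).redeem fun hn => absurd hP hn
    · exact h

theorem redCall_inv {μ : ℕ} {s : Red} (h : s.Inv corr μ) (v : Val) :
    (redCall corr s v).AllResults fun r => r.2.Inv corr μ := by
  unfold redCall
  cases AdvReq.ofVal v with
  | hash q =>
    simp only [redHash, allResults_bind]
    exact (hashP_results _ _ _).mono fun r hr => h.extend hr.2
  | send P r =>
    by_cases hP : P ∈ corr
    · simpa [hP] using redSend_inv h hP r
    · simpa [hP, AllResults] using h
  | share x =>
    by_cases hc : Party.B ∈ corr ∧ Party.A ∉ corr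
    · simp only [hc, if_true, redShare, not_false_eq_true, and_self]
      split
      next hph =>
        simp only [allResults_bind, allResults_tellIf]
        refine (hashP_results _ _ _).mono fun r hr => ?_
        have h' := h.extend hr.2
        refine ⟨h.mu, fun ht => ?_, fun hB => absurd hc.1 hB, fun hA y hy => ?_,
          fun _ hB => absurd hc.1 hB, h.log⟩
        · cases hst : s.stage <;> simp_all [Stage.hasTx, Stage.phase]
        · by_cases hd : r.1 = s.d1
          · simp only [hd, if_true, Option.some.injEq] at hy
            subst hy
            simp only [← hd, hr.1]
          · simp only [hd, if_false] at hy
            exact h'.preA hA y hy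
      · exact h
    · simpa [hc, AllResults] using h

/-- The `2` is due to redeeming transactions, which test two preimages; all other messages cause at
most one query. It is the growth rate in all later bounds on the table. -/
theorem redCall_length (s : Red) (v : Val) :
    (redCall corr s v).AllResults fun r => r.2.mu = s.mu ∧
      r.2.table.length ≤ s.table.length + 2 := by
  unfold redCall
  cases AdvReq.ofVal v with
  | hash q =>
    simp only [redHash, allResults_bind]
    exact (hashP_results _ _ _).mono fun r hr => ⟨rfl, hr.2.length.trans (by omega)⟩
  | send P r =>
    by_cases hP : P ∈ corr
    · simp only [hP, if_true]
      cases r with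
      | redeem t p1 p2 path =>
        rw [redSend, redRedeem]
        split
        · simp only [allResults_bind, allResults_tellIf]
          refine (preimageP_results _ _ _ _).mono fun r1 hr1 => ?_
          refine (preimageP_results _ _ _ _).mono fun r2 hr2 => ?_
          exact ⟨rfl, (hr1.trans hr2).length⟩
        · exact ⟨rfl, by simp⟩
      | _ =>
        rw [redSend]
        split
        · rw [allResults_bind, allResults_tell]
          exact ⟨rfl, by simp⟩
        · exact ⟨rfl, by simp⟩
    · simp [hP, AllResults]
  | share x =>
    by_cases hc : Party.B ∈ corr ∧ Party.A ∉ corr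
    · simp only [hc, if_true, redShare, not_false_eq_true, and_self]
      split
      · simp only [allResults_bind, allResults_tellIf]
        exact (hashP_results _ _ _).mono fun r hr => ⟨rfl, hr.2.length.trans (by omega)⟩
      · exact ⟨rfl, by simp⟩
    · simp [hc, AllResults]

theorem redLeak_length (s : Red) (l : FLeak) :
    (redLeak corr s l).AllResults fun r => r.2.mu = s.mu ∧
      r.2.table.length ≤ s.table.length + 2 := by
  cases l with
  | setupB =>
    simp only [redLeak, redSetupB, allResults_bind]
    refine allResults_of_forall _ fun a => allResults_of_forall _ fun b => ?_
    refine (hashP_results _ _ _).mono fun r1 hr1 => ?_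
    refine (hashP_results _ _ _).mono fun r2 hr2 => ?_
    exact ⟨rfl, (hr1.2.trans hr2.2).length⟩
  | share => rw [redLeak]; split <;> exact ⟨rfl, by simp⟩
  | _ => exact ⟨rfl, by simp [redHonestRedeem, Red.redeem]⟩

theorem redInput_length (s : Red) (nv : Val) :
    (redInput corr s nv).AllResults fun r => r.2.mu = s.mu ∧
      r.2.table.length ≤ s.table.length + 2 := by
  unfold redInput
  split
  · exact ⟨rfl, by simp⟩
  split
  · exact redLeak_length s _
  · exact ⟨rfl, by simp⟩

/-! ### The adversary's messages in the ideal world -/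

theorem expect_interp_tell (f : FState) (v : Val) (H : Unit × FState → ℝ≥0∞) :
    expect ((tell v).interp (idealWorld corr).call f) H = H ((), (idealCall corr f v).2) := by
  simp [tell, idealWorld]

theorem expect_interp_tellIf (f : FState) (b : Bool) (v : Val) (H : Unit × FState → ℝ≥0∞) :
    expect ((tellIf b v).interp (idealWorld corr).call f) H
      = H ((), if b then (idealCall corr f v).2 else f) := by
  cases b <;> simp [tellIf, expect_interp_tell]

theorem idealCall_inputReq (f : FState) (P : Party) (i : PInput) (hP : P ∈ corr)
    (hi : ∀ path, i ≠ .redeem path) :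
    (idealCall corr f (inputReq P i)).2 = (fStep f P i).2.2 := by
  have : SimReq.ofVal (inputReq P i) = .input P i := by
    cases P <;> cases i <;> first | rfl | exact absurd rfl (hi _)
  simp [idealCall, this, hP]

theorem idealCall_updateA (f : FState) :
    (idealCall corr f updateAReq).2 = { f with pubA := true } := rfl

theorem idealCall_updateB (f : FState) :
    (idealCall corr f updateBReq).2 = { f with pubB := true } := rfl

/-- A repeated setup by A or initiation by M is accepted in the hybrid world and ignored by the
ideal functionality, whose bits are already set; the states still agree. Redeeming transactions are
not forwarded as such. Only their effect on the publication indicators is, by updates, and updating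
an indicator that is already set is harmless. -/
theorem expect_interp_redSend {s : Red} {P : Party} (hP : P ∈ corr) (r : GReq)
    (H : (Val × Red) × FState → ℝ≥0∞) :
    expect ((redSend corr s P r).interp (idealWorld corr).call (s.ideal corr)) H
      = (redSend corr s P r).avg fun r => H (r, r.2.ideal corr) := by
  cases r with
  | setupB d1 d2 =>
    rw [redSend]
    split
    next h =>
      obtain ⟨rfl, hs⟩ := h
      simp [expect_interp_bind, expect_interp_tell, avg_bind, idealCall_inputReq, hP]
      simp [tell, fStep, Red.ideal, hs, Stage.hasDig, Stage.hasTx, Stage.hasPub, Stage.hasInit]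
    · simp
  | setupA =>
    rw [redSend]
    split
    next h =>
      obtain ⟨rfl, hs⟩ := h
      simp [expect_interp_bind, expect_interp_tell, avg_bind, idealCall_inputReq, hP]
      cases hst : s.stage <;> simp_all [tell, fStep, Red.ideal, Stage.hasDig, Stage.hasTx,
        Stage.hasPub, Stage.hasInit, Stage.afterSetupA]
    · simp
  | publish t =>
    rw [redSend]
    split
    next h =>
      simp [expect_interp_bind, expect_interp_tell, avg_bind, idealCall_inputReq, hP]
      cases P <;> simp_all [tell, fStep, Red.ideal, Stage.hasDig, Stage.hasTx,
        Stage.hasPub, Stage.hasInit]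
    · simp
  | init t =>
    rw [redSend]
    split
    next h =>
      obtain ⟨rfl, hs⟩ := h
      simp [expect_interp_bind, expect_interp_tell, avg_bind, idealCall_inputReq, hP]
      cases hst : s.stage <;> simp_all [tell, fStep, Red.ideal, Stage.hasDig, Stage.hasTx,
        Stage.hasPub, Stage.hasInit]
    · simp
  | redeem t p1 p2 path =>
    rw [redSend, redRedeem]
    split
    · simp only [expect_interp_bind, expect_interp_preimageP, expect_interp_tellIf,
        expect_interp_ret, avg_bind, avg_ret, avg_tellIf, idealCall_updateA, idealCall_updateB]
      congr 1; ext r1; congr 1; ext r2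
      congr 2
      cases hA : s.pubA <;> cases hB : s.pubB <;> cases r1.1 <;> cases r2.1 <;>
        simp [Red.ideal, Red.redeem, hA, hB]
    · simp

/-- The counterpart of `expect_hybridCall`: the same computation, with its messages now reaching the
functionality, carries `Red.ideal` along. Together they couple the two worlds. -/
theorem expect_interp_redCall {s : Red} (v : Val) (H : (Val × Red) × FState → ℝ≥0∞) :
    expect ((redCall corr s v).interp (idealWorld corr).call (s.ideal corr)) H
      = (redCall corr s v).avg fun r => H (r, r.2.ideal corr) := by
  unfold redCall
  cases AdvReq.ofVal v with
  | hash q =>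
    simp [redHash, expect_interp_bind, expect_interp_hashP, avg_bind, Red.ideal]
  | send P r =>
    by_cases hP : P ∈ corr
    · simp only [hP, if_true, expect_interp_redSend]
    · simp [hP]
  | share x =>
    by_cases hc : Party.B ∈ corr ∧ Party.A ∉ corr
    · simp only [hc, if_true, redShare, not_false_eq_true, and_self]
      split
      next hph =>
        simp only [expect_interp_bind, expect_interp_hashP, expect_interp_tellIf,
          expect_interp_ret, avg_bind, avg_ret, avg_tellIf]
        congr 1; ext r
        congr 2
        rw [idealCall_inputReq _ _ _ hc.1 (by simp)]
        -- In the initiation phase the functionality accepts the sharing unless its bit is already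
        -- set. In that case A has accepted a value before, and replacing it by another preimage of
        -- the same digest leaves the bit as it is.
        cases hst : s.stage <;> cases hap : s.apre <;> by_cases hd : r.1 = s.d1 <;>
          simp_all [Red.ideal, fStep, Stage.hasTx, Stage.hasInit, Stage.phase, Stage.hasDig,
            Stage.hasPub]
      · simp
    · simp [hc]

/-! ### Inputs of the environment -/

/-- No message is sent while a leak is translated, so the responder is irrelevant and its state
untouched. -/
theorem expect_interp_redLeak {σ : Type} (O : σ → Val → PMF (Val × σ)) (s : Red) (l : FLeak) (f : σ)
    (H : (Val × Red) × σ → ℝ≥0∞) :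
    expect ((redLeak corr s l).interp O f) H = (redLeak corr s l).avg fun r => H (r, f) := by
  cases l with
  | setupB => simp [redLeak, redSetupB, expect_interp_bind, expect_interp_hashP,
      expect_interp_drawP, avg_bind]
  | share => rw [redLeak]; split <;> simp
  | _ => simp [redLeak]

theorem expect_interp_redInput {σ : Type} (O : σ → Val → PMF (Val × σ)) (s : Red) (nv : Val) (f : σ)
    (H : (Val × Red) × σ → ℝ≥0∞) :
    expect ((redInput corr s nv).interp O f) H = (redInput corr s nv).avg fun r => H (r, f) := by
  unfold redInput
  split
  · simp
  split
  · exact expect_interp_redLeak O s _ f H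
  · simp

/-- What the ideal world does on an input of the environment. -/
def idealInput (corr : Finset Party) (f : FState) (P : Party) (i : PInput) :
    Option Bool × Val × FState :=
  if P ∈ corr then (none, fNotesVal [.input P i], f)
  else ((fStep f P i).2.1, fNotesVal ((fStep f P i).1.map FNote.leak), (fStep f P i).2.2)

theorem idealWorld_input (f : FState) (P : Party) (i : PInput) :
    (idealWorld corr).input f P i = pure (idealInput corr f P i) := by
  simp only [idealWorld, idealInput]
  split <;> rfl

theorem redInput_leak (s : Red) (l : FLeak) :
    redInput corr s (fNotesVal ([l].map FNote.leak)) = redLeak corr s l := by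
  have : FLeak.ofVal l.toVal = l := by
    cases l with
    | redeem path P => cases path <;> cases P <;> rfl
    | _ => rfl
  simp [redInput, fNotesVal, Val.ofList, FNote.toVal, Val.tag, Val.ofNat, Val.fst, Val.snd, this]

theorem redInput_nil (s : Red) : redInput corr s (fNotesVal []) = .ret (.nil, s) := by
  simp [redInput, fNotesVal, Val.ofList]

theorem redInput_input (s : Red) (P : Party) (i : PInput) :
    redInput corr s (fNotesVal [.input P i]) = .ret (notesVal [.input P i], s) := by
  simp [redInput, fNotesVal, Val.ofList, FNote.toVal, Val.tag, Val.ofNat, Val.fst, Val.snd,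
    notesVal, Note.toVal]

end
end MadHtlc

set_option linter.unusedSimpArgs false
namespace MadHtlc
open scoped ENNReal
open Prog

/-! ### Inputs of the environment: hybrid, reduced and ideal world -/

section
variable {corr : Finset Party}

/-- An input to a party in the reduced world. -/
def redWorldInput (corr : Finset Party) (s : Red) (P : Party) (i : PInput) : Prog (Val × Red) :=
  redInput corr s (idealInput corr (s.ideal corr) P i).2.1

/-- An honest publisher contributes exactly what it has stored: B both preimages, A the first one if
it has accepted a value, M nothing. For honest A, acceptance is the indicator of sharing by
definition, so the contract predicate becomes `canRedeem` case by case. -/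
theorem Red.rPredicate_honest (s : Red) {P : Party}
    (hP : P ∉ corr) (path : RPath) :
    rPredicate path P (s.pubA || (if path.usesA then s.preA P else none).isSome)
      (s.pubB || (if path.usesB then s.preB P else none).isSome)
      = canRedeem s.pubA s.pubB (s.sharedInd corr) P path := by
  cases P <;> cases path <;>
    simp_all [rPredicate, canRedeem, RPath.usesA, RPath.usesB, Red.preA, Red.preB, Red.sharedInd]

/-- The input does not have any effect in the ideal world. -/
def Ignored (f : FState) (P : Party) (i : PInput) : Prop := fStep f P i = ([], none, f)

theorem Ignored.redWorldInput {s : Red} {P : Party} {i : PInput}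
    (h : Ignored (s.ideal corr) P i) (hP : P ∉ corr) : redWorldInput corr s P i = .ret (.nil, s) := by
  rw [Ignored] at h
  simp [MadHtlc.redWorldInput, idealInput, hP, h, redInput_nil, -List.map_nil]
  exact redInput_nil s

theorem redWorldInput_leak {s : Red} {P : Party} {i : PInput} {l : FLeak} {o : Option Bool}
    {f : FState} (h : fStep (s.ideal corr) P i = ([l], o, f)) (hP : P ∉ corr) :
    redWorldInput corr s P i = redLeak corr s l := by
  simp only [MadHtlc.redWorldInput, idealInput, hP, h, if_false]
  exact redInput_leak s l

theorem expect_hybrid_input_honest {μ : ℕ} {s : Red} {P : Party} {i : PInput} (hP : P ∉ corr)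
    (H : Option Bool × Val × HState → ℝ≥0∞) :
    expect ((hybridWorld corr μ).input (s.expand corr) P i) H
      = expect (protocolInput corr μ (s.expand corr) P i) fun x => H (x.1, notesVal x.2.1, x.2.2) := by
  simp [hybridWorld, hP]

theorem expect_hybrid_input_of_ignored {μ : ℕ} {s : Red} {P : Party} {i : PInput}
    (hP : P ∉ corr) (h : Ignored (s.ideal corr) P i)
    (hp : protocolInput corr μ (s.expand corr) P i = pure (none, [], s.expand corr))
    (H : Option Bool × Val × HState → ℝ≥0∞) :
    expect ((hybridWorld corr μ).input (s.expand corr) P i) H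
      = (redWorldInput corr s P i).avg fun r =>
          H ((idealInput corr (s.ideal corr) P i).1, r.1, r.2.expand corr) := by
  rw [expect_hybrid_input_honest hP, hp, h.redWorldInput hP]
  rw [Ignored] at h
  simp [idealInput, hP, h, notesVal, Val.ofList]

theorem Red.expand_setupA_honest {s : Red} (hA : Party.A ∉ corr) (hs : s.stage = .digests) (μ : ℕ)
    (H : Option Bool × Val × HState → ℝ≥0∞) :
    expect (protocolInput corr μ (s.expand corr) .A .setupA)
        (fun x => H (x.1, notesVal x.2.1, x.2.2))
      = H (none, setupANote corr ⟨s.d1, s.d2⟩, ({ s with stage := .created } : Red).expand corr) := by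
  obtain ⟨mu, T, st, e1, e2, pa, pb, sh, apre, pubA, pubB, log⟩ := s
  subst hs
  by_cases hB : Party.B ∈ corr <;>
    simp [protocolInput, send, gStep, Red.expand, Red.digO, Red.txO, Stage.hasDig, Stage.hasTx,
      Stage.hasPub, Stage.hasInit, Stage.phase, hA, hB, deliver, receive, setupANote, noteVal,
      toCorrupt]

theorem Red.expand_publish_honest {s : Red} {P : Party} (hP : P ∉ corr) (hPM : P ≠ .M)
    (hs : s.stage = .created) (μ : ℕ) (H : Option Bool × Val × HState → ℝ≥0∞) :
    expect (protocolInput corr μ (s.expand corr) P .publish)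
        (fun x => H (x.1, notesVal x.2.1, x.2.2))
      = H (none, publishNote corr ⟨s.d1, s.d2⟩,
          ({ s with stage := .published } : Red).expand corr) := by
  obtain ⟨mu, T, st, e1, e2, pa, pb, sh, apre, pubA, pubB, log⟩ := s
  subst hs
  cases P <;> by_cases hA : Party.A ∈ corr <;> by_cases hB : Party.B ∈ corr <;>
    by_cases hM : Party.M ∈ corr <;>
    simp_all [protocolInput, send, gStep, Red.expand, Red.digO, Red.txO, Stage.hasDig, Stage.hasTx,
      Stage.hasPub, Stage.hasInit, Stage.phase, deliver, receive, publishNote, noteVal,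
      toCorrupt]

theorem Red.expand_init_honest {s : Red} (hM : Party.M ∉ corr) (hs : s.stage = .published) (μ : ℕ)
    (H : Option Bool × Val × HState → ℝ≥0∞) :
    expect (protocolInput corr μ (s.expand corr) .M .init)
        (fun x => H (x.1, notesVal x.2.1, x.2.2))
      = H (none, initNote corr ⟨s.d1, s.d2⟩,
          ({ s with stage := .initiated } : Red).expand corr) := by
  obtain ⟨mu, T, st, e1, e2, pa, pb, sh, apre, pubA, pubB, log⟩ := s
  subst hs
  by_cases hA : Party.A ∈ corr <;> by_cases hB : Party.B ∈ corr <;>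
    simp [protocolInput, send, gStep, Red.expand, Red.digO, Red.txO, Stage.hasDig, Stage.hasTx,
      Stage.hasPub, Stage.hasInit, Stage.phase, deliver, receive, initNote, noteVal,
      toCorrupt, hA, hB, hM]

theorem expect_send_setupB_honest {s : Red} (hB : Party.B ∉ corr) (hs : s.stage = .start) (μ : ℕ)
    (a b d1 d2 : Bits) (T : Table) (H : Option Bool × Val × HState → ℝ≥0∞) :
    expect (send corr μ
        { s.expand corr with table := T, b := { (s.expand corr).b with pre := some (a, b) } } .B
        (.setupB d1 d2)) (fun x => H (x.1, notesVal x.2.1, x.2.2))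
      = H (none, setupBNote corr d1 d2, ({ s with
          table := T, stage := .digests, d1 := d1, d2 := d2, pa := a, pb := b } : Red).expand
            corr) := by
  obtain ⟨mu, T, st, e1, e2, pa, pb, sh, apre, pubA, pubB, log⟩ := s
  subst hs
  by_cases hA : Party.A ∈ corr <;>
    simp [send, gStep, Red.expand, Red.digO, Red.txO, Stage.hasDig, Stage.hasTx,
      Stage.hasPub, Stage.hasInit, Stage.phase, hA, hB, deliver, receive, setupBNote, noteVal,
      toCorrupt]

theorem Red.expand_setupB_honest {s : Red} (hB : Party.B ∉ corr) (hs : s.stage = .start)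
    (H : Option Bool × Val × HState → ℝ≥0∞) :
    expect (protocolInput corr s.mu (s.expand corr) .B .setupB)
        (fun x => H (x.1, notesVal x.2.1, x.2.2))
      = (redSetupB corr s).avg fun r => H (none, r.1, r.2.expand corr) := by
  have hc : (s.expand corr).b.phase = .setup ∧ (s.expand corr).b.pre = none := by
    simp [Red.expand, hB, hs, Stage.phase, Stage.hasDig]
  have ht : (s.expand corr).table = s.table := rfl
  simp only [protocolInput, if_pos hc, expect_bind, expect_drawBits, expect_hash, redSetupB,
    avg_bind, avg_ret, expect_send_setupB_honest hB hs, ht]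

/-- The value sent by honest B is already in the table with the first digest. So the check of honest
A makes no new query and always succeeds. -/
theorem Red.Inv.expand_share_honest {μ : ℕ} {s : Red} (h : s.Inv corr μ) (hB : Party.B ∉ corr)
    (hs : s.stage.phase = .initiation) (hsh : s.shared = false)
    (H : Option Bool × Val × HState → ℝ≥0∞) :
    expect (protocolInput corr μ (s.expand corr) .B .share)
        (fun x => H (x.1, notesVal x.2.1, x.2.2))
      = (redLeak corr s .share).avg fun r => H (none, r.1, r.2.expand corr) := by
  have hpb := h.preB
  obtain ⟨mu, T, st, e1, e2, pa, pb, sh, apre, pubA, pubB, log⟩ := s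
  simp only at hs hsh hpb
  subst hsh
  have hT : T.lookup pa = some e1 := by
    cases st <;> simp_all [Stage.phase, Stage.hasDig]
  by_cases hA : Party.A ∈ corr <;> cases st <;>
    simp_all [protocolInput, Red.expand, Red.digO, Red.txO, Stage.hasDig, Stage.hasTx,
      Stage.hasPub, Stage.hasInit, Stage.phase, redLeak, receiveShare, isPreimage, hash]

/-- By the invariant, stored values are in the table with the right digests. Each test of a preimage
is therefore deterministic: it leaves the table alone and succeeds exactly if a value is present. -/
theorem Red.Inv.expand_redeem_honest {μ : ℕ} {s : Red} (h : s.Inv corr μ) {P : Party}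
    (hP : P ∉ corr) (hs : s.stage = .initiated) (path : RPath)
    (H : Option Bool × Val × HState → ℝ≥0∞) :
    expect (protocolInput corr μ (s.expand corr) P (.redeem path))
        (fun x => H (x.1, notesVal x.2.1, x.2.2))
      = H (some (canRedeem s.pubA s.pubB (s.sharedInd corr) P path),
          (redHonestRedeem corr s path P).1, (redHonestRedeem corr s path P).2.expand corr) := by
  have hpred := s.rPredicate_honest hP path
  have hpre1 : (s.expand corr).preA P = s.preA P := by
    cases P <;> simp [Red.expand, HState.preA, Red.preA, hP, hs, Stage.hasDig]
  have hpre2 : (s.expand corr).preB P = s.preB P := by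
    cases P <;> simp [Red.expand, HState.preB, Red.preB, hP, hs, Stage.hasDig]
  have hphase : (s.expand corr).phase P = .redeeming := by
    cases P <;> simp [Red.expand, HState.phase, hP, hs, Stage.phase, Stage.hasInit]
  have htx : (s.expand corr).tx P = some ⟨s.d1, s.d2⟩ := by
    cases P <;> simp [Red.expand, HState.tx, Red.txO, hP, hs, Stage.hasTx, Stage.hasPub]
  have hdig : (s.expand corr).g.dig = some (s.d1, s.d2) := by
    simp [Red.expand, Red.digO, hs, Stage.hasDig]
  have hgtx : (s.expand corr).g.tx = some ⟨s.d1, s.d2⟩ ∧ (s.expand corr).g.init = true := by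
    simp [Red.expand, Red.txO, hs, Stage.hasTx, Stage.hasInit]
  have hp : protocolInput corr μ (s.expand corr) P (.redeem path)
      = send corr μ (s.expand corr) P (.redeem ⟨s.d1, s.d2⟩
          (if path.usesA then s.preA P else none) (if path.usesB then s.preB P else none) path) := by
    cases P <;> simp only [protocolInput, hphase, htx, hpre1, hpre2]
  have h1 : isPreimage μ s.table (if path.usesA then s.preA P else none) s.d1
      = pure ((if path.usesA then s.preA P else none).isSome, s.table) := by
    have hlook : ∀ x, s.preA P = some x → s.table.lookup x = some s.d1 := by
      intro x hx
      cases P with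
      | A => exact h.preA hP x hx
      | B =>
        obtain rfl : s.pa = x := by simpa [Red.preA] using hx
        exact (h.preB hP (by simp [hs, Stage.hasDig])).1
      | M => simp [Red.preA] at hx
    cases path.usesA
    · rfl
    · cases hx : s.preA P with
      | none => rfl
      | some x => simp [isPreimage, hash, hlook x hx]
  have h2 : isPreimage μ s.table (if path.usesB then s.preB P else none) s.d2
      = pure ((if path.usesB then s.preB P else none).isSome, s.table) := by
    have hlook : ∀ x, s.preB P = some x → s.table.lookup x = some s.d2 := by
      intro x hx
      cases P with
      | B =>
        obtain rfl : s.pb = x := by simpa [Red.preB] using hx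
        exact (h.preB hP (by simp [hs, Stage.hasDig])).2
      | _ => simp [Red.preB] at hx
    cases path.usesB
    · rfl
    · cases hx : s.preB P with
      | none => rfl
      | some x => simp [isPreimage, hash, hlook x hx]
  have ht : (s.expand corr).table = s.table := rfl
  have hpA : (s.expand corr).g.pubA = s.pubA := rfl
  have hpB : (s.expand corr).g.pubB = s.pubB := rfl
  rw [hp, send]
  simp only [gStep, hdig, if_pos hgtx, expect_bind, ht, h1, h2, expect_pure, hpA, hpB, deliver, hP,
    if_false, receive, hpred, Option.or_none, List.map_cons, List.map_nil, List.append_nil]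
  have hr : ∀ x b, receive x P (.res b) = (x, some b) := by intro x b; cases P <;> rfl
  simp only [hr, Option.some_or, redHonestRedeem, redeemNote, hpred, noteVal, toCorrupt, hP,
    if_false, Red.redeem, s.expand_shared corr]
  rw [← hdig]
  rfl

/-- For each input to an honest party, the guards of the protocol and those of the functionality are
the same condition on the reduced state. So an input is either effective in both worlds or ignored
in both. -/
theorem expect_hybrid_input {μ : ℕ} {s : Red} (h : s.Inv corr μ) (P : Party) (i : PInput)
    (H : Option Bool × Val × HState → ℝ≥0∞) :
    expect ((hybridWorld corr μ).input (s.expand corr) P i) H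
      = (redWorldInput corr s P i).avg fun r =>
          H ((idealInput corr (s.ideal corr) P i).1, r.1, r.2.expand corr) := by
  by_cases hP : P ∈ corr
  · simp [hybridWorld, hP, redWorldInput, idealInput, redInput_input]
  cases i with
  | setupB =>
    by_cases hc : P = .B ∧ s.stage = .start
    · obtain ⟨rfl, hs⟩ := hc
      have hf : fStep (s.ideal corr) .B .setupB
          = ([.setupB], none, { s.ideal corr with setupB := true }) := by
        simp [fStep, Red.ideal, hs, Stage.hasDig]
      rw [expect_hybrid_input_honest hP, redWorldInput_leak hf hP, ← h.mu,
        Red.expand_setupB_honest hP hs]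
      simp [idealInput, hP, hf, redLeak]
    · refine expect_hybrid_input_of_ignored hP ?_ ?_ H
      · cases P <;> cases hs : s.stage <;>
          simp_all [Ignored, fStep, Red.ideal, Stage.hasDig]
      · cases P <;> cases hs : s.stage <;>
          simp_all [protocolInput, Red.expand, Stage.hasDig, Stage.phase]
  | setupA =>
    by_cases hc : P = .A ∧ s.stage = .digests
    · obtain ⟨rfl, hs⟩ := hc
      have hf : fStep (s.ideal corr) .A .setupA
          = ([.setupA], none, { s.ideal corr with setupA := true }) := by
        simp [fStep, Red.ideal, hs, Stage.hasDig, Stage.hasTx]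
      rw [expect_hybrid_input_honest hP, redWorldInput_leak hf hP, Red.expand_setupA_honest hP hs]
      simp [idealInput, hP, hf, redLeak]
    · refine expect_hybrid_input_of_ignored hP ?_ ?_ H
      · cases P <;> cases hs : s.stage <;>
          simp_all [Ignored, fStep, Red.ideal, Stage.hasDig, Stage.hasTx]
      · cases P <;> cases hs : s.stage <;>
          simp_all [protocolInput, Red.expand, Stage.hasDig, Stage.phase, Red.digO]
  | share =>
    by_cases hc : P = .B ∧ s.stage.phase = .initiation ∧ s.shared = false
    · obtain ⟨rfl, hs, hsh⟩ := hc
      have hf : fStep (s.ideal corr) .B .share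
          = ([.share], none, { s.ideal corr with shared := true }) := by
        have := h.shared
        by_cases hA : Party.A ∈ corr <;> cases hst : s.stage <;>
          simp_all [fStep, Red.ideal, Stage.phase, Stage.hasTx, Stage.hasInit]
      rw [expect_hybrid_input_honest hP, redWorldInput_leak hf hP, h.expand_share_honest hP hs hsh]
      simp [idealInput, hP, hf]
    · refine expect_hybrid_input_of_ignored hP ?_ ?_ H
      · have := h.shared
        by_cases hA : Party.A ∈ corr <;> cases P <;> cases hst : s.stage <;>
          simp_all [Ignored, fStep, Red.ideal, Stage.phase, Stage.hasTx, Stage.hasInit]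
      · cases P <;> cases hst : s.stage <;>
          simp_all [protocolInput, Red.expand, Stage.hasDig, Stage.phase, Red.digO]
  | publish =>
    by_cases hc : P ≠ .M ∧ s.stage = .created
    · obtain ⟨hPM, hs⟩ := hc
      have hf : fStep (s.ideal corr) P .publish
          = ([.publish], none, { s.ideal corr with published := true }) := by
        cases P <;> simp_all [fStep, Red.ideal, Stage.hasTx, Stage.hasPub]
      rw [expect_hybrid_input_honest hP, redWorldInput_leak hf hP,
        Red.expand_publish_honest hP hPM hs]
      simp [idealInput, hP, hf, redLeak]
    · refine expect_hybrid_input_of_ignored hP ?_ ?_ H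
      · cases P <;> cases hst : s.stage <;>
          simp_all [Ignored, fStep, Red.ideal, Stage.hasPub, Stage.hasTx]
      -- In stage `published` the honest party does send its message again, and it is the mempool
      -- that ignores it; hence `send` and `gStep` are unfolded here.
      · cases P <;> cases hst : s.stage <;>
          simp_all [protocolInput, Red.expand, Stage.phase, Red.txO, Stage.hasTx, Stage.hasPub,
            send, gStep, deliver]
  | init =>
    by_cases hc : P = .M ∧ s.stage = .published
    · obtain ⟨rfl, hs⟩ := hc
      have hf : fStep (s.ideal corr) .M .init
          = ([.init], none, { s.ideal corr with init := true }) := by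
        simp [fStep, Red.ideal, hs, Stage.hasPub, Stage.hasInit]
      rw [expect_hybrid_input_honest hP, redWorldInput_leak hf hP, Red.expand_init_honest hP hs]
      simp [idealInput, hP, hf, redLeak]
    · refine expect_hybrid_input_of_ignored hP ?_ ?_ H
      · cases P <;> cases hst : s.stage <;>
          simp_all [Ignored, fStep, Red.ideal, Stage.hasPub, Stage.hasInit]
      · cases P <;> cases hst : s.stage <;>
          simp_all [protocolInput, Red.expand, Stage.phase, Red.txO, Stage.hasTx, Stage.hasPub,
            Stage.hasInit]
  | redeem path =>
    by_cases hs : s.stage = .initiated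
    · have hf : (fStep (s.ideal corr) P (.redeem path)).1 = [.redeem path P] := by
        cases P <;> simp [fStep, Red.ideal, hs, Stage.hasInit]
      have hf' : (fStep (s.ideal corr) P (.redeem path)).2.1
          = some (canRedeem s.pubA s.pubB (s.sharedInd corr) P path) := by
        rw [← s.rPredicate_honest hP path]
        cases P <;> cases path <;> simp [fStep, Red.ideal, hs, Stage.hasInit, hP, Red.preA,
          Red.preB, RPath.usesA, RPath.usesB]
      rw [expect_hybrid_input_honest hP, h.expand_redeem_honest hP hs,
        redWorldInput_leak (l := .redeem path P) (o := (fStep (s.ideal corr) P (.redeem path)).2.1)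
          (f := (fStep (s.ideal corr) P (.redeem path)).2.2) (by rw [← hf]) hP]
      simp [idealInput, hP, hf', redLeak]
    · refine expect_hybrid_input_of_ignored hP ?_ ?_ H
      · cases P <;> cases hst : s.stage <;>
          simp_all [Ignored, fStep, Red.ideal, Stage.hasInit]
      · cases P <;> cases hst : s.stage <;>
          simp_all [protocolInput, Red.expand, Stage.phase, Red.txO, Stage.hasTx, Stage.hasPub,
            Stage.hasInit, HState.phase, HState.tx]

/-- When an honest party forwards its input, the functionality moves first and the simulator learns
of it by the leak. Once the leak has been translated, the two states agree again. -/
theorem Red.Inv.redWorldInput {μ : ℕ} {s : Red} (h : s.Inv corr μ) (P : Party) (i : PInput) :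
    (redWorldInput corr s P i).AllResults fun r =>
      r.2.ideal corr = (idealInput corr (s.ideal corr) P i).2.2 ∧ r.2.Inv corr μ := by
  by_cases hP : P ∈ corr
  · simpa [MadHtlc.redWorldInput, idealInput, hP, redInput_input, AllResults] using h
  have hid : idealInput corr (s.ideal corr) P i = ((fStep (s.ideal corr) P i).2.1,
      fNotesVal ((fStep (s.ideal corr) P i).1.map FNote.leak), (fStep (s.ideal corr) P i).2.2) := by
    simp [idealInput, hP]
  by_cases hig : Ignored (s.ideal corr) P i
  · rw [hig.redWorldInput hP, hid, hig]
    exact ⟨rfl, h⟩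
  rw [hid]
  have hsh := h.shared
  cases i with
  | setupB =>
    have hc : P = .B ∧ s.stage = .start := by
      cases P <;> cases hs : s.stage <;> simp_all [Ignored, fStep, Red.ideal, Stage.hasDig]
    obtain ⟨rfl, hs⟩ := hc
    have hf : fStep (s.ideal corr) .B .setupB
        = ([.setupB], none, { s.ideal corr with setupB := true }) := by
      simp [fStep, Red.ideal, hs, Stage.hasDig]
    obtain ⟨he1, he2⟩ := h.early (by simp [hs, Stage.hasTx])
    rw [redWorldInput_leak hf hP, hf]
    simp only [redLeak, redSetupB, allResults_bind]
    refine allResults_of_forall _ fun a => allResults_of_forall _ fun b => ?_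
    refine (hashP_results _ _ _).mono fun r1 hr1 => ?_
    refine (hashP_results _ _ _).mono fun r2 hr2 => ?_
    refine ⟨by simp [Red.ideal, Stage.hasTx, Stage.hasDig, Stage.hasPub, Stage.hasInit, hs], h.mu,
      fun _ => ⟨he1, he2⟩, fun _ _ => ⟨hr2.2.lookup _ _ hr1.1, hr2.1⟩, fun _ x hx => ?_,
      fun _ _ => ?_, h.log⟩
    · simp [he1] at hx
    · simp [he1, he2]
  | setupA =>
    have hc : P = .A ∧ s.stage = .digests := by
      cases P <;> cases hs : s.stage <;>
        simp_all [Ignored, fStep, Red.ideal, Stage.hasDig, Stage.hasTx]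
    obtain ⟨rfl, hs⟩ := hc
    have hf : fStep (s.ideal corr) .A .setupA
        = ([.setupA], none, { s.ideal corr with setupA := true }) := by
      simp [fStep, Red.ideal, hs, Stage.hasDig, Stage.hasTx]
    rw [redWorldInput_leak hf hP, hf]
    exact ⟨by simp [Red.ideal, Stage.hasTx, Stage.hasDig, Stage.hasPub, Stage.hasInit, hs], h.mu,
      by simp [Stage.hasTx], fun hB _ => h.preB hB (by simp [hs, Stage.hasDig]), h.preA, h.shared,
      h.log⟩
  | share =>
    have hc : P = .B ∧ s.stage.phase = .initiation ∧ s.shared = false := by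
      by_cases hA : Party.A ∈ corr <;> cases P <;> cases hst : s.stage <;> 
        cases hshd : s.shared <;>
        simp_all [Ignored, fStep, Red.ideal, Stage.phase, Stage.hasTx, Stage.hasInit]
    obtain ⟨rfl, hs, hshd⟩ := hc
    have hf : fStep (s.ideal corr) .B .share
        = ([.share], none, { s.ideal corr with shared := true }) := by
      by_cases hA : Party.A ∈ corr <;> cases hst : s.stage <;>
        simp_all [fStep, Red.ideal, Stage.phase, Stage.hasTx, Stage.hasInit]
    have htx : s.stage.hasTx = true ∧ s.stage.hasDig = true := by
      cases hst : s.stage <;> simp_all [Stage.phase, Stage.hasTx, Stage.hasDig]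
    rw [redWorldInput_leak hf hP, hf, redLeak]
    split
    next hA =>
      exact ⟨by simp [Red.ideal, hA], h.mu, by simp [htx], h.preB, fun hA' => absurd hA hA',
        fun hA' => absurd hA hA', h.log⟩
    next hA =>
      refine ⟨by simp [Red.ideal, hA], h.mu, by simp [htx], h.preB, fun _ x hx => ?_,
        fun _ _ => rfl, h.log⟩
      obtain rfl : s.pa = x := by simpa using hx
      exact (h.preB hP htx.2).1
  | publish =>
    have hc : P ≠ .M ∧ s.stage = .created := by
      cases P <;> cases hs : s.stage <;>
        simp_all [Ignored, fStep, Red.ideal, Stage.hasPub, Stage.hasTx]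
    obtain ⟨hPM, hs⟩ := hc
    have hf : fStep (s.ideal corr) P .publish
        = ([.publish], none, { s.ideal corr with published := true }) := by
      cases P <;> simp_all [fStep, Red.ideal, Stage.hasTx, Stage.hasPub]
    rw [redWorldInput_leak hf hP, hf]
    exact ⟨by simp [Red.ideal, Stage.hasTx, Stage.hasDig, Stage.hasPub, Stage.hasInit, hs], h.mu,
      by simp [Stage.hasTx], fun hB _ => h.preB hB (by simp [hs, Stage.hasDig]), h.preA, h.shared,
      h.log⟩
  | init =>
    have hc : P = .M ∧ s.stage = .published := by
      cases P <;> cases hs : s.stage <;>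
        simp_all [Ignored, fStep, Red.ideal, Stage.hasPub, Stage.hasInit]
    obtain ⟨rfl, hs⟩ := hc
    have hf : fStep (s.ideal corr) .M .init
        = ([.init], none, { s.ideal corr with init := true }) := by
      simp [fStep, Red.ideal, hs, Stage.hasPub, Stage.hasInit]
    rw [redWorldInput_leak hf hP, hf]
    exact ⟨by simp [Red.ideal, Stage.hasTx, Stage.hasDig, Stage.hasPub, Stage.hasInit, hs], h.mu,
      by simp [Stage.hasTx], fun hB _ => h.preB hB (by simp [hs, Stage.hasDig]), h.preA, h.shared,
      h.log⟩
  | redeem path =>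
    have hs : s.stage = .initiated := by
      cases P <;> cases hs : s.stage <;> simp_all [Ignored, fStep, Red.ideal, Stage.hasInit]
    have hf : (fStep (s.ideal corr) P (.redeem path)).1 = [.redeem path P] := by
      cases P <;> simp [fStep, Red.ideal, hs, Stage.hasInit]
    rw [redWorldInput_leak (l := .redeem path P)
      (o := (fStep (s.ideal corr) P (.redeem path)).2.1)
      (f := (fStep (s.ideal corr) P (.redeem path)).2.2) (by rw [← hf]) hP]
    refine ⟨?_, h.redeem fun _ => s.rPredicate_honest hP path⟩
    cases P <;> cases path <;> simp [fStep, Red.ideal, hs, Stage.hasInit, hP, Red.preA,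
      Red.preB, RPath.usesA, RPath.usesB, redHonestRedeem, Red.redeem, Stage.hasTx, Stage.hasDig,
      Stage.hasPub]

end
end MadHtlc

set_option linter.unusedSimpArgs false
namespace MadHtlc
open scoped ENNReal
open Prog

/-! ## Executions in the reduced world -/

section
variable (corr : Finset Party) (adv : Cmd) (T : ℕ)

/-- An activation of the adversary in the reduced world. -/
def redActivate (s : Red) (st : Store) (m : Option Val) (notes : Val) (out : Option Bool) :
    Prog (Option (Val × (Red × Store))) :=
  ((adv.run (Function.update st 0 (activationVal m notes)) T).simulate
    (fun s v => (redCall corr s v).total) s).bindO fun r =>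
      .ret (some (.node (outputVal out) (r.1.1 0), (r.2, r.1.1)))

/-- A turn in the reduced world. -/
def redTurn (x : Red × Store) (v : Val) : Prog (Option (Val × (Red × Store))) :=
  match EnvReq.ofVal v with
  | .adv m => redActivate corr adv T x.1 x.2 (some m) .nil none
  | .input P i =>
      (redWorldInput corr x.1 P i).bind fun r =>
        redActivate corr adv T r.2 x.2 none r.1 (idealInput corr (x.1.ideal corr) P i).1

/-- The execution in the reduced world. -/
def redExec (env : Cmd) (μ : ℕ) (z : Bits) (t : ℕ) : Prog (Option ((Store × ℕ) × (Red × Store))) :=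
  (env.run (initStore μ (.ofBits z)) t).simulate (redTurn corr adv T)
    (Red.start μ, initStore μ .nil)

variable {corr} {adv} {T}

theorem redActivate_inv {μ : ℕ} {s : Red} (h : s.Inv corr μ) (st : Store) (m : Option Val)
    (notes : Val) (out : Option Bool) :
    (redActivate corr adv T s st m notes out).AllResults
      fun o => ∀ r, o = some r → r.2.1.Inv corr μ := by
  rw [redActivate, allResults_bindO]
  refine (allResults_simulate (I := fun s => s.Inv corr μ) (fun s v hs => ?_) _ h).mono
    fun o ho => ?_
  · rw [allResults_total]
    exact (redCall_inv hs v).mono (by simp)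
  · cases o with
    | none => simp
    | some r => simpa [AllResults] using ho

theorem redTurn_inv {μ : ℕ} {x : Red × Store} (h : x.1.Inv corr μ) (v : Val) :
    (redTurn corr adv T x v).AllResults fun o => ∀ r, o = some r → r.2.1.Inv corr μ := by
  unfold redTurn
  cases EnvReq.ofVal v with
  | adv m => exact redActivate_inv h _ _ _ _
  | input P i =>
    simp only [allResults_bind]
    exact (h.redWorldInput P i).mono fun r hr => redActivate_inv hr.2 _ _ _ _

theorem expect_hybrid_activate {μ : ℕ} {s : Red} (h : s.Inv corr μ) (st : Store)
    (m : Option Val) (notes : Val) (out : Option Bool)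
    (f : Val × Option (HState × Store) → ℝ≥0∞) (hf : f (.nil, none) = 0) :
    expect (activate (hybridWorld corr μ) adv T (s.expand corr) st m notes out) f
      = (redActivate corr adv T s st m notes out).avg
          (liftO fun r => f (r.1, some (r.2.1.expand corr, r.2.2))) := by
  rw [expect_activate _ _ _ _ _ _ _ _ _ hf, redActivate, avg_bindO]
  refine (expect_interp_eq_avg_simulate (O := (hybridWorld corr μ).call) (e := Red.expand corr)
    (I := fun s => s.Inv corr μ) (h := redCall corr) (fun s v hs => redCall_inv hs v)
    (fun s v hs H => expect_hybridCall corr μ s hs.mu v H) _ h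
    (fun x : (Store × ℕ) × HState =>
      f (.node (outputVal out) (x.1.1 0), some (x.2, x.1.1)))).trans ?_
  congr 1

theorem expect_hybrid_turn {μ : ℕ} {x : Red × Store} (h : x.1.Inv corr μ) (v : Val)
    (f : Val × Option (HState × Store) → ℝ≥0∞) (hf : ∀ v, f (v, none) = 0) :
    expect (turn (hybridWorld corr μ) adv T (some (x.1.expand corr, x.2)) v) f
      = (redTurn corr adv T x v).avg
          (liftO fun r => f (r.1, some (r.2.1.expand corr, r.2.2))) := by
  simp only [redTurn, turn]
  cases hv : EnvReq.ofVal v with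
  | adv m => exact expect_hybrid_activate h _ _ _ _ f (hf _)
  | input P i =>
    simp only [expect_bind, avg_bind]
    rw [expect_hybrid_input h]
    exact avg_congr_of_allResults ((h.redWorldInput P i).mono fun r hr =>
      expect_hybrid_activate hr.2 _ _ _ _ f (hf _))

theorem expect_interp_hybrid_turn {μ : ℕ} {α : Type} (q : Prog (Option α)) {x : Red × Store}
    (h : x.1.Inv corr μ) (H : α → HState × Store → ℝ≥0∞) :
    expect (q.interp (turn (hybridWorld corr μ) adv T) (some (x.1.expand corr, x.2)))
        (fun y => liftO (fun a => liftO (H a) y.2) y.1)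
      = (q.simulate (redTurn corr adv T) x).avg
          (liftO fun r => H r.1 (r.2.1.expand corr, r.2.2)) := by
  induction q generalizing x with
  | ret o => cases o <;> simp [simulate]
  | coin k ih => simp [simulate, ih _ h]
  | call v k ih =>
    rw [simulate, expect_interp_call, expect_hybrid_turn h]
    · rw [avg_bindO]
      refine avg_congr_of_allResults ((redTurn_inv h v).mono fun o ho => ?_)
      cases o with
      | none => rfl
      | some r => exact ih _ (ho r rfl)
    · intro v
      refine expect_interp_turn_none _ _ _ _ _ fun b => ?_
      cases b <;> rfl

/-- The law of the execution in the hybrid world. -/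
theorem expect_hybrid_exec (env : Cmd) (μ : ℕ) (z : Bits) (t : ℕ) (H : Bool × HState → ℝ≥0∞) :
    expect (exec (hybridWorld corr μ) env adv μ z t) (liftO H)
      = (redExec corr adv t env μ z t).avg
          (liftO fun r => H ((r.1.1 0).toBool, r.2.1.expand corr)) := by
  rw [expect_exec]
  have hst : (hybridWorld corr μ).start = (Red.start μ).expand corr := by
    simp [hybridWorld, HState.start, Red.expand, Red.start, Red.digO, Red.txO, Stage.hasDig,
      Stage.hasTx, Stage.hasPub, Stage.hasInit, Stage.phase]
  rw [hst]
  exact expect_interp_hybrid_turn (x := (Red.start μ, initStore μ .nil)) _ (Red.Inv.start μ)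
    (fun (r : Store × ℕ) ws => H ((r.1 0).toBool, ws.1))

theorem redExec_inv (env : Cmd) (μ : ℕ) (z : Bits) (t : ℕ) :
    (redExec corr adv T env μ z t).AllResults fun o => ∀ r, o = some r → r.2.1.Inv corr μ :=
  allResults_simulate (I := fun x : Red × Store => x.1.Inv corr μ)
    (fun _ v hx => redTurn_inv hx v) _ (Red.Inv.start μ)

/-! ## Reachable states -/

/-- The indicator of the states not of this form has expectation zero by the law of the reduced
execution, all of whose results satisfy the invariant. -/
theorem exists_red_of_mem_support {env : Cmd} {μ : ℕ} {z : Bits} {t : ℕ} {b : Bool} {w : HState}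
    (hw : some (b, w) ∈ (exec (hybridWorld corr μ) env adv μ z t).support) :
    ∃ s : Red, s.Inv corr μ ∧ w = s.expand corr := by
  classical
  by_contra hn
  have := expect_hybrid_exec (corr := corr) (adv := adv) env μ z t
    fun x => if ∃ s : Red, s.Inv corr μ ∧ x.2 = s.expand corr then 0 else 1
  rw [avg_eq_zero] at this
  · simpa [hn] using eq_zero_of_expect_eq_zero this hw
  · refine (redExec_inv env μ z t).mono fun o ho => ?_
    cases o with
    | none => rfl
    | some r => exact if_pos ⟨_, ho r rfl, rfl⟩

theorem RedeemTx.Exact.after {r : RedeemTx} (h : r.Exact corr) (hv : r.valid = true) :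
    (r.path.usesA = true → r.pubAAfter = true) ∧ (r.path.usesB = true → r.pubBAfter = true) := by
  rw [h.valid] at hv
  cases hp : r.path <;> simp_all [rPredicate, RPath.usesA, RPath.usesB]

theorem Red.Inv.redeem_exact {μ : ℕ} {s : Red} (h : s.Inv corr μ) {P : Party} (hP : P ∉ corr)
    (path : RPath) (hs : s.stage = .initiated) :
    ∀ x ∈ ((hybridWorld corr μ).input (s.expand corr) P (.redeem path)).support,
      x.1 = some (canRedeem s.pubA s.pubB (s.sharedInd corr) P path) ∧
      (x.1 = some true →
        x.2.2.g.pubA = (s.pubA || path.usesA) ∧ x.2.2.g.pubB = (s.pubB || path.usesB)) := by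
  refine forall_mem_support_of_avg (q := .ret ())
    (e := fun _ => (some (canRedeem s.pubA s.pubB (s.sharedInd corr) P path),
          (redHonestRedeem corr s path P).1, (redHonestRedeem corr s path P).2.expand corr))
    (fun H => ?_) ⟨rfl, fun hv => ?_⟩
  · rw [expect_hybrid_input_honest hP, h.expand_redeem_honest hP hs]
    rfl
  · have hv' : rPredicate path P (s.pubA || (if path.usesA then s.preA P else none).isSome)
      (s.pubB || (if path.usesB then s.preB P else none).isSome) = true := by
      rw [s.rPredicate_honest hP path]
      simpa using hv
    simp only [redHonestRedeem, Red.redeem, Red.expand]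
    cases path <;> cases P <;> simp_all [rPredicate, RPath.usesA, RPath.usesB]

/-- Either B has shared before, and then the input is ignored and the indicator persists, or the
leak of the input sets the indicator. -/
theorem Red.Inv.share_exact {μ : ℕ} {s : Red} (h : s.Inv corr μ) (hB : Party.B ∉ corr)
    (hs : s.stage.phase = .initiation) :
    ∀ x ∈ ((hybridWorld corr μ).input (s.expand corr) .B .share).support,
      x.2.2.shared corr = true := by
  have hsh := h.shared
  refine forall_mem_support_of_avg (expect_hybrid_input h _ _) ?_
  simp only [Red.expand_shared, Red.sharedInd, hB, if_false]
  by_cases hc : s.shared = true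
  · have hig : Ignored (s.ideal corr) .B .share := by
      by_cases hA : Party.A ∈ corr <;> simp_all [Ignored, fStep, Red.ideal]
    rw [hig.redWorldInput hB]
    by_cases hA : Party.A ∈ corr <;> simp_all [AllResults]
  · have hf : fStep (s.ideal corr) .B .share
        = ([.share], none, { s.ideal corr with shared := true }) := by
      by_cases hA : Party.A ∈ corr <;> cases hst : s.stage <;>
        simp_all [fStep, Red.ideal, Stage.phase, Stage.hasTx, Stage.hasInit]
    rw [redWorldInput_leak hf hB, redLeak]
    by_cases hA : Party.A ∈ corr <;> simp [hA, AllResults]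

end
end MadHtlc

namespace MadHtlc
open Prog

/-! ## Programming the machines

A function `f : α → Prog β` is realized by a command that works on variable `2`, which holds a stack
with the (encoded) argument on top, and replaces the argument by the result. Variable `3` is
scratch space, all other variables are preserved. -/

/-- Injectivity is not required in general, only where two values are compared. This leaves room for
the encoding of `Red`, which forgets the log. -/
class Enc (α : Type) where
  enc : α → Val

open Enc (enc)

instance : Enc Val := ⟨id⟩
instance : Enc Unit := ⟨fun _ => .nil⟩
instance : Enc Bool := ⟨Val.ofBool⟩
instance : Enc ℕ := ⟨Val.ofNat⟩
instance {α β : Type} [Enc α] [Enc β] : Enc (α × β) := ⟨fun p => .node (enc p.1) (enc p.2)⟩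
instance {α : Type} [Enc α] : Enc (Option α) :=
  ⟨fun o => match o with
    | none => .nil
    | some a => .node (enc a) .nil⟩
instance {α : Type} [Enc α] : Enc (List α) := ⟨fun l => .ofList (l.map enc)⟩

section
variable {α β γ δ : Type} [Enc α] [Enc β] [Enc γ] [Enc δ]

@[simp] theorem enc_val (v : Val) : enc v = v := rfl
@[simp] theorem enc_prod (a : α) (b : β) : enc (a, b) = .node (enc a) (enc b) := rfl
@[simp] theorem enc_none : enc (none : Option α) = .nil := rfl
@[simp] theorem enc_some (a : α) : enc (some a) = .node (enc a) .nil := rfl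
@[simp] theorem enc_nil : enc ([] : List α) = .nil := rfl
@[simp] theorem enc_cons (a : α) (l : List α) : enc (a :: l) = .node (enc a) (enc l) := rfl

theorem enc_bits (x : Bits) : enc x = Val.ofBits x := by
  induction x with
  | nil => rfl
  | cons b bs ih => rw [enc_cons, ih]; rfl

theorem ofNat_injective : Function.Injective Val.ofNat := by
  intro m
  induction m with
  | zero => intro n h; cases n <;> simp_all [Val.ofNat]
  | succ m ih =>
    intro n h
    cases n with
    | zero => simp [Val.ofNat] at h
    | succ n => simp only [Val.ofNat, Val.node.injEq, true_and] at h; rw [ih h]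

theorem enc_bits_injective : Function.Injective (enc : Bits → Val) := by
  intro x y h
  rw [enc_bits, enc_bits] at h
  rw [← Val.bits_ofBits x, h, Val.bits_ofBits]

/-! ### Expressions -/

/-- The expression with the given constant value. -/
def Expr.const : Val → Expr
  | .nil => .nil
  | .node l r => .cons (const l) (const r)

@[simp] theorem Expr.eval_const (s : Store) (v : Val) : (Expr.const v).eval s = v := by
  induction v with
  | nil => rfl
  | node l r ihl ihr => simp [const, eval, ihl, ihr]

/-- The function is computed by an expression. -/
def IsExpr (g : α → β) : Prop :=
  ∃ e : Expr, ∀ (s : Store) (a : α) (rest : Val), s 2 = .node (enc a) rest → e.eval s = enc (g a)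

theorem IsExpr.id : IsExpr (fun a : α => a) :=
  ⟨.hd (.var 2), fun s a rest h => by simp [Expr.eval, h, Val.fst]⟩

theorem IsExpr.const (b : β) : IsExpr (fun _ : α => b) :=
  ⟨.const (enc b), fun s a rest h => by simp⟩

theorem IsExpr.congr {g : α → β} {g' : α → γ} (h : IsExpr g) (hg : ∀ a, enc (g a) = enc (g' a)) :
    IsExpr g' := by
  obtain ⟨e, he⟩ := h
  exact ⟨e, fun s a rest hs => by rw [he s a rest hs, hg]⟩

theorem IsExpr.map₁ {g : α → β} {F : β → γ} (op : Expr → Expr) (op' : Val → Val)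
    (hop : ∀ s e, (op e).eval s = op' (e.eval s)) (hF : ∀ b, op' (enc b) = enc (F b))
    (h : IsExpr g) : IsExpr (fun a => F (g a)) := by
  obtain ⟨e, he⟩ := h
  exact ⟨op e, fun s a rest hs => by rw [hop, he s a rest hs, hF]⟩

theorem IsExpr.map₂ {g : α → β} {g' : α → γ} {F : β → γ → δ} (op : Expr → Expr → Expr)
    (op' : Val → Val → Val) (hop : ∀ s e e', (op e e').eval s = op' (e.eval s) (e'.eval s))
    (hF : ∀ b c, op' (enc b) (enc c) = enc (F b c)) (h : IsExpr g) (h' : IsExpr g') :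
    IsExpr (fun a => F (g a) (g' a)) := by
  obtain ⟨e, he⟩ := h
  obtain ⟨e', he'⟩ := h'
  exact ⟨op e e', fun s a rest hs => by rw [hop, he s a rest hs, he' s a rest hs, hF]⟩

theorem IsExpr.fst {g : α → β × γ} (h : IsExpr g) : IsExpr (fun a => (g a).1) :=
  IsExpr.map₁ (F := Prod.fst) .hd Val.fst (fun _ _ => rfl) (fun _ => rfl) h

theorem IsExpr.snd {g : α → β × γ} (h : IsExpr g) : IsExpr (fun a => (g a).2) :=
  IsExpr.map₁ (F := Prod.snd) .tl Val.snd (fun _ _ => rfl) (fun _ => rfl) h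

theorem IsExpr.pair {g : α → β} {g' : α → γ} (h : IsExpr g) (h' : IsExpr g') :
    IsExpr (fun a => (g a, g' a)) :=
  IsExpr.map₂ (F := Prod.mk) .cons .node (fun _ _ _ => rfl) (fun _ _ => rfl) h h'

theorem IsExpr.valFst {g : α → Val} (h : IsExpr g) : IsExpr (fun a => (g a).fst) :=
  IsExpr.map₁ (F := Val.fst) .hd Val.fst (fun _ _ => rfl) (fun _ => rfl) h

theorem IsExpr.valSnd {g : α → Val} (h : IsExpr g) : IsExpr (fun a => (g a).snd) :=
  IsExpr.map₁ (F := Val.snd) .tl Val.snd (fun _ _ => rfl) (fun _ => rfl) h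

theorem IsExpr.node {g g' : α → Val} (h : IsExpr g) (h' : IsExpr g') :
    IsExpr (fun a => Val.node (g a) (g' a)) :=
  IsExpr.map₂ (F := Val.node) .cons .node (fun _ _ _ => rfl) (fun _ _ => rfl) h h'

theorem IsExpr.encode {g : α → β} (h : IsExpr g) : IsExpr (fun a => (enc (g a) : Val)) :=
  h.congr fun _ => rfl

theorem IsExpr.cons {g : α → β} {g' : α → List β} (h : IsExpr g) (h' : IsExpr g') :
    IsExpr (fun a => g a :: g' a) :=
  IsExpr.map₂ (F := List.cons) .cons .node (fun _ _ _ => rfl) (fun _ _ => rfl) h h'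

theorem IsExpr.tail {g : α → List β} (h : IsExpr g) : IsExpr (fun a => (g a).tail) :=
  IsExpr.map₁ (F := List.tail) .tl Val.snd (fun _ _ => rfl) (fun l => by cases l <;> rfl) h

theorem IsExpr.optSome {g : α → β} (h : IsExpr g) : IsExpr (fun a => some (g a)) :=
  IsExpr.map₁ (F := some) (.cons · .nil) (.node · .nil) (fun _ _ => rfl) (fun _ => rfl) h

/-- The head of `nil` is `nil`, so reading an absent value is one head operation provided that the
default is encoded by `nil`. -/
theorem IsExpr.getD [Inhabited β] (hd : enc (default : β) = .nil) {g : α → Option β}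
    (h : IsExpr g) : IsExpr (fun a => (g a).getD default) :=
  IsExpr.map₁ (F := fun o => o.getD default) .hd Val.fst (fun _ _ => rfl)
    (fun o => by cases o with
      | none => exact hd.symm
      | some a => rfl) h

theorem IsExpr.beq {g g' : α → β} [DecidableEq β] (hinj : Function.Injective (enc : β → Val))
    (h : IsExpr g) (h' : IsExpr g') : IsExpr (fun a => decide (g a = g' a)) :=
  IsExpr.map₂ (F := fun b b' => decide (b = b')) .eq (fun v v' => .ofBool (decide (v = v')))
    (fun _ _ _ => rfl) (fun b b' => by simp [hinj.eq_iff, enc]) h h'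

theorem IsExpr.not {g : α → Bool} (h : IsExpr g) : IsExpr (fun a => !g a) :=
  IsExpr.map₁ (F := fun b => !b) (.eq · .nil) (fun v => .ofBool (decide (v = .nil)))
    (fun _ _ => rfl) (fun b => by cases b <;> simp [enc, Val.ofBool]) h

theorem IsExpr.toBool {g : α → Val} (h : IsExpr g) : IsExpr (fun a => (g a).toBool) :=
  IsExpr.map₁ (F := Val.toBool) (fun e => .eq (.eq e .nil) .nil)
    (fun v => .ofBool (decide ((.ofBool (decide (v = .nil)) : Val) = .nil)))
    (fun _ _ => rfl) (fun b => by cases b <;> simp [enc, Val.ofBool, Val.toBool]) h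

theorem IsExpr.isSome {g : α → Option β} (h : IsExpr g) : IsExpr (fun a => (g a).isSome) :=
  (h.encode.toBool).congr fun a => by cases g a <;> rfl

theorem IsExpr.ne_nil {g : α → List β} (h : IsExpr g) : IsExpr (fun a => !(g a).isEmpty) :=
  (h.encode.toBool).congr fun a => by cases g a <;> rfl

theorem IsExpr.head [Inhabited β] (hd : enc (default : β) = .nil) {g : α → List β}
    (h : IsExpr g) : IsExpr (fun a => (g a).headD default) :=
  IsExpr.map₁ (F := fun l => l.headD default) .hd Val.fst (fun _ _ => rfl)
    (fun l => by cases l with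
      | nil => exact hd.symm
      | cons a l => rfl) h

/-- Message tags are compared with fixed numerals only, so the comparison unrolls to a fixed number
of tail operations and needs no loop. -/
theorem IsExpr.len_le {g : α → Val} (h : IsExpr g) (k : ℕ) :
    IsExpr (fun a => decide ((g a).len ≤ k)) := by
  induction k generalizing g with
  | zero =>
    exact (h.toBool.not).congr fun a => by cases g a <;> simp [Val.toBool, Val.len]
  | succ k ih =>
    exact (ih h.valSnd).congr fun a =>
      congrArg enc (decide_eq_decide.2 (by cases g a <;> simp [Val.snd, Val.len]))

/-! ### Realizable computations -/

/-- The computation is realized by a command, in time linear in `w`. -/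
def Realizes (f : α → Prog β) (w : α → ℕ) : Prop :=
  ∃ (c : Cmd) (C : ℕ), ∀ (a : α) (rest : Val) (s : Store) (t : ℕ),
    s 2 = .node (enc a) rest → C * (w a + 1) ≤ t →
    Refines (fun b (r : Store × ℕ) => r.1 2 = .node (enc b) rest ∧ t ≤ r.2 + C * (w a + 1) ∧
      ∀ n, n ≠ 2 → n ≠ 3 → r.1 n = s n) (f a).total (c.run s t)

theorem Prog.Refines.of_total {α β : Type} {R : β → α → Prop} {p : Prog β} {q : Prog (Option α)}
    (h : Refines R p.total q) {P : β → Prop} (hp : p.AllResults P) :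
    Refines (fun b a => R b a ∧ P b) p.total q := by
  induction p generalizing q with
  | ret b =>
    obtain ⟨a, rfl, hab⟩ := h
    exact ⟨a, rfl, hab, hp⟩
  | coin k ih =>
    obtain ⟨k', rfl, hk⟩ := h
    exact ⟨k', rfl, fun b => ih b (hk b) (hp b)⟩
  | call v k ih =>
    obtain ⟨k', rfl, hk⟩ := h
    exact ⟨k', rfl, fun b => ih b (hk b) (hp b)⟩

theorem Realizes.ret {g : α → β} (hg : IsExpr g) (w : α → ℕ) :
    Realizes (fun a => Prog.ret (g a)) w := by
  obtain ⟨e, he⟩ := hg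
  refine ⟨.assign 2 (.cons e (.tl (.var 2))), 1, fun a rest s t hs ht => ?_⟩
  obtain ⟨t, rfl⟩ : ∃ t', t = t' + 1 := ⟨t - 1, by omega⟩
  refine ⟨_, rfl, ?_, ?_, fun n h2 h3 => ?_⟩
  · simp [Expr.eval, he s a rest hs, hs, Val.snd]
  · simp only; omega
  · simp [h2]

theorem Realizes.ite {b : α → Bool} {f g : α → Prog β} {w : α → ℕ} (hb : IsExpr b)
    (hf : Realizes f w) (hg : Realizes g w) : Realizes (fun a => if b a then f a else g a) w := by
  obtain ⟨e, he⟩ := hb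
  obtain ⟨c, C, hc⟩ := hf
  obtain ⟨d, D, hd⟩ := hg
  refine ⟨.ite e c d, C + D + 1, fun a rest s t hs ht => ?_⟩
  have hexp : (C + D + 1) * (w a + 1) = C * (w a + 1) + D * (w a + 1) + (w a + 1) := by ring
  obtain ⟨t, rfl⟩ : ∃ t', t = t' + 1 := ⟨t - 1, by omega⟩
  rw [Cmd.run, he s a rest hs]
  dsimp only
  cases hba : b a
  · rw [if_neg (by simp), if_neg (by simp [enc, Val.ofBool, Val.toBool])]
    exact (hd a rest s t hs (by omega)).mono fun x r ⟨h1, h2, h3⟩ => ⟨h1, by omega, h3⟩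
  · rw [if_pos rfl, if_pos (by rfl)]
    exact (hc a rest s t hs (by omega)).mono fun x r ⟨h1, h2, h3⟩ => ⟨h1, by omega, h3⟩

theorem Realizes.comp {F : β → Prog γ} {wF : β → ℕ} (hF : Realizes F wF) {g : α → β}
    (hg : IsExpr g) {w : α → ℕ} (D : ℕ) (hw : ∀ a, wF (g a) ≤ D * (w a + 1)) :
    Realizes (fun a => F (g a)) w := by
  obtain ⟨e, he⟩ := hg
  obtain ⟨c, C, hc⟩ := hF
  refine ⟨.seq (.assign 2 (.cons e (.tl (.var 2)))) c, C * (D + 1) + 1,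
    fun a rest s t hs ht => ?_⟩
  have h1 : C * (wF (g a) + 1) ≤ C * (D + 1) * (w a + 1) := by
    rw [mul_assoc]
    refine Nat.mul_le_mul_left C ?_
    have := hw a
    nlinarith
  have h2 : (C * (D + 1) + 1) * (w a + 1) = C * (D + 1) * (w a + 1) + (w a + 1) := by ring
  obtain ⟨t, rfl⟩ : ∃ t', t = t' + 1 := ⟨t - 1, by omega⟩
  rw [Cmd.run, Cmd.run, ret_some_bindO]
  refine (hc (g a) rest _ t ?_ (by omega)).mono fun x r ⟨e1, e2, e3⟩ => ⟨e1, by omega, ?_⟩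
  · simp [Expr.eval, he s a rest hs, hs, Val.snd]
  · intro n h2 h3
    rw [e3 n h2 h3]
    simp [h2]

/-- The argument is pushed a second time, so that the command for `f` consumes one copy and leaves
the other below its result. The two are then paired for `g`. -/
theorem Realizes.bind {f : α → Prog β} {g : α → β → Prog γ} {w : α → ℕ} {w' : α × β → ℕ}
    (hf : Realizes f w) (hg : Realizes (fun p : α × β => g p.1 p.2) w') (D : ℕ)
    (hw : ∀ a, (f a).AllResults fun b => w' (a, b) ≤ D * (w a + 1)) :
    Realizes (fun a => (f a).bind (g a)) w := by
  obtain ⟨c, C, hc⟩ := hf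
  obtain ⟨c', C', hc'⟩ := hg
  refine ⟨.seq (.assign 2 (.cons (.hd (.var 2)) (.var 2))) (.seq c (.seq (.assign 2
    (.cons (.cons (.hd (.tl (.var 2))) (.hd (.var 2))) (.tl (.tl (.var 2))))) c')),
    C + C' * (D + 1) + 2, fun a rest s t hs ht => ?_⟩
  have h1 : (C + C' * (D + 1) + 2) * (w a + 1)
    = C * (w a + 1) + C' * (D + 1) * (w a + 1) + 2 * (w a + 1) := by ring
  have h2 : ∀ n, n ≤ D * (w a + 1) → C' * (n + 1) ≤ C' * (D + 1) * (w a + 1) := by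
    intro n hn
    rw [mul_assoc]
    refine Nat.mul_le_mul_left C' ?_
    nlinarith
  obtain ⟨t, rfl⟩ : ∃ t', t = t' + 1 := ⟨t - 1, by omega⟩
  rw [Cmd.run, Cmd.run, ret_some_bindO, Cmd.run, total_bind]
  refine ((hc a (.node (enc a) rest) _ t ?_ (by omega)).of_total (hw a)).bindO ?_
  · simp [Expr.eval, hs, Val.fst]
  rintro b ⟨s1, t1⟩ ⟨⟨e1, e2, e3⟩, hb⟩
  simp only at e1 e2 e3 ⊢
  have h3 := h2 _ hb
  obtain ⟨t1, rfl⟩ : ∃ t', t1 = t' + 1 := ⟨t1 - 1, by omega⟩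
  rw [Cmd.run, Cmd.run, ret_some_bindO]
  refine (hc' (a, b) rest _ t1 ?_ (by omega)).mono fun x r ⟨e1', e2', e3'⟩ =>
    ⟨e1', by omega, ?_⟩
  · simp [Expr.eval, e1, Val.fst, Val.snd]
  · intro n hn2 hn3
    rw [e3' n hn2 hn3]
    simp [hn2, e3 n hn2 hn3]

theorem Realizes.bind' {f : α → Prog β} {g : α → β → Prog γ} {w : α → ℕ}
    (hf : Realizes f w) (hg : Realizes (fun p : α × β => g p.1 p.2) fun p => w p.1) :
    Realizes (fun a => (f a).bind (g a)) w :=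
  hf.bind hg 1 fun a => allResults_of_forall _ fun b => by simp

theorem Realizes.letE {g : α → β} {F : α → β → Prog γ} {w : α → ℕ}
    (hg : Realizes (fun a => Prog.ret (g a)) w)
    (hF : Realizes (fun p : α × β => F p.1 p.2) fun p => w p.1) :
    Realizes (fun a => F a (g a)) w :=
  Realizes.bind' hg hF

theorem Realizes.coin (w : α → ℕ) : Realizes (fun _ : α => Prog.coin Prog.ret) w := by
  refine ⟨.seq (.coin 3) (.assign 2 (.cons (.var 3) (.tl (.var 2)))), 2,
    fun a rest s t hs ht => ?_⟩
  obtain ⟨t, rfl⟩ : ∃ t', t = t' + 2 := ⟨t - 2, by omega⟩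
  refine ⟨_, rfl, fun b => ⟨_, rfl, ?_, ?_, fun n h2 h3 => ?_⟩⟩
  · simp [Expr.eval, hs, Val.snd]; rfl
  · simp only; omega
  · simp [h2, h3]

/-- Constant messages suffice: with the party fixed, whatever the reduced world tells the
functionality is a constant. The answer lands in the scratch variable and is never read. -/
theorem Realizes.call (v : Val) (w : α → ℕ) :
    Realizes (fun _ : α => Prog.call v fun _ => Prog.ret ()) w := by
  refine ⟨.seq (.call 3 (.const v)) (.assign 2 (.cons .nil (.tl (.var 2)))), v.size + 2,
    fun a rest s t hs ht => ?_⟩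
  have h1 : (v.size + 2) * (w a + 1) = v.size * w a + v.size + 2 * w a + 2 := by ring
  have h2 : v.size + 1 ≤ t := by omega
  obtain ⟨u, hu⟩ : ∃ u, t - (v.size + 1) = u + 1 := ⟨t - (v.size + 1) - 1, by omega⟩
  have hrun : (Cmd.seq (.call 3 (.const v)) (.assign 2 (.cons .nil (.tl (.var 2))))).run s t
      = .call v fun r => .ret (some (Function.update (Function.update s 3 r) 2
          ((Expr.cons .nil (.tl (.var 2))).eval (Function.update s 3 r)), u)) := by
    simp [Cmd.run, h2, hu]
  rw [hrun]
  refine ⟨_, rfl, fun b => ⟨_, rfl, ?_, ?_, fun n h2 h3 => ?_⟩⟩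
  · simp [Expr.eval, hs, Val.snd]; rfl
  · simp only; omega
  · simp [h2, h3]

/-- The measure `m` strictly decreases, so there are at most `m a` rounds, each consisting of one
test and a body of constant cost `C`, and one final test. -/
theorem Realizes.loop {test : α → Bool} {body : α → Prog α} {F : α → Prog α} {m : α → ℕ}
    (ht : IsExpr test) (hb : Realizes body fun _ => 0)
    (hF : ∀ a, F a = if test a then (body a).bind F else .ret a)
    (hm : ∀ a, test a = true → (body a).AllResults fun b => m b < m a) : Realizes F m := by
  obtain ⟨e, he⟩ := ht
  obtain ⟨c, C, hc⟩ := hb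
  refine ⟨.loop e c, C + 1, fun a rest s t hs ht => ?_⟩
  rw [Cmd.run]
  -- `Cmd.run` takes the time limit also as the bound on the number of tests; `m a + 1` tests are
  -- needed.
  have hfuel : m a < t := by nlinarith [Nat.zero_le (C * m a)]
  suffices h : ∀ (k : ℕ) (a : α) (s : Store) (t : ℕ), s 2 = .node (enc a) rest →
      (C + 1) * (m a + 1) ≤ t → m a < k →
      Refines (fun b (r : Store × ℕ) => r.1 2 = .node (enc b) rest ∧
        t ≤ r.2 + (C + 1) * (m a + 1) ∧ ∀ n, n ≠ 2 → n ≠ 3 → r.1 n = s n) (F a).total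
        (whileLoop (fun s => (e.eval s).toBool) (fun s t => c.run s t) k s t) from
    h t a s t hs ht hfuel
  clear hfuel hs ht a s t
  intro k
  induction k with
  | zero => intro a s t _ _ h; omega
  | succ k ih =>
    intro a s t hs ht hk
    have h1 : (C + 1) * (m a + 1) = C * m a + m a + C + 1 := by ring
    obtain ⟨t, rfl⟩ : ∃ t', t = t' + 1 := ⟨t - 1, by omega⟩
    rw [whileLoop, he s a rest hs, hF]
    cases hta : test a
    · rw [if_neg (by simp), if_neg (by simp [enc, Val.ofBool, Val.toBool])]
      exact ⟨_, rfl, hs, by simp only; omega, fun n _ _ => rfl⟩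
    · rw [if_pos rfl, if_pos (by rfl), total_bind]
      have hC : C * (0 + 1) ≤ t := by omega
      refine ((hc a rest s t hs hC).of_total (hm a hta)).bindO ?_
      rintro b ⟨s1, t1⟩ ⟨⟨e1, e2, e3⟩, hmb⟩
      simp only at e1 e2 e3 ⊢
      have h2 : (C + 1) * (m b + 1) ≤ (C + 1) * m a := Nat.mul_le_mul_left _ hmb
      have h3 : (C + 1) * m a = C * m a + m a := by ring
      refine (ih b s1 t1 e1 (by omega) (by omega)).mono ?_
      rintro x r ⟨f1, f2, f3⟩
      exact ⟨f1, by omega, fun n hn2 hn3 => (f3 n hn2 hn3).trans (e3 n hn2 hn3)⟩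

end
end MadHtlc

set_option linter.unusedSimpArgs false
namespace MadHtlc
open Prog
open Enc (enc)

/-! ### Realization of the simulator's subroutines -/

theorem realizes_reverse {α : Type} [Enc α] [Inhabited α] (hd : enc (default : α) = .nil) :
    Realizes (fun l : List α => Prog.ret l.reverse) List.length := by
  have h : Realizes (fun p : List α × List α => Prog.ret (([] : List α), p.1.reverse ++ p.2))
      fun p => p.1.length := by
    refine Realizes.loop (test := fun p => !p.1.isEmpty)
      (body := fun p => .ret (p.1.tail, p.1.headD default :: p.2)) IsExpr.id.fst.ne_nil
      (Realizes.ret (.pair IsExpr.id.fst.tail ((IsExpr.id.fst.head hd).cons IsExpr.id.snd)) _) ?_ ?_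
    · rintro ⟨l, acc⟩; cases l <;> simp
    · rintro ⟨l, acc⟩ hl; cases l <;> simp_all [AllResults]
  have h' := (h.comp (g := fun l : List α => (l, ([] : List α))) (w := List.length)
    (.pair .id (.const _)) 1 (by simp)).bind'
      (g := fun _ p => Prog.ret p.2) (Realizes.ret IsExpr.id.snd.snd _)
  simpa using h'

theorem Val.length_bits_le (v : Val) : v.bits.length ≤ v.size := by
  induction v with
  | nil => simp [bits]
  | node l r _ ih => simp [bits, size]; omega

/-- A loop can extend its accumulator only at the front, so it collects the bits in reverse order
and the result is reversed at the end. The same device is used for `drawP`. -/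
theorem realizes_bits : Realizes (fun v : Val => Prog.ret v.bits) Val.size := by
  have h : Realizes (fun p : Val × Bits => Prog.ret (Val.nil, p.1.bits.reverse ++ p.2))
      fun p => p.1.size := by
    refine Realizes.loop (test := fun p => p.1.toBool)
      (body := fun p => .ret (p.1.snd, p.1.fst.toBool :: p.2)) IsExpr.id.fst.toBool
      (Realizes.ret (.pair IsExpr.id.fst.valSnd (IsExpr.id.fst.valFst.toBool.cons IsExpr.id.snd)) _)
      ?_ ?_
    · rintro ⟨v, acc⟩; cases v <;> simp [Val.toBool, Val.bits, Val.fst, Val.snd]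
    · rintro ⟨v, acc⟩ hl
      cases v <;> simp_all [AllResults, Val.toBool, Val.snd, Val.size]
  have hr : Realizes (fun x : Val × (Val × Bits) => Prog.ret x.2.2.reverse)
      fun x => x.2.2.length := (realizes_reverse (α := Bool) rfl).comp IsExpr.id.snd.snd 1 (by simp)
  have h' := (h.comp (g := fun v : Val => (v, ([] : Bits))) (w := Val.size)
    (.pair .id (.const _)) 1 (by simp)).bind
      (g := fun _ p => Prog.ret p.2.reverse) hr 1 fun v => by
        have := v.length_bits_le
        simp [AllResults]; omega
  simpa using h'

section
variable {α : Type} [Enc α]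

theorem IsExpr.and {g g' : α → Bool} (h : IsExpr g) (h' : IsExpr g') :
    IsExpr (fun a => g a && g' a) := by
  have hinj : Function.Injective (enc : Bool × Bool → Val) := by
    rintro ⟨_ | _, _ | _⟩ ⟨_ | _, _ | _⟩ <;> simp [enc, Val.ofBool]
  refine ((h.pair h').beq hinj (.const (true, true))).congr fun a => ?_
  cases g a <;> cases g' a <;> rfl

theorem IsExpr.headKey {g : α → Table} (h : IsExpr g) :
    IsExpr (fun a => ((g a).headD default).1) :=
  IsExpr.map₁ (F := fun l : Table => (l.headD default).1) (fun e => .hd (.hd e))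
    (fun v => v.fst.fst) (fun _ _ => rfl) (fun l => by cases l <;> rfl) h

theorem IsExpr.headVal {g : α → Table} (h : IsExpr g) :
    IsExpr (fun a => ((g a).headD default).2) :=
  IsExpr.map₁ (F := fun l : Table => (l.headD default).2) (fun e => .tl (.hd e))
    (fun v => v.fst.snd) (fun _ _ => rfl) (fun l => by cases l <;> rfl) h

theorem IsExpr.pred {g : α → ℕ} (h : IsExpr g) : IsExpr (fun a => g a - 1) :=
  IsExpr.map₁ (F := fun n => n - 1) .tl Val.snd (fun _ _ => rfl)
    (fun n => by cases n <;> rfl) h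

theorem IsExpr.ne_zero {g : α → ℕ} (h : IsExpr g) : IsExpr (fun a => !decide (g a = 0)) :=
  (h.encode.toBool).congr fun a => by cases g a <;> rfl

end

/-- The loop drops entries until the key is at the head. If anything is left, the answer is stored
in its first entry. -/
theorem realizes_lookup :
    Realizes (fun p : Table × Bits => Prog.ret (p.1.lookup p.2)) fun p => p.1.length := by
  have h : Realizes (fun p : Table × Bits => Prog.ret
      (p.1.dropWhile (fun x => !decide (x.1 = p.2)), p.2)) fun p => p.1.length := by
    refine Realizes.loop
      (test := fun p => !p.1.isEmpty && !decide ((p.1.headD default).1 = p.2))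
      (body := fun p => .ret (p.1.tail, p.2))
      (IsExpr.id.fst.ne_nil.and (IsExpr.id.fst.headKey.beq enc_bits_injective IsExpr.id.snd).not)
      (Realizes.ret (.pair IsExpr.id.fst.tail IsExpr.id.snd) _) ?_ ?_
    · rintro ⟨l, q⟩
      cases l with
      | nil => simp
      | cons x l => by_cases hx : x.1 = q <;> simp [hx]
    · rintro ⟨l, q⟩ hl; cases l <;> simp_all [AllResults]
  have h' := h.bind' (g := fun _ p => if !p.1.isEmpty then .ret (some (p.1.headD default).2)
    else .ret none) (Realizes.ite IsExpr.id.snd.fst.ne_nil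
      (Realizes.ret IsExpr.id.snd.fst.headVal.optSome _) (Realizes.ret (.const _) _))
  convert h' using 2 with p
  obtain ⟨T, q⟩ := p
  simp only [ret_bind]
  induction T with
  | nil => simp
  | cons x T ih =>
    obtain ⟨k, v⟩ := x
    by_cases hx : k = q
    · simp [hx, List.lookup]
    · have : (q == k) = false := by simpa using fun h => hx h.symm
      rw [List.lookup, this]
      have h2 : List.dropWhile (fun x : Bits × Bits => !decide (x.1 = q)) ((k, v) :: T)
          = List.dropWhile (fun x => !decide (x.1 = q)) T := by simp [hx]
      rw [h2]
      exact ih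

theorem realizes_drawP : Realizes drawP fun n => n := by
  have h : Realizes (fun p : ℕ × Bits => (drawP p.1).bind fun bs => .ret (0, bs.reverse ++ p.2))
      fun p => p.1 := by
    refine Realizes.loop (test := fun p => !decide (p.1 = 0))
      (body := fun p => (Prog.coin .ret).bind fun b => .ret (p.1 - 1, b :: p.2)) IsExpr.id.fst.ne_zero
      (Realizes.bind' (Realizes.coin _) (Realizes.ret (.pair IsExpr.id.fst.fst.pred
        (IsExpr.id.snd.cons IsExpr.id.fst.snd)) _)) ?_ ?_
    · rintro ⟨n, acc⟩
      cases n <;> simp [drawP, Prog.bind_assoc]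
    · rintro ⟨n, acc⟩ hn
      simp at hn
      exact fun b => Nat.sub_lt (Nat.pos_of_ne_zero hn) one_pos
  have hlen : ∀ n, (drawP n).AllResults fun bs => bs.length = n := by
    intro n
    induction n with
    | zero => rfl
    | succ n ih =>
      intro b
      rw [allResults_bind]
      exact ih.mono fun bs hbs => by simpa [AllResults] using hbs
  have hr : Realizes (fun x : ℕ × (ℕ × Bits) => Prog.ret x.2.2.reverse)
      fun x => x.2.2.length := (realizes_reverse (α := Bool) rfl).comp IsExpr.id.snd.snd 1 (by simp)
  have h' := (h.comp (g := fun n : ℕ => (n, ([] : Bits))) (w := fun n => n)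
    (.pair .id (.const _)) 1 (by simp)).bind (g := fun _ p => Prog.ret p.2.reverse) hr 1
      fun n => by
        rw [allResults_bind]
        exact (hlen n).mono fun bs hbs => by simp [AllResults, hbs]
  simpa [Prog.bind_assoc] using h'

theorem realizes_hashP : Realizes (fun p : ℕ × Table × Bits => hashP p.1 p.2.1 p.2.2)
    fun p => p.1 + p.2.1.length := by
  have hl : Realizes (fun p : ℕ × Table × Bits => Prog.ret (p.2.1.lookup p.2.2))
      fun p => p.1 + p.2.1.length :=
    realizes_lookup.comp (g := fun p : ℕ × Table × Bits => p.2) IsExpr.id.snd 1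
      fun p => by omega
  have hd : Realizes (fun x : (ℕ × Table × Bits) × Option Bits =>
      (drawP x.1.1).bind fun r => .ret (r, (x.1.2.2, r) :: x.1.2.1))
      fun x => x.1.1 + x.1.2.1.length :=
    Realizes.bind' (realizes_drawP.comp (g := fun x : (ℕ × Table × Bits) × Option Bits => x.1.1)
      IsExpr.id.fst.fst 1 fun p => by omega) (Realizes.ret (.pair IsExpr.id.snd
        (.cons (.pair IsExpr.id.fst.fst.snd.snd IsExpr.id.snd) IsExpr.id.fst.fst.snd.fst)) _)
  have h := Realizes.letE hl (F := fun p o => if o.isSome then .ret (o.getD default, p.2.1) else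
    (drawP p.1).bind fun r => .ret (r, (p.2.2, r) :: p.2.1))
    (Realizes.ite IsExpr.id.snd.isSome (Realizes.ret (.pair (IsExpr.id.snd.getD rfl)
      IsExpr.id.fst.snd.fst) _) hd)
  convert h using 2 with p
  rw [hashP]
  cases p.2.1.lookup p.2.2 <;> simp

theorem realizes_preimageP :
    Realizes (fun p : ℕ × Table × Option Bits × Bits => preimageP p.1 p.2.1 p.2.2.1 p.2.2.2)
      fun p => p.1 + p.2.1.length := by
  have hh : Realizes (fun p : ℕ × Table × Option Bits × Bits =>
      (hashP p.1 p.2.1 (p.2.2.1.getD default)).bind fun r => .ret (decide (r.1 = p.2.2.2), r.2))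
      fun p => p.1 + p.2.1.length :=
    Realizes.bind' (realizes_hashP.comp (g := fun p : ℕ × Table × Option Bits × Bits =>
        (p.1, p.2.1, p.2.2.1.getD default))
      (.pair IsExpr.id.fst (.pair IsExpr.id.snd.fst (IsExpr.id.snd.snd.fst.getD rfl))) 1
      fun p => by dsimp only; omega)
      (Realizes.ret (.pair (IsExpr.id.snd.fst.beq enc_bits_injective IsExpr.id.fst.snd.snd.snd)
        IsExpr.id.snd.snd) _)
  have h := Realizes.ite (IsExpr.id.snd.snd.fst (α := ℕ × Table × Option Bits × Bits)).isSome hh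
    (Realizes.ret (g := fun p : ℕ × Table × Option Bits × Bits => (false, p.2.1)) (.pair (.const _) IsExpr.id.snd.fst) _)
  convert h using 2 with p
  cases hp : p.2.2.1 <;> simp [preimageP]

end MadHtlc

set_option linter.unusedSimpArgs false
namespace MadHtlc
open Prog
open Enc (enc)

/-! ### Realization of the reduced world -/

def Stage.index : Stage → ℕ
  | start => 0
  | digests => 1
  | created => 2
  | published => 3
  | initiated => 4

instance : Enc Stage := ⟨fun s => .ofNat s.index⟩

theorem enc_stage_injective : Function.Injective (enc : Stage → Val) := fun x y h => by
  have := ofNat_injective h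
  cases x <;> cases y <;> simp_all [Stage.index]

/-- The components of a state of the reduced world, without the log. -/
def Red.tuple (s : Red) : ℕ × Table × Stage × Bits × Bits × Bits × Bits × Bool × Option Bits ×
    Bool × Bool :=
  (s.mu, s.table, s.stage, s.d1, s.d2, s.pa, s.pb, s.shared, s.apre, s.pubA, s.pubB)

instance : Enc Red := ⟨fun s => enc s.tuple⟩

section
variable {α β γ : Type} [Enc α] [Enc β] [Enc γ]

section
variable {g : α → Red} (h : IsExpr g)
include h

theorem IsExpr.tuple : IsExpr (fun a => (g a).tuple) := h.congr fun _ => rfl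
theorem IsExpr.mu : IsExpr (fun a => (g a).mu) := h.tuple.fst
theorem IsExpr.table : IsExpr (fun a => (g a).table) := h.tuple.snd.fst
theorem IsExpr.stage : IsExpr (fun a => (g a).stage) := h.tuple.snd.snd.fst
theorem IsExpr.d1 : IsExpr (fun a => (g a).d1) := h.tuple.snd.snd.snd.fst
theorem IsExpr.d2 : IsExpr (fun a => (g a).d2) := h.tuple.snd.snd.snd.snd.fst
theorem IsExpr.pa : IsExpr (fun a => (g a).pa) := h.tuple.snd.snd.snd.snd.snd.fst
theorem IsExpr.pb : IsExpr (fun a => (g a).pb) := h.tuple.snd.snd.snd.snd.snd.snd.fst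
theorem IsExpr.shared : IsExpr (fun a => (g a).shared) := h.tuple.snd.snd.snd.snd.snd.snd.snd.fst
theorem IsExpr.apre : IsExpr (fun a => (g a).apre) :=
  h.tuple.snd.snd.snd.snd.snd.snd.snd.snd.fst
theorem IsExpr.pubA : IsExpr (fun a => (g a).pubA) :=
  h.tuple.snd.snd.snd.snd.snd.snd.snd.snd.snd.fst
theorem IsExpr.pubB : IsExpr (fun a => (g a).pubB) :=
  h.tuple.snd.snd.snd.snd.snd.snd.snd.snd.snd.snd

end

/-- The log is not part of the encoding, so it may be any function of the argument; no machine ever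
has to compute it. -/
theorem IsExpr.red {f1 : α → ℕ} {f2 : α → Table} {f3 : α → Stage} {f4 f5 f6 f7 : α → Bits}
    {f8 : α → Bool} {f9 : α → Option Bits} {f10 f11 : α → Bool} {f12 : α → List RedeemTx}
    (h1 : IsExpr f1) (h2 : IsExpr f2) (h3 : IsExpr f3) (h4 : IsExpr f4) (h5 : IsExpr f5)
    (h6 : IsExpr f6) (h7 : IsExpr f7) (h8 : IsExpr f8) (h9 : IsExpr f9) (h10 : IsExpr f10)
    (h11 : IsExpr f11) :
    IsExpr (fun a => Red.mk (f1 a) (f2 a) (f3 a) (f4 a) (f5 a) (f6 a) (f7 a) (f8 a) (f9 a)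
      (f10 a) (f11 a) (f12 a)) :=
  (h1.pair (h2.pair (h3.pair (h4.pair (h5.pair (h6.pair (h7.pair (h8.pair (h9.pair
    (h10.pair h11)))))))))).congr fun _ => rfl

theorem IsExpr.or {g g' : α → Bool} (h : IsExpr g) (h' : IsExpr g') :
    IsExpr (fun a => g a || g' a) :=
  (h.not.and h'.not).not.congr fun a => by cases g a <;> cases g' a <;> rfl

theorem IsExpr.decide_and {p q : α → Prop} [DecidablePred p] [DecidablePred q]
    (h : IsExpr fun a => decide (p a)) (h' : IsExpr fun a => decide (q a)) :
    IsExpr (fun a => decide (p a ∧ q a)) :=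
  (h.and h').congr fun a => by simp

theorem IsExpr.decide_or {p q : α → Prop} [DecidablePred p] [DecidablePred q]
    (h : IsExpr fun a => decide (p a)) (h' : IsExpr fun a => decide (q a)) :
    IsExpr (fun a => decide (p a ∨ q a)) :=
  (h.or h').congr fun a => by simp

theorem IsExpr.ofBits {g : α → Bits} (h : IsExpr g) : IsExpr (fun a => Val.ofBits (g a)) :=
  h.congr fun _ => enc_bits _

theorem IsExpr.ofOptBits {g : α → Option Bits} (h : IsExpr g) :
    IsExpr (fun a => Val.ofOptBits (g a)) :=
  h.congr fun a => by cases g a <;> simp [Val.ofOptBits, enc_bits]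

theorem IsExpr.ofBool {g : α → Bool} (h : IsExpr g) : IsExpr (fun a => Val.ofBool (g a)) :=
  h.congr fun _ => rfl

theorem IsExpr.decide_tx {x x' y y' : α → Bits} (hx : IsExpr x) (hx' : IsExpr x')
    (hy : IsExpr y) (hy' : IsExpr y') :
    IsExpr (fun a => decide ((⟨x a, x' a⟩ : Tx) = ⟨y a, y' a⟩)) :=
  ((hx.beq enc_bits_injective hy).and (hx'.beq enc_bits_injective hy')).congr fun a => by simp

theorem Realizes.iteP {p : α → Prop} [DecidablePred p] {f g : α → Prog β} {w : α → ℕ}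
    (hp : IsExpr fun a => decide (p a)) (hf : Realizes f w) (hg : Realizes g w) :
    Realizes (fun a => if p a then f a else g a) w := by
  simpa using Realizes.ite hp hf hg

/-- The decoded party is eliminated by a case distinction. Afterwards it is a constant, and
different commands may serve different parties. -/
theorem Realizes.party {g : α → Val} (hg : IsExpr g) {f : Party → α → Prog β} {w : α → ℕ}
    (hf : ∀ P, Realizes (f P) w) : Realizes (fun a => f (.ofVal (g a)) a) w := by
  convert Realizes.iteP (hg.len_le 0) (hf .A) (Realizes.iteP (hg.len_le 1) (hf .B) (hf .M))
    using 2 with a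
  rw [Party.ofVal]
  rcases (g a).len with _ | _ | n <;> simp

theorem Realizes.rpath {g : α → Val} (hg : IsExpr g) {f : RPath → α → Prog β} {w : α → ℕ}
    (hf : ∀ path, Realizes (f path) w) : Realizes (fun a => f (.ofVal (g a)) a) w := by
  convert Realizes.iteP (hg.len_le 0) (hf .depA) (Realizes.iteP (hg.len_le 1) (hf .depB)
    (Realizes.iteP (hg.len_le 2) (hf .depM) (Realizes.iteP (hg.len_le 3) (hf .colB) (hf .colM))))
    using 2 with a
  rw [RPath.ofVal]
  rcases (g a).len with _ | _ | _ | _ | n <;> simp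

theorem Realizes.bits {g : α → Val} (hg : IsExpr g) {F : α → Bits → Prog β} {w : α → ℕ}
    (hw : ∀ a, (g a).size ≤ w a) (hF : Realizes (fun p : α × Bits => F p.1 p.2) fun p => w p.1) :
    Realizes (fun a => F a (g a).bits) w :=
  Realizes.letE (realizes_bits.comp hg 1 fun a => by have := hw a; omega) hF

theorem Val.size_fst_le (v : Val) : v.fst.size ≤ v.size := by
  cases v <;> simp [fst, size]; omega

theorem Val.size_snd_le (v : Val) : v.snd.size ≤ v.size := by
  cases v <;> simp [snd, size]; omega

theorem Realizes.optBits {g : α → Val} (hg : IsExpr g) {F : α → Option Bits → Prog β}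
    {w : α → ℕ} (hw : ∀ a, (g a).size ≤ w a)
    (hF : Realizes (fun p : α × Option Bits => F p.1 p.2) fun p => w p.1) :
    Realizes (fun a => F a (g a).optBits) w := by
  refine Realizes.letE ?_ hF
  convert Realizes.ite hg.toBool (Realizes.bits (F := fun _ x => Prog.ret (some x)) hg.valFst
    (fun a => (Val.size_fst_le _).trans (hw a)) (Realizes.ret IsExpr.id.snd.optSome _))
    (Realizes.ret (.const none) w) using 2 with a
  cases g a <;> simp [Val.optBits, Val.toBool, Val.fst]

theorem realizes_tellIf {b : α → Bool} (hb : IsExpr b) (v : Val) (w : α → ℕ) :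
    Realizes (fun a => tellIf (b a) v) w :=
  Realizes.ite hb (Realizes.call v w) (Realizes.ret (.const ()) w)

/-! #### Notes -/

variable (corr : Finset Party)

theorem isExpr_rPredicate (path : RPath) (P : Party) {x y : α → Bool} (hx : IsExpr x)
    (hy : IsExpr y) : IsExpr (fun a => rPredicate path P (x a) (y a)) := by
  cases path
  · exact (IsExpr.const (decide (P = .A))).and hx
  · exact (IsExpr.const (decide (P = .B))).and hy
  · exact hx.and hy
  · exact IsExpr.const _
  · exact hx.and hy

/-- The set of corrupted parties is fixed, so the shape of the note is known when the command is
built. It is a constant tree with a few variable leaves. -/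
theorem isExpr_setupBNote {d1 d2 : α → Bits} (h1 : IsExpr d1) (h2 : IsExpr d2) :
    IsExpr (fun a => setupBNote corr (d1 a) (d2 a)) := by
  by_cases hA : Party.A ∈ corr <;>
  simp only [setupBNote, noteVal, notesVal, toCorrupt, hA, if_true, if_false, List.map,
    Val.ofList, Note.toVal, Leak.toVal, GMsg.toVal, Val.tag, Party.toVal, Val.ofNat] <;>
  repeat' first | exact IsExpr.const _ | exact h1.ofBits | exact h2.ofBits | apply IsExpr.node

theorem isExpr_txNote {d1 d2 : α → Bits} (h1 : IsExpr d1) (h2 : IsExpr d2) :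
    IsExpr (fun a => setupANote corr ⟨d1 a, d2 a⟩) ∧
    IsExpr (fun a => publishNote corr ⟨d1 a, d2 a⟩) ∧
    IsExpr (fun a => initNote corr ⟨d1 a, d2 a⟩) := by
  refine ⟨?_, ?_, ?_⟩ <;>
  by_cases hA : Party.A ∈ corr <;> by_cases hB : Party.B ∈ corr <;>
    by_cases hM : Party.M ∈ corr <;>
  simp only [setupANote, publishNote, initNote, noteVal, notesVal, toCorrupt, hA, hB, hM, if_true,
    if_false, List.map, Val.ofList, Note.toVal, Leak.toVal, GMsg.toVal, Val.tag, Party.toVal,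
    Val.ofNat, Tx.toVal] <;>
  repeat' first | exact IsExpr.const _ | exact h1.ofBits | exact h2.ofBits | apply IsExpr.node

theorem isExpr_redeemNote {p1 p2 : α → Option Bits} {d1 d2 : α → Bits} (path : RPath) (P : Party)
    {x y : α → Bool} (hp1 : IsExpr p1) (hp2 : IsExpr p2) (h1 : IsExpr d1) (h2 : IsExpr d2)
    (hx : IsExpr x) (hy : IsExpr y) :
    IsExpr (fun a => redeemNote corr (p1 a) (p2 a) (d1 a) (d2 a) path P (x a) (y a)) := by
  by_cases hP : P ∈ corr <;>
  simp only [redeemNote, noteVal, notesVal, toCorrupt, hP, if_true, if_false, List.map,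
    Val.ofList, Note.toVal, Leak.toVal, GMsg.toVal, Val.tag] <;>
  repeat' first
    | exact IsExpr.const _ | exact h1.ofBits | exact h2.ofBits | exact hp1.ofOptBits
    | exact hp2.ofOptBits | exact hx.ofBool | exact hy.ofBool
    | exact (isExpr_rPredicate path P hx hy).ofBool | apply IsExpr.node

end
end MadHtlc

set_option linter.unusedSimpArgs false
namespace MadHtlc
open Prog
open Enc (enc)

/-! ### Commands for the transitions of the reduced world -/

section
variable {α β γ : Type} [Enc α] [Enc β] [Enc γ]
variable (corr : Finset Party)

theorem IsExpr.stage_eq {g : α → Stage} (h : IsExpr g) (st : Stage) :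
    IsExpr (fun a => decide (g a = st)) := h.beq enc_stage_injective (.const st)

theorem IsExpr.decide_const {p : Prop} [Decidable p] : IsExpr (fun _ : α => decide p) := .const _

theorem IsExpr.preA {g : α → Red} (h : IsExpr g) (P : Party) : IsExpr (fun a => (g a).preA P) := by
  cases P
  · exact h.apre
  · exact h.pa.optSome
  · exact .const none

theorem IsExpr.preB {g : α → Red} (h : IsExpr g) (P : Party) : IsExpr (fun a => (g a).preB P) := by
  cases P
  · exact .const none
  · exact h.pb.optSome
  · exact .const none

theorem IsExpr.redeem {g : α → Red} (h : IsExpr g) (P : Party) (path : RPath) {x y : α → Bool}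
    (hx : IsExpr x) (hy : IsExpr y) :
    IsExpr (fun a => (g a).redeem corr P path (x a) (y a)) :=
  .red h.mu h.table h.stage h.d1 h.d2 h.pa h.pb h.shared h.apre (h.pubA.or hx) (h.pubB.or hy)

theorem realizes_redHash : Realizes (fun p : Red × Bits => redHash p.1 p.2)
    fun p => p.1.mu + p.1.table.length := by
  refine Realizes.bind' (realizes_hashP.comp (g := fun p : Red × Bits => (p.1.mu, p.1.table, p.2))
    (.pair IsExpr.id.fst.mu (.pair IsExpr.id.fst.table IsExpr.id.snd)) 1 fun p => by dsimp only; omega)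
    (Realizes.ret (.pair IsExpr.id.snd.fst.ofBits ?_) _)
  have h : IsExpr fun p : (Red × Bits) × Bits × Table => p.1.1 := IsExpr.id.fst.fst
  exact .red h.mu IsExpr.id.snd.snd h.stage h.d1 h.d2 h.pa h.pb h.shared h.apre h.pubA h.pubB

theorem realizes_redShare : Realizes (fun p : Red × Bits => redShare p.1 p.2)
    fun p => p.1.mu + p.1.table.length := by
  have h0 : IsExpr fun p : Red × Bits => p.1 := IsExpr.id.fst
  have h : IsExpr fun p : ((Red × Bits) × Bits × Table) × Unit => p.1.1.1 := IsExpr.id.fst.fst.fst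
  have hh := realizes_hashP.comp (g := fun p : Red × Bits => (p.1.mu, p.1.table, p.2))
    (w := fun p : Red × Bits => p.1.mu + p.1.table.length)
    (.pair IsExpr.id.fst.mu (.pair IsExpr.id.fst.table IsExpr.id.snd)) 1
    fun p => by dsimp only; omega
  have hx : IsExpr fun p : ((Red × Bits) × Bits × Table) × Unit => p.1.1.2 := IsExpr.id.fst.fst.snd
  have hr : IsExpr fun p : ((Red × Bits) × Bits × Table) × Unit => p.1.2 := IsExpr.id.fst.snd
  have he : IsExpr fun p : (Red × Bits) × Bits × Table => decide (p.2.1 = p.1.1.d1) :=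
    IsExpr.id.snd.fst.beq enc_bits_injective IsExpr.id.fst.fst.d1
  have he' : IsExpr fun p : ((Red × Bits) × Bits × Table) × Unit =>
      decide (p.1.2.1 = p.1.1.1.d1) := hr.fst.beq enc_bits_injective h.d1
  have hb := Realizes.bind' hh (g := fun p r =>
    (tellIf (decide (r.1 = p.1.d1)) (inputReq .B .share)).bind fun _ =>
      if r.1 = p.1.d1 then .ret (Val.nil, { p.1 with table := r.2, apre := some p.2 })
      else .ret (.nil, { p.1 with table := r.2 }))
    (Realizes.bind' (realizes_tellIf he _ _) (Realizes.iteP he'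
      (Realizes.ret (.pair (.const _) (.red h.mu hr.snd h.stage h.d1 h.d2 h.pa h.pb h.shared
        hx.optSome h.pubA h.pubB)) _)
      (Realizes.ret (.pair (.const _) (.red h.mu hr.snd h.stage h.d1 h.d2 h.pa h.pb h.shared
        h.apre h.pubA h.pubB)) _)))
  convert Realizes.iteP ((h0.stage.stage_eq .created).decide_or (h0.stage.stage_eq .published)) hb
    (Realizes.ret (.pair (.const Val.nil) h0) _) using 2 with p
  rw [redShare]
  have hst : p.1.stage.phase = .initiation ↔ p.1.stage = .created ∨ p.1.stage = .published := by
    cases p.1.stage <;> simp [Stage.phase]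
  simp only [hst]
  congr 2
  funext r
  congr 1
  funext _
  split_ifs <;> rfl

theorem realizes_redRedeem (P : Party) (path : RPath) :
    Realizes (fun p : Red × (Bits × Bits) × Option Bits × Option Bits =>
      redRedeem corr p.1 P ⟨p.2.1.1, p.2.1.2⟩ p.2.2.1 p.2.2.2 path)
      fun p => p.1.mu + p.1.table.length := by
  have h0 : IsExpr fun p : Red × (Bits × Bits) × Option Bits × Option Bits => p.1 := IsExpr.id.fst
  have c0 : IsExpr fun p : Red × (Bits × Bits) × Option Bits × Option Bits => p.2 := IsExpr.id.snd
  let α1 : Type := (Red × (Bits × Bits) × Option Bits × Option Bits) × Bool × Table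
  let α2 : Type := α1 × Bool × Table
  let α3 : Type := α2 × Unit
  let α4 : Type := α3 × Unit
  have h1 : IsExpr fun p : α1 => p.1.1 := IsExpr.id.fst.fst
  have h2 : IsExpr fun p : α2 => p.1.1.1 := IsExpr.id.fst.fst.fst
  have h3 : IsExpr fun p : α3 => p.1.1.1.1 := IsExpr.id.fst.fst.fst.fst
  have h4 : IsExpr fun p : α4 => p.1.1.1.1.1 := IsExpr.id.fst.fst.fst.fst.fst
  have a2 : IsExpr fun p : α2 => p.1.1.1.pubA || p.1.2.1 := h2.pubA.or IsExpr.id.fst.snd.fst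
  have b3 : IsExpr fun p : α3 => p.1.1.1.1.pubB || p.1.2.1 := h3.pubB.or IsExpr.id.fst.snd.fst
  have x4 : IsExpr fun p : α4 => p.1.1.1.2.1 := IsExpr.id.fst.fst.fst.snd.fst
  have y4 : IsExpr fun p : α4 => p.1.1.2.1 := IsExpr.id.fst.fst.snd.fst
  have a4 : IsExpr fun p : α4 => p.1.1.1.1.1.pubA || p.1.1.1.2.1 := h4.pubA.or x4
  have b4 : IsExpr fun p : α4 => p.1.1.1.1.1.pubB || p.1.1.2.1 := h4.pubB.or y4
  have c4 : IsExpr fun p : α4 => p.1.1.1.1.2 := IsExpr.id.fst.fst.fst.fst.snd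
  have s4 : IsExpr fun p : α4 => ({ p.1.1.1.1.1 with table := p.1.1.2.2 } : Red) :=
    .red h4.mu IsExpr.id.fst.fst.snd.snd h4.stage h4.d1 h4.d2 h4.pa h4.pb h4.shared h4.apre
      h4.pubA h4.pubB
  have n4 := isExpr_redeemNote corr path P c4.snd.fst c4.snd.snd h4.d1 h4.d2 a4 b4
  have hp1 : Realizes (fun p : Red × (Bits × Bits) × Option Bits × Option Bits =>
      preimageP p.1.mu p.1.table p.2.2.1 p.1.d1) fun p => p.1.mu + p.1.table.length :=
    realizes_preimageP.comp (g := fun p : Red × (Bits × Bits) × Option Bits × Option Bits =>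
      (p.1.mu, p.1.table, p.2.2.1, p.1.d1))
      (.pair h0.mu (.pair h0.table (.pair c0.snd.fst h0.d1))) 1 fun p => by dsimp only; omega
  have hp2 : Realizes (fun p : α1 => preimageP p.1.1.mu p.2.2 p.1.2.2.2 p.1.1.d2)
      fun p => p.1.1.mu + p.2.2.length :=
    realizes_preimageP.comp (g := fun p : α1 => (p.1.1.mu, p.2.2, p.1.2.2.2, p.1.1.d2))
      (.pair h1.mu (.pair IsExpr.id.snd.snd (.pair IsExpr.id.fst.snd.snd.snd h1.d2))) 1
      fun p => by dsimp only; omega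
  have hfin := Realizes.ret (n4.pair (s4.redeem corr P path x4 y4))
    fun p : α4 => p.1.1.1.1.1.mu + p.1.1.1.2.2.length
  have hk : Realizes (fun p : α1 => (preimageP p.1.1.mu p.2.2 p.1.2.2.2 p.1.1.d2).bind fun h2 =>
      (tellIf (p.1.1.pubA || p.2.1) updateAReq).bind fun _ =>
      (tellIf (p.1.1.pubB || h2.1) updateBReq).bind fun _ =>
      .ret (redeemNote corr p.1.2.2.1 p.1.2.2.2 p.1.1.d1 p.1.1.d2 path P (p.1.1.pubA || p.2.1)
        (p.1.1.pubB || h2.1), { p.1.1 with table := h2.2 }.redeem corr P path p.2.1 h2.1))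
      fun p => p.1.1.mu + p.2.2.length :=
    Realizes.bind' hp2 (Realizes.bind' (realizes_tellIf a2 updateAReq _)
      (Realizes.bind' (realizes_tellIf b3 updateBReq _) hfin))
  -- The second test works on the table left by the first, which has at most one more entry; the
  -- factor `1` absorbs it.
  have hb := Realizes.bind (g := fun p h1 =>
      (preimageP p.1.mu h1.2 p.2.2.2 p.1.d2).bind fun h2 =>
      (tellIf (p.1.pubA || h1.1) updateAReq).bind fun _ =>
      (tellIf (p.1.pubB || h2.1) updateBReq).bind fun _ =>
      .ret (redeemNote corr p.2.2.1 p.2.2.2 p.1.d1 p.1.d2 path P (p.1.pubA || h1.1)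
        (p.1.pubB || h2.1), { p.1 with table := h2.2 }.redeem corr P path h1.1 h2.1)) hp1 hk 1
    fun p => (preimageP_results _ _ _ _).mono fun r hr => by
      have := hr.length
      dsimp only; omega
  exact Realizes.iteP ((h0.stage.stage_eq .initiated).decide_and
    (c0.fst.fst.decide_tx c0.fst.snd h0.d1 h0.d2)) hb (Realizes.ret (.pair (.const Val.nil) h0) _)

theorem realizes_redSend (P : Party) :
    Realizes (fun p : Red × Val => redSend corr p.1 P (.ofVal p.2))
      fun p => p.1.mu + p.1.table.length + p.2.size := by
  let w : Red × Val → ℕ := fun p => p.1.mu + p.1.table.length + p.2.size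
  have v0 : IsExpr fun p : Red × Val => p.2 := IsExpr.id.snd
  have h0 : IsExpr fun p : Red × Val => p.1 := IsExpr.id.fst
  have skip : ∀ {α' : Type} [Enc α'] {g : α' → Red} (hg : IsExpr g) (w' : α' → ℕ),
      Realizes (fun a => Prog.ret (Val.nil, g a)) w' :=
    fun hg w' => Realizes.ret (.pair (.const Val.nil) hg) _
  let β : Type := ((Red × Val) × Bits) × Bits
  have hβ : IsExpr fun p : β => p.1.1.1 := IsExpr.id.fst.fst.fst
  have x1 : IsExpr fun p : β => p.1.2 := IsExpr.id.fst.snd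
  have x2 : IsExpr fun p : β => p.2 := IsExpr.id.snd
  have hβ' : IsExpr fun p : β × Unit => p.1.1.1.1 := IsExpr.id.fst.fst.fst.fst
  have x1' : IsExpr fun p : β × Unit => p.1.1.2 := IsExpr.id.fst.fst.snd
  have x2' : IsExpr fun p : β × Unit => p.1.2 := IsExpr.id.fst.snd
  have eqTx : IsExpr fun p : β => decide ((⟨p.1.2, p.2⟩ : Tx) = ⟨p.1.1.1.d1, p.1.1.1.d2⟩) :=
    x1.decide_tx x2 hβ.d1 hβ.d2
  have h1 : IsExpr fun p : (Red × Val) × Unit => p.1.1 := IsExpr.id.fst.fst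
  have setupB : Realizes (fun p : Red × Val => redSend corr p.1 P
      (.setupB p.2.fst.bits p.2.snd.bits)) w := by
    refine Realizes.bits (F := fun p d1 => redSend corr p.1 P (.setupB d1 p.2.snd.bits)) v0.valFst
      (fun p => (Val.size_fst_le _).trans (Nat.le_add_left _ _)) ?_
    refine Realizes.bits (F := fun p d2 => redSend corr p.1.1 P (.setupB p.2 d2))
      (IsExpr.id.fst.snd.valSnd) (fun p => (Val.size_snd_le _).trans (Nat.le_add_left _ _)) ?_
    exact Realizes.iteP (IsExpr.decide_const.decide_and (hβ.stage.stage_eq .start))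
      (Realizes.bind' (Realizes.call _ _) (Realizes.ret (.pair (isExpr_setupBNote corr x1' x2')
        (.red hβ'.mu hβ'.table (.const .digests) x1' x2' hβ'.pa hβ'.pb hβ'.shared hβ'.apre
          hβ'.pubA hβ'.pubB)) _)) (skip hβ _)
  have setupA : Realizes (fun p : Red × Val => redSend corr p.1 P .setupA) w := by
    have hn := (isExpr_txNote corr h1.d1 h1.d2).1
    have hb : Realizes (fun p : Red × Val => (tell (inputReq .A .setupA)).bind fun _ =>
        if p.1.stage = .digests then
          .ret (setupANote corr ⟨p.1.d1, p.1.d2⟩, { p.1 with stage := .created })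
        else .ret (setupANote corr ⟨p.1.d1, p.1.d2⟩, p.1)) w :=
      Realizes.bind' (Realizes.call _ _) (Realizes.iteP (h1.stage.stage_eq .digests)
        (Realizes.ret (.pair hn (.red h1.mu h1.table (.const .created) h1.d1 h1.d2 h1.pa h1.pb
          h1.shared h1.apre h1.pubA h1.pubB)) _) (Realizes.ret (.pair hn h1) _))
    convert Realizes.iteP (IsExpr.decide_const (p := P = .A)) (Realizes.iteP
      (h0.stage.stage_eq .start) (skip h0 w) hb) (skip h0 w) using 2 with p
    obtain ⟨⟨mu, T, st, e1, e2, pa, pb, sh, apre, pubA, pubB, log⟩, v⟩ := p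
    by_cases hP : P = .A <;> cases st <;> simp [redSend, hP, Stage.afterSetupA]
  have readTx : ∀ (f : Tx → Red → Prog (Val × Red)),
      Realizes (fun p : β => f ⟨p.1.2, p.2⟩ p.1.1.1) (fun p => w p.1.1) →
      Realizes (fun p : Red × Val => f (.ofVal p.2) p.1) w := by
    intro f hf
    refine Realizes.bits (F := fun p d1 => f ⟨d1, p.2.snd.bits⟩ p.1) v0.valFst
      (fun p => (Val.size_fst_le _).trans (Nat.le_add_left _ _)) ?_
    exact Realizes.bits (F := fun (p : (Red × Val) × Bits) d2 => f ⟨p.2, d2⟩ p.1.1)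
      (IsExpr.id.fst.snd.valSnd) (fun p => (Val.size_snd_le _).trans (Nat.le_add_left _ _)) hf
  have publish : Realizes (fun p : Red × Val => redSend corr p.1 P (.publish (.ofVal p.2))) w := by
    refine readTx (fun t s => redSend corr s P (.publish t)) ?_
    exact Realizes.iteP (IsExpr.decide_const.decide_and
      ((hβ.stage.stage_eq .created).decide_and eqTx))
      (Realizes.bind' (Realizes.call _ _) (Realizes.ret (.pair (isExpr_txNote corr x1' x2').2.1
        (.red hβ'.mu hβ'.table (.const .published) hβ'.d1 hβ'.d2 hβ'.pa hβ'.pb hβ'.shared hβ'.apre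
          hβ'.pubA hβ'.pubB)) _)) (skip hβ _)
  have init : Realizes (fun p : Red × Val => redSend corr p.1 P (.init (.ofVal p.2))) w := by
    refine readTx (fun t s => redSend corr s P (.init t)) ?_
    have hpub : IsExpr fun p : β => decide (p.1.1.1.stage.hasPub = true) :=
      ((hβ.stage.stage_eq .published).or (hβ.stage.stage_eq .initiated)).congr fun p => by
        cases p.1.1.1.stage <;> rfl
    exact Realizes.iteP (IsExpr.decide_const.decide_and (hpub.decide_and eqTx))
      (Realizes.bind' (Realizes.call _ _) (Realizes.ret (.pair (isExpr_txNote corr x1' x2').2.2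
        (.red hβ'.mu hβ'.table (.const .initiated) hβ'.d1 hβ'.d2 hβ'.pa hβ'.pb hβ'.shared hβ'.apre
          hβ'.pubA hβ'.pubB)) _)) (skip hβ _)
  have redeem : Realizes (fun p : Red × Val => redSend corr p.1 P
      (.redeem (.ofVal p.2.fst) p.2.snd.fst.optBits p.2.snd.snd.fst.optBits
        (.ofVal p.2.snd.snd.snd))) w := by
    refine Realizes.rpath (f := fun path p => redSend corr p.1 P
      (.redeem (.ofVal p.2.fst) p.2.snd.fst.optBits p.2.snd.snd.fst.optBits path))
      v0.valSnd.valSnd.valSnd fun path => ?_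
    refine Realizes.bits (F := fun p d1 => redRedeem corr p.1 P ⟨d1, p.2.fst.snd.bits⟩
      p.2.snd.fst.optBits p.2.snd.snd.fst.optBits path) v0.valFst.valFst
      (fun p => ((Val.size_fst_le _).trans (Val.size_fst_le _)).trans (Nat.le_add_left _ _)) ?_
    have v1 : IsExpr fun p : (Red × Val) × Bits => p.1.2 := IsExpr.id.fst.snd
    refine Realizes.bits (F := fun p d2 => redRedeem corr p.1.1 P ⟨p.2, d2⟩
      p.1.2.snd.fst.optBits p.1.2.snd.snd.fst.optBits path) v1.valFst.valSnd
      (fun p => ((Val.size_snd_le _).trans (Val.size_fst_le _)).trans (Nat.le_add_left _ _)) ?_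
    have v2 : IsExpr fun p : β => p.1.1.2 := IsExpr.id.fst.fst.snd
    refine Realizes.optBits (F := fun (p : β) y => redRedeem corr p.1.1.1 P ⟨p.1.2, p.2⟩
      y p.1.1.2.snd.snd.fst.optBits path) v2.valSnd.valFst
      (fun p => ((Val.size_fst_le _).trans (Val.size_snd_le _)).trans (Nat.le_add_left _ _)) ?_
    have v3 : IsExpr fun p : β × Option Bits => p.1.1.1.2 := IsExpr.id.fst.fst.fst.snd
    refine Realizes.optBits (F := fun (p : β × Option Bits) y => redRedeem corr p.1.1.1.1 P
      ⟨p.1.1.2, p.1.2⟩ p.2 y path) v3.valSnd.valSnd.valFst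
      (fun p => (((Val.size_fst_le _).trans (Val.size_snd_le _)).trans (Val.size_snd_le _)).trans
        (Nat.le_add_left _ _)) ?_
    have v4 : IsExpr fun p : (β × Option Bits) × Option Bits =>
        (p.1.1.1.1.1, (p.1.1.1.2, p.1.1.2), p.1.2, p.2) :=
      IsExpr.id.fst.fst.fst.fst.fst.pair ((IsExpr.id.fst.fst.fst.snd.pair
        IsExpr.id.fst.fst.snd).pair (IsExpr.id.fst.snd.pair IsExpr.id.snd))
    exact (realizes_redRedeem corr P path).comp v4 1 fun p => by dsimp only [w]; omega
  have hw : ∀ p : Red × Val, w (p.1, p.2.snd) ≤ 1 * (w p + 1) := fun p => by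
    have := p.2.size_snd_le
    dsimp only [w]; omega
  have sub : ∀ {F : Red × Val → Prog (Val × Red)}, Realizes F w →
      Realizes (fun p => F (p.1, p.2.snd)) w :=
    fun hF => hF.comp (g := fun p : Red × Val => (p.1, p.2.snd)) (.pair h0 v0.valSnd) 1 hw
  convert Realizes.iteP (v0.valFst.len_le 0) (sub setupB)
    (Realizes.iteP (v0.valFst.len_le 1) setupA
    (Realizes.iteP (v0.valFst.len_le 2) (sub publish)
    (Realizes.iteP (v0.valFst.len_le 3) (sub init) (sub redeem)))) using 2 with p
  rw [GReq.ofVal]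
  rcases p.2.fst.len with _ | _ | _ | _ | n <;> simp

theorem realizes_redCall : Realizes (fun p : Red × Val => redCall corr p.1 p.2)
    fun p => p.1.mu + p.1.table.length + p.2.size := by
  let w : Red × Val → ℕ := fun p => p.1.mu + p.1.table.length + p.2.size
  have v0 : IsExpr fun p : Red × Val => p.2 := IsExpr.id.snd
  have h0 : IsExpr fun p : Red × Val => p.1 := IsExpr.id.fst
  have h1 : IsExpr fun p : (Red × Val) × Bits => (p.1.1, p.2) := IsExpr.id.fst.fst.pair IsExpr.id.snd
  have skip : Realizes (fun p : Red × Val => Prog.ret (Val.nil, p.1)) w :=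
    Realizes.ret (.pair (.const Val.nil) h0) _
  have hash : Realizes (fun p : Red × Val => redHash p.1 p.2.snd.bits) w :=
    Realizes.bits (F := fun p x => redHash p.1 x) v0.valSnd
      (fun p => (Val.size_snd_le _).trans (Nat.le_add_left _ _))
      (realizes_redHash.comp h1 1 fun p => by dsimp only [w]; omega)
  have share : Realizes (fun p : Red × Val => redShare p.1 p.2.snd.bits) w :=
    Realizes.bits (F := fun p x => redShare p.1 x) v0.valSnd
      (fun p => (Val.size_snd_le _).trans (Nat.le_add_left _ _))
      (realizes_redShare.comp h1 1 fun p => by dsimp only [w]; omega)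
  have send : Realizes (fun p : Red × Val => if .ofVal p.2.snd.fst ∈ corr then
      redSend corr p.1 (.ofVal p.2.snd.fst) (.ofVal p.2.snd.snd) else .ret (.nil, p.1)) w := by
    refine Realizes.party (f := fun P p => if P ∈ corr then
      redSend corr p.1 P (.ofVal p.2.snd.snd) else .ret (.nil, p.1)) v0.valSnd.valFst fun P => ?_
    refine Realizes.iteP IsExpr.decide_const ?_ skip
    refine (realizes_redSend corr P).comp (g := fun p : Red × Val => (p.1, p.2.snd.snd))
      (.pair h0 v0.valSnd.valSnd) 1 fun p => ?_
    have := (Val.size_snd_le p.2.snd).trans (Val.size_snd_le _)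
    dsimp only [w]; omega
  convert Realizes.iteP (v0.valFst.len_le 0) hash (Realizes.iteP (v0.valFst.len_le 1) send
    (Realizes.iteP (IsExpr.decide_const (p := Party.B ∈ corr ∧ Party.A ∉ corr)) share skip))
    using 2 with p
  rw [redCall, AdvReq.ofVal]
  rcases p.2.fst.len with _ | _ | n <;> simp

theorem realizes_redSetupB : Realizes (redSetupB corr) fun s => s.mu + s.table.length := by
  let α4 : Type := (((Red × Bits) × Bits) × Bits × Table) × Bits × Table
  have h4 : IsExpr fun p : α4 => p.1.1.1.1 := IsExpr.id.fst.fst.fst.fst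
  have draw : ∀ {α' : Type} [Enc α'] {g : α' → Red}, IsExpr g →
      Realizes (fun a => drawP (g a).mu) fun a => (g a).mu + (g a).table.length :=
    fun {α' _ g} hg => realizes_drawP.comp (g := fun a => (g a).mu) hg.mu 1 fun p => by omega
  have hash1 : Realizes (fun p : (Red × Bits) × Bits => hashP p.1.1.mu p.1.1.table p.1.2)
      fun p => p.1.1.mu + p.1.1.table.length :=
    realizes_hashP.comp (g := fun p : (Red × Bits) × Bits => (p.1.1.mu, p.1.1.table, p.1.2))
      (.pair IsExpr.id.fst.fst.mu (.pair IsExpr.id.fst.fst.table IsExpr.id.fst.snd)) 1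
      fun p => by dsimp only; omega
  have hash2 : Realizes (fun p : ((Red × Bits) × Bits) × Bits × Table =>
      hashP p.1.1.1.mu p.2.2 p.1.2) fun p => p.1.1.1.mu + p.2.2.length :=
    realizes_hashP.comp (g := fun p : ((Red × Bits) × Bits) × Bits × Table =>
      (p.1.1.1.mu, p.2.2, p.1.2)) (.pair IsExpr.id.fst.fst.fst.mu (.pair IsExpr.id.snd.snd
        IsExpr.id.fst.snd)) 1 fun p => by dsimp only; omega
  have hfin : Realizes (fun p : α4 => Prog.ret (setupBNote corr p.1.2.1 p.2.1,
      { p.1.1.1.1 with table := p.2.2, stage := .digests, d1 := p.1.2.1, d2 := p.2.1, pa := p.1.1.1.2,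
                       pb := p.1.1.2 }))
      fun p => p.1.1.1.1.mu + p.1.2.2.length :=
    Realizes.ret (.pair (isExpr_setupBNote corr IsExpr.id.fst.snd.fst IsExpr.id.snd.fst)
      (.red h4.mu IsExpr.id.snd.snd (.const .digests) IsExpr.id.fst.snd.fst IsExpr.id.snd.fst
        IsExpr.id.fst.fst.fst.snd IsExpr.id.fst.fst.snd h4.shared h4.apre h4.pubA h4.pubB)) _
  exact Realizes.bind' (draw IsExpr.id) (Realizes.bind' (draw IsExpr.id.fst) (Realizes.bind hash1
    (Realizes.bind' hash2 hfin) 1 fun p => (hashP_results _ _ _).mono fun r hr => by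
      have := hr.2.length
      dsimp only; omega))

theorem realizes_redHonestRedeem (path : RPath) (P : Party) (w : Red → ℕ) :
    Realizes (fun s => Prog.ret (redHonestRedeem corr s path P)) w := by
  have h : IsExpr fun s : Red => s := IsExpr.id
  have h1 : IsExpr fun s : Red => if path.usesA then s.preA P else none := by
    cases path <;> first | exact h.preA P | exact .const none
  have h2 : IsExpr fun s : Red => if path.usesB then s.preB P else none := by
    cases path <;> first | exact h.preB P | exact .const none
  exact Realizes.ret ((isExpr_redeemNote corr path P h1 h2 h.d1 h.d2 (h.pubA.or h1.isSome)
    (h.pubB.or h2.isSome)).pair (h.redeem corr P path h1.isSome h2.isSome)) _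

theorem realizes_redInput : Realizes (fun p : Red × Val => redInput corr p.1 p.2)
    fun p => p.1.mu + p.1.table.length := by
  let w : Red × Val → ℕ := fun p => p.1.mu + p.1.table.length
  have v0 : IsExpr fun p : Red × Val => p.2 := IsExpr.id.snd
  have h0 : IsExpr fun p : Red × Val => p.1 := IsExpr.id.fst
  have hw : ∀ p : Red × Val, p.1.mu + p.1.table.length ≤ 1 * (w p + 1) := fun p => by
    dsimp only [w]; omega
  have stage : ∀ st : Stage, IsExpr fun p : Red × Val => ({ p.1 with stage := st } : Red) :=
    fun st => .red h0.mu h0.table (.const st) h0.d1 h0.d2 h0.pa h0.pb h0.shared h0.apre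
      h0.pubA h0.pubB
  have hn := isExpr_txNote corr h0.d1 h0.d2
  have share : Realizes (fun p : Red × Val => redLeak corr p.1 .share) w := by
    by_cases hA : Party.A ∈ corr <;> simp only [redLeak, hA, if_true, if_false, notesVal,
      List.map, Val.ofList, Note.toVal, Val.tag]
    · exact Realizes.ret (.pair (.node (.node (.const _) h0.pa.ofBits) (.const _)) (.red h0.mu
        h0.table h0.stage h0.d1 h0.d2 h0.pa h0.pb (.const true) h0.apre h0.pubA h0.pubB)) _
    · exact Realizes.ret (.pair (.const _) (.red h0.mu
        h0.table h0.stage h0.d1 h0.d2 h0.pa h0.pb (.const true) h0.pa.optSome h0.pubA h0.pubB)) _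
  have redeem : Realizes (fun p : Red × Val => redLeak corr p.1
      (.redeem (.ofVal p.2.snd.fst) (.ofVal p.2.snd.snd))) w :=
    Realizes.rpath (f := fun path p => redLeak corr p.1 (.redeem path (.ofVal p.2.snd.snd)))
      v0.valSnd.valFst fun path => Realizes.party (f := fun P p =>
        redLeak corr p.1 (.redeem path P)) v0.valSnd.valSnd fun P =>
        (realizes_redHonestRedeem corr path P fun s => s.mu + s.table.length).comp h0 1 hw
  have leak : Realizes (fun p : Red × Val => redLeak corr p.1 (.ofVal p.2)) w := by
    convert Realizes.iteP (v0.valFst.len_le 0) ((realizes_redSetupB corr).comp h0 1 hw)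
      (Realizes.iteP (v0.valFst.len_le 1) (Realizes.ret (hn.1.pair (stage .created)) w)
      (Realizes.iteP (v0.valFst.len_le 2) share
      (Realizes.iteP (v0.valFst.len_le 3) (Realizes.ret (hn.2.1.pair (stage .published)) w)
      (Realizes.iteP (v0.valFst.len_le 4) (Realizes.ret (hn.2.2.pair (stage .initiated)) w)
      redeem)))) using 2 with p
    rw [FLeak.ofVal]
    rcases p.2.fst.len with _ | _ | _ | _ | _ | n <;> simp [redLeak]
    rw [if_neg (by omega), if_neg (by omega)]
  exact Realizes.iteP (v0.beq Function.injective_id (.const Val.nil))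
    (Realizes.ret (.pair (.const _) h0) _)
    (Realizes.iteP (v0.valFst.valFst.beq Function.injective_id (.const Val.nil))
      (leak.comp (g := fun p : Red × Val => (p.1, p.2.fst.snd)) (.pair h0 v0.valFst.valSnd) 1 hw)
      (Realizes.ret (.pair (.node (.node (.const _) v0.valFst.valSnd) (.const _)) h0) _))

end
end MadHtlc

namespace MadHtlc
open scoped ENNReal
open Prog
open Enc (enc)

/-! ## The simulator -/

/-- The expression with all variables shifted. -/
def Expr.shift : Expr → Expr
  | var n => var (n + 4)
  | nil => nil
  | cons e f => cons e.shift f.shift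
  | hd e => hd e.shift
  | tl e => tl e.shift
  | eq e f => eq e.shift f.shift

theorem Expr.eval_shift {s s' : Store} (h : ∀ n, s' (n + 4) = s n) (e : Expr) :
    e.shift.eval s' = e.eval s := by
  induction e <;> simp_all [shift, eval]

/-- The adversary, with its messages answered by the command `d`. -/
def Cmd.shift (d : Cmd) : Cmd → Cmd
  | assign x e => assign (x + 4) e.shift
  | seq c c' => seq (shift d c) (shift d c')
  | ite e c c' => ite e.shift (shift d c) (shift d c')
  | loop e c => loop e.shift (shift d c)
  | coin x => coin (x + 4)
  | call x e =>
      seq (assign 2 (.cons (.cons (.hd (.var 2)) e.shift) .nil))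
        (seq d (seq (assign (x + 4) (.hd (.hd (.var 2)))) (assign 2 (.cons (.tl (.hd (.var 2))) .nil))))

/-- The simulator's store `s'` represents the adversary's store `s` and the state `σ`. -/
structure Represents (s : Store) (σ : Red) (s' : Store) : Prop where
  var : ∀ n, s' (n + 4) = s n
  state : s' 2 = .node (enc σ) .nil

theorem Represents.update {s s' : Store} {σ : Red} (h : Represents s σ s') (x : ℕ) (v : Val) :
    Represents (Function.update s x v) σ (Function.update s' (x + 4) v) where
  var n := by
    by_cases hn : n = x
    · simp [hn]
    · simp [hn, h.var]
  state := by simp [h.state]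

/-- The relation between the final states of an activation of the adversary and its translation. -/
structure Tracks (B t t' : ℕ) (σ : Red) (r : (Store × ℕ) × Red) (r' : Store × ℕ) : Prop where
  rep : Represents r.1.1 r.2 r'.1
  time : t' + B * r.1.2 ≤ r'.2 + B * t
  mu : r.2.mu = σ.mu
  table : r.2.table.length + 2 * r.1.2 ≤ σ.table.length + 2 * t

theorem Tracks.trans {B t t' : ℕ} {σ : Red} {r : (Store × ℕ) × Red} {r' : Store × ℕ}
    (h : Tracks B t t' σ r r') {q : (Store × ℕ) × Red} {q' : Store × ℕ}
    (h' : Tracks B r.1.2 r'.2 r.2 q q') : Tracks B t t' σ q q' :=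
  ⟨h'.rep, by have := h.time; have := h'.time; omega, h'.mu.trans h.mu,
    h'.table.trans h.table⟩

section
variable (corr : Finset Party) {d : Cmd} {C : ℕ}

/-- The messages are answered by `d`. -/
def Answers (d : Cmd) (C : ℕ) : Prop :=
  ∀ (a : Red × Val) (rest : Val) (s : Store) (t : ℕ),
    s 2 = .node (enc a) rest → C * (a.1.mu + a.1.table.length + a.2.size + 1) ≤ t →
    Refines (fun (b : Val × Red) (r : Store × ℕ) => r.1 2 = .node (enc b) rest ∧
      t ≤ r.2 + C * (a.1.mu + a.1.table.length + a.2.size + 1) ∧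
      ∀ n, n ≠ 2 → n ≠ 3 → r.1 n = s n) (redCall corr a.1 a.2).total (d.run s t)

theorem whileLoop_tracks {L B : ℕ} (hB : 1 ≤ B) {test test' : Store → Bool}
    {body body' : Store → ℕ → Prog (Option (Store × ℕ))} {μ : ℕ}
    (ht : ∀ s σ s', Represents s σ s' → test' s' = test s)
    (hb : ∀ (s : Store) (σ : Red) (s' : Store) (t t' : ℕ), Represents s σ s' → σ.mu = μ →
      σ.table.length + 2 * t ≤ L → B * t ≤ t' →
      Refines (Tracks B t t' σ) ((body s t).simulate (fun s v => (redCall corr s v).total) σ)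
        (body' s' t'))
    (n m : ℕ) (hnm : n ≤ m) (s : Store) (σ : Red) (s' : Store) (t t' : ℕ) (hs : Represents s σ s')
    (hμ : σ.mu = μ) (hL : σ.table.length + 2 * t ≤ L) (hBt : B * t ≤ t') :
    Refines (Tracks B t t' σ)
      ((whileLoop test body n s t).simulate (fun s v => (redCall corr s v).total) σ)
      (whileLoop test' body' m s' t') := by
  induction n generalizing m s σ s' t t' with
  | zero => trivial
  | succ n ih =>
    obtain ⟨m, rfl⟩ : ∃ m', m = m' + 1 := ⟨m - 1, by omega⟩
    cases t with
    | zero => trivial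
    | succ t =>
      have e1 : B * (t + 1) = B * t + B := by ring
      obtain ⟨t', rfl⟩ : ∃ u, t' = u + 1 := ⟨t' - 1, by omega⟩
      rw [whileLoop, whileLoop, ht s σ s' hs]
      split
      · rw [simulate_bindO]
        refine (hb s σ s' t t' hs hμ (by omega) (by omega)).bindO fun r r' hr => ?_
        have h1 := hr.time
        have h2 := hr.table
        refine (ih m (by omega) r.1.1 r.2 r'.1 r.1.2 r'.2 hr.rep (hr.mu.trans hμ) (by omega)
          (by omega)).mono fun q q' hq => ?_
        have h3 := hq.time
        have h4 := hq.table
        exact ⟨hq.rep, by omega, hq.mu.trans hr.mu, by omega⟩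
      · exact ⟨_, rfl, hs, by simp only; omega, rfl, by simp only; omega⟩

variable {corr} in
theorem Cmd.run_shift_tracks (hd : Answers corr d C) {μ L : ℕ} (c : Cmd) (s : Store)
    (σ : Red) (s' : Store) (t t' : ℕ) (hs : Represents s σ s') (hμ : σ.mu = μ)
    (hL : σ.table.length + 2 * t ≤ L) (hBt : (C * (μ + L + 1) + 3) * t ≤ t') :
    Refines (Tracks (C * (μ + L + 1) + 3) t t' σ)
      ((c.run s t).simulate (fun s v => (redCall corr s v).total) σ) ((Cmd.shift d c).run s' t') := by
  -- `B` is the price of one unit of the adversary's time. A message of size `n` costs the adversary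
  -- `n + 1`, its translation at most `C * (μ + L + n + 1)` for the command `d` and `3` for the
  -- assignments around it. The bound `L` on the table persists, because each message adds at most
  -- two entries and uses up at least one unit.
  set B := C * (μ + L + 1) + 3 with hBdef
  induction c generalizing s σ s' t t' with
  | assign x e =>
    cases t with
    | zero => trivial
    | succ t =>
      have e1 : B * (t + 1) = B * t + B := by ring
      obtain ⟨t', rfl⟩ : ∃ u, t' = u + 1 := ⟨t' - 1, by omega⟩
      refine ⟨_, rfl, ?_, by simp only; omega, rfl, by simp only; omega⟩
      rw [Expr.eval_shift hs.var]
      exact hs.update _ _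
  | seq c c' ih ih' =>
    rw [Cmd.run, simulate_bindO]
    refine (ih s σ s' t t' hs hμ hL hBt).bindO fun r r' hr => ?_
    have h1 := hr.time
    have h2 := hr.table
    exact (ih' r.1.1 r.2 r'.1 r.1.2 r'.2 hr.rep (hr.mu.trans hμ) (by omega) (by omega)).mono
      fun q q' hq => hr.trans hq
  | ite e c c' ih ih' =>
    cases t with
    | zero => trivial
    | succ t =>
      have e1 : B * (t + 1) = B * t + B := by ring
      obtain ⟨t', rfl⟩ : ∃ u, t' = u + 1 := ⟨t' - 1, by omega⟩
      rw [Cmd.run, Cmd.shift, Cmd.run, Expr.eval_shift hs.var]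
      split
      · refine (ih s σ s' t t' hs hμ (by omega) (by omega)).mono fun q q' hq => ?_
        exact ⟨hq.rep, by have := hq.time; omega, hq.mu, by have := hq.table; omega⟩
      · refine (ih' s σ s' t t' hs hμ (by omega) (by omega)).mono fun q q' hq => ?_
        exact ⟨hq.rep, by have := hq.time; omega, hq.mu, by have := hq.table; omega⟩
  | loop e c ih =>
    have : t ≤ B * t := Nat.le_mul_of_pos_left _ (by omega)
    exact whileLoop_tracks corr (by omega)
      (fun s σ s' h => by rw [Expr.eval_shift h.var]) ih _ _ (by omega) s σ s' t t' hs hμ hL hBt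
  | coin x =>
    cases t with
    | zero => trivial
    | succ t =>
      have e1 : B * (t + 1) = B * t + B := by ring
      obtain ⟨t', rfl⟩ : ∃ u, t' = u + 1 := ⟨t' - 1, by omega⟩
      exact ⟨_, rfl, fun b => ⟨_, rfl, hs.update _ _, by simp only; omega, rfl, by simp only; omega⟩⟩
  | call x e =>
    rw [Cmd.run]
    split
    next hle =>
      generalize hv : e.eval s = v at hle ⊢
      obtain ⟨u, rfl⟩ := Nat.exists_eq_add_of_le hle
      have e1 : B * (v.size + 1 + u) = B * u + B * (v.size + 1) := by ring
      have e2 : C * (μ + σ.table.length + v.size + 1) + 3 ≤ B * (v.size + 1) := by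
        have : C * (μ + σ.table.length + v.size + 1) ≤ C * ((μ + L + 1) * (v.size + 1)) := by
          refine Nat.mul_le_mul_left C ?_
          nlinarith [Nat.zero_le ((μ + L) * v.size)]
        have h2 : B * (v.size + 1) = C * ((μ + L + 1) * (v.size + 1)) + 3 * (v.size + 1) := by
          rw [hBdef]; ring
        omega
      obtain ⟨t', rfl⟩ : ∃ u, t' = u + 1 := ⟨t' - 1, by omega⟩
      rw [Cmd.shift, Cmd.run, Cmd.run, ret_some_bindO, Cmd.run, simulate]
      have hq := hd (σ, v) .nil (Function.update s' 2
        ((Expr.cons (.cons (.hd (.var 2)) e.shift) .nil).eval s')) t'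
        (by simp [Expr.eval, hs.state, Val.fst, Expr.eval_shift hs.var, hv])
        (by dsimp only; rw [hμ]; omega)
      refine (hq.of_total (redCall_length σ v)).bindO ?_
      rintro ⟨w, σ'⟩ ⟨s1, t1⟩ ⟨⟨f1, f2, f3⟩, g1, g2⟩
      dsimp only at f1 f2 f3 g1 g2 ⊢
      rw [hμ] at f2
      obtain ⟨t1, rfl⟩ : ∃ u, t1 = u + 2 := ⟨t1 - 2, by omega⟩
      refine ⟨_, rfl, ⟨fun n => ?_, ?_⟩, ?_, g1, ?_⟩
      · by_cases hn : n = x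
        · simp [hn, Expr.eval, f1, Val.fst]
        · have := f3 (n + 4) (by omega) (by omega)
          simp [hn, this, hs.var]
      · simp [Expr.eval, f1, Val.fst, Val.snd]
      · simp only [Nat.add_sub_cancel_left]; omega
      · simp only [Nat.add_sub_cancel_left]; omega
    · trivial

theorem Prog.bindO_ret {α : Type} (p : Prog (Option α)) : (p.bindO fun a => .ret (some a)) = p := by
  induction p with
  | ret o => cases o <;> rfl
  | coin k ih => simp [ih]
  | call v k ih => simp [ih]

/-- What the adversary does in an activation in which the simulator gets the given notes. -/
def simActivation (adv : Cmd) (t : ℕ) (s : Store) (σ : Red) (m : Option Val) (notes : Val) :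
    Prog (Option ((Store × ℕ) × Red)) :=
  (redInput corr σ notes).total.bindO fun r =>
    (adv.run (Function.update s 0 (activationVal m r.1)) t).simulate
      (fun s v => (redCall corr s v).total) r.2

/-- The notes are translated by `d`. -/
def Translates (d : Cmd) (C : ℕ) : Prop :=
  ∀ (a : Red × Val) (rest : Val) (s : Store) (t : ℕ),
    s 2 = .node (enc a) rest → C * (a.1.mu + a.1.table.length + 1) ≤ t →
    Refines (fun (b : Val × Red) (r : Store × ℕ) => r.1 2 = .node (enc b) rest ∧
      t ≤ r.2 + C * (a.1.mu + a.1.table.length + 1) ∧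
      ∀ n, n ≠ 2 → n ≠ 3 → r.1 n = s n) (redInput corr a.1 a.2).total (d.run s t)

/-- The simulator. -/
def simCmd (d d' adv : Cmd) : Cmd :=
  .seq (.ite (.var 2) (.assign 3 .nil) (.seq
    (.assign 2 (.cons (.cons (.var 1) (.const (enc (Red.start 0)).snd)) .nil))
    (.assign 5 (.var 1)))) <|
  .seq (.assign 2 (.cons (.cons (.hd (.var 2)) (.tl (.var 0))) .nil)) <|
  .seq d' <|
  .seq (.assign 4 (.cons (.hd (.var 0)) (.hd (.hd (.var 2))))) <|
  .seq (.assign 2 (.cons (.tl (.hd (.var 2))) .nil)) <|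
  .seq (Cmd.shift d adv) (.assign 0 (.var 4))

/-- The simulator's store represents the adversary's store and the state, or nothing has
happened yet. -/
def Ready (s : Store) (σ : Red) (s' : Store) : Prop :=
  Represents s σ s' ∨
    ∃ μ, s = initStore μ .nil ∧ σ = Red.start μ ∧ s' = initStore μ .nil

theorem represents_init (μ : ℕ) : Represents (initStore μ .nil) (Red.start μ)
    (Function.update (Function.update (initStore μ .nil) 2 (.node (enc (Red.start μ)) .nil)) 5
      (.ofNat μ)) where
  var n := by
    rcases n with _ | _ | n <;> simp [initStore]
  state := by simp

/-- The relation between the final states of an activation. -/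
structure Simulates (μ t t' k l : ℕ) (r : (Store × ℕ) × Red) (r' : Store × ℕ) : Prop where
  rep : Represents r.1.1 r.2 r'.1
  out : r'.1 0 = r.1.1 0
  time : t' ≤ r'.2 + k
  mu : r.2.mu = μ
  table : r.2.table.length ≤ l + 2 + 2 * t

-- The empty variable `2` reveals the first activation, in which the initial reduced state is built
-- from the security parameter and the parameter is copied to variable `5`, the adversary's variable
-- `1`. Then the notes are translated, the adversary is activated on its shifted variables, and its
-- answer is copied back. Seven elementary steps surround the two commands, whence the `8`.
variable {corr} in
theorem simCmd_refines (hd : Answers corr d C) {d' : Cmd} {C' : ℕ} (hd' : Translates corr d' C')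
    (adv : Cmd) {μ L : ℕ} {s : Store} {σ : Red} {s' : Store} (hs : Ready s σ s') (hμ : σ.mu = μ)
    (m : Option Val) (notes : Val) (t t' : ℕ) (hL : σ.table.length + 2 + 2 * t ≤ L)
    (ht : (C * (μ + L + 1) + 3) * t + (C' + 8) * (μ + L + 1) ≤ t') :
    Refines (Simulates μ t t' ((C * (μ + L + 1) + 3) * t + (C' + 8) * (μ + L + 1))
        σ.table.length) (simActivation corr adv t s σ m notes)
      ((simCmd d d' adv).run (Function.update s' 0 (activationVal m notes)) t') := by
  set B := C * (μ + L + 1) + 3 with hB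
  have e1 : (C' + 8) * (μ + L + 1) = C' * (μ + L + 1) + 8 * (μ + L + 1) := by ring
  have e2 : C' * (μ + σ.table.length + 1) ≤ C' * (μ + L + 1) := by gcongr; omega
  have hinit : ∃ (s1 : Store) (t1 : ℕ), (Cmd.ite (.var 2) (.assign 3 .nil) (.seq
      (.assign 2 (.cons (.cons (.var 1) (.const (enc (Red.start 0)).snd)) .nil))
      (.assign 5 (.var 1)))).run (Function.update s' 0 (activationVal m notes)) t'
        = .ret (some (s1, t1)) ∧ t' ≤ t1 + 3 ∧ Represents s σ s1 ∧
          s1 0 = activationVal m notes := by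
    obtain ⟨t', rfl⟩ : ∃ u, t' = u + 3 := ⟨t' - 3, by omega⟩
    rcases hs with hs | ⟨μ', rfl, rfl, rfl⟩
    · refine ⟨Function.update (Function.update s' 0 (activationVal m notes)) 3 .nil, t' + 1, ?_,
        by omega, ⟨fun n => ?_, ?_⟩, ?_⟩
      · simp [Cmd.run, Expr.eval, hs.state, Val.toBool]
      · simpa using hs.var n
      · simpa using hs.state
      · simp
    · refine ⟨Function.update (Function.update (Function.update (initStore μ' .nil) 0
        (activationVal m notes)) 2 (.node (enc (Red.start μ')) .nil)) 5 (.ofNat μ'), t', ?_,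
        by omega, ⟨fun n => ?_, ?_⟩, ?_⟩
      · simp [Cmd.run, Expr.eval, initStore, Val.toBool]
        rfl
      · have := (represents_init μ').var n
        rcases n with _ | _ | n <;> simpa using this
      · simp
      · simp
  obtain ⟨s1, t1, hrun, ht1, hrep, hs10⟩ := hinit
  rw [simCmd, Cmd.run, hrun, ret_some_bindO, simActivation]
  dsimp only
  obtain ⟨t1, rfl⟩ : ∃ u, t1 = u + 1 := ⟨t1 - 1, by omega⟩
  rw [Cmd.run, Cmd.run, ret_some_bindO, Cmd.run]
  refine ((hd' (σ, notes) .nil _ t1 ?_ ?_).of_total (redInput_length σ notes)).bindO ?_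
  · simp [Expr.eval, hrep.state, hs10, Val.fst, Val.snd, activationVal]
  · dsimp only; rw [hμ]; omega
  rintro ⟨v, σ'⟩ ⟨s2, t2⟩ ⟨⟨f1, f2, f3⟩, g1, g2⟩
  dsimp only at f1 f2 f3 g1 g2 ⊢
  rw [hμ] at f2 g1
  obtain ⟨t2, rfl⟩ : ∃ u, t2 = u + 2 := ⟨t2 - 2, by omega⟩
  rw [Cmd.run, Cmd.run, ret_some_bindO, Cmd.run, Cmd.run, ret_some_bindO, Cmd.run]
  dsimp only
  have h0 : s2 0 = activationVal m notes := by
    rw [f3 0 (by omega) (by omega)]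
    simpa using hs10
  have hrep2 : Represents (Function.update s 0 (activationVal m v)) σ'
      (Function.update (Function.update s2 4 ((Expr.cons (.hd (.var 0)) (.hd (.hd (.var 2)))).eval
        s2)) 2 ((Expr.cons (.tl (.hd (.var 2))) .nil).eval (Function.update s2 4
          ((Expr.cons (.hd (.var 0)) (.hd (.hd (.var 2)))).eval s2)))) := by
    refine ⟨fun n => ?_, ?_⟩
    · rcases n with _ | n
      · simp [Expr.eval, h0, f1, Val.fst, activationVal]
      · have := f3 (n + 1 + 4) (by omega) (by omega)
        simp at this
        simp [this, hrep.var]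
    · simp [Expr.eval, f1, Val.fst, Val.snd]
  have hadv := Cmd.run_shift_tracks hd (L := L) adv _ σ' _ t t2 hrep2 g1 (by omega)
    (by rw [← hB]; omega)
  rw [← bindO_ret (simulate _ _ _)]
  refine hadv.bindO fun r r' hr => ?_
  have h1 := hr.time
  rw [← hB] at h1
  have h2 := hr.table
  obtain ⟨s3, t3⟩ := r'
  dsimp only at h1
  obtain ⟨t3, rfl⟩ : ∃ u, t3 = u + 1 := ⟨t3 - 1, by omega⟩
  refine ⟨_, rfl, ⟨fun n => ?_, ?_⟩, ?_, ?_, ?_, ?_⟩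
  · simpa using hr.rep.var n
  · simpa using hr.rep.state
  · simpa [Expr.eval] using hr.rep.var 0
  · simp only; omega
  · exact hr.mu.trans g1
  · omega

end
end MadHtlc

namespace MadHtlc
open scoped ENNReal
open Prog
open Enc (enc)

/-! ### Running time of the simulator -/

section
variable {corr : Finset Party} {d d' : Cmd} {C C' : ℕ} {adv : Cmd}

theorem exists_answers (corr : Finset Party) : ∃ d C, Answers corr d C := by
  obtain ⟨d, C, h⟩ := realizes_redCall corr
  exact ⟨d, C, h⟩

theorem exists_translates (corr : Finset Party) : ∃ d C, Translates corr d C := by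
  obtain ⟨d, C, h⟩ := realizes_redInput corr
  exact ⟨d, C, h⟩

theorem simActivation_results {T n : ℕ} {s : Store} (hl : adv.Live T n s) (σ : Red)
    (m : Option Val) (notes : Val) (hm : envLength (m, notes) ≤ n) {t : ℕ} (ht : T ≤ t) :
    (simActivation corr adv t s σ m notes).AllResults
      fun o => ∃ r, o = some r ∧ adv.Live T (n - envLength (m, notes)) r.1.1 := by
  rw [simActivation, total_bindO, allResults_bind]
  refine allResults_of_forall _ fun r => ?_
  exact AllResults.simulate (P := fun r : Store × ℕ => adv.Live T (n - envLength (m, notes)) r.1)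
    (hl.run_of_le (m, r.1) hm ht) r.2

/-- The time that the simulator needs in an activation in which the adversary takes time `t`. -/
def simCost (C C' μ L t : ℕ) : ℕ := (C * (μ + L + 1) + 3) * t + (C' + 8) * (μ + L + 1)

/-- Each activation is charged as if the adversary used its whole time `T` anew. The table then
grows by at most `2` for the translated notes and `2 * T` for the messages, so one bound `L` serves
all activations. -/
theorem simCmd_runAll (hd : Answers corr d C) (hd' : Translates corr d' C') {μ L T : ℕ}
    (acts : List (Option Val × Val)) {n : ℕ} {s : Store} {σ : Red} {s' : Store}
    (hs : Ready s σ s') (hμ : σ.mu = μ) (hl : adv.Live T n s) (hn : (acts.map envLength).sum ≤ n)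
    (hL : σ.table.length + acts.length * (2 + 2 * T) ≤ L) {t' : ℕ}
    (ht : acts.length * simCost C C' μ L T ≤ t') :
    ((simCmd d d' adv).runAll acts s' t').AllResults fun o => o.isSome = true := by
  induction acts generalizing n s σ s' t' with
  | nil => rfl
  | cons a as ih =>
    simp only [List.map_cons, List.sum_cons, List.length_cons, add_mul, one_mul] at hn hL ht
    have href := simCmd_refines hd hd' adv hs hμ a.1 a.2 T t' (L := L) (by omega)
      (by rw [← simCost]; omega)
    have hres := href.allResults (simActivation_results hl σ a.1 a.2
      (show envLength (a.1, a.2) ≤ n by simp; omega) le_rfl)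
    rw [Cmd.runAll, allResults_bindO]
    refine hres.mono ?_
    rintro o ⟨b, r, rfl, hr, hlive⟩
    have h1 := hr.table
    have h2 := hr.time
    rw [← simCost] at h2
    exact ih (.inl hr.rep) hr.mu hlive (by simp; omega) (by omega) (by omega)

theorem simCmd_isPPT (hd : Answers corr d C) (hd' : Translates corr d' C') (hadv : adv.IsPPT) :
    (simCmd d d' adv).IsPPT := by
  obtain ⟨p, hp⟩ := hadv.exists_live
  -- At `X = μ + n` this is the factor `μ + L + 1` of `simCost`, with `μ` enlarged to `μ + n` and `L
  -- = (μ + n) * (2 + 2 * T)`. There are at most `n` activations, since each counts for at least one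
  -- in the length.
  let q : Polynomial ℕ := .X + .X * (2 + 2 * p) + 1
  refine ⟨.X * (((C : Polynomial ℕ) * q + 3) * p + ((C' + 8 : ℕ) : Polynomial ℕ) * q), fun μ acts => ?_⟩
  set n := (acts.map envLength).sum with hn
  have hlen : acts.length ≤ n := by
    rw [hn, ← List.length_map (f := envLength)]
    refine List.length_le_sum_of_one_le _ fun i hi => ?_
    obtain ⟨a, -, rfl⟩ := List.mem_map.1 hi
    rw [envLength]
    split <;> omega
  have e : (Polynomial.X * (((C : Polynomial ℕ) * q + 3) * p +
      ((C' + 8 : ℕ) : Polynomial ℕ) * q)).eval (μ + n)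
      = (μ + n) * simCost C C' (μ + n) ((μ + n) * (2 + 2 * p.eval (μ + n))) (p.eval (μ + n)) := by
    simp [q, simCost]
  rw [e]
  refine simCmd_runAll hd hd' (μ := μ) acts (L := (μ + n) * (2 + 2 * p.eval (μ + n)))
    (T := p.eval (μ + n)) (.inr ⟨μ, rfl, rfl, rfl⟩) rfl (hp μ n) le_rfl ?_ ?_
  · rw [Red.start, List.length_nil, zero_add]
    gcongr
    omega
  · have h1 : acts.length ≤ μ + n := by omega
    unfold simCost
    gcongr <;> omega

/-! ## The simulation is perfect -/

theorem Prog.Refines.simulate {ρ α β : Type} {R : β → α → Prop} {q : Prog (Option β)}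
    {p : Prog (Option α)} (h : Refines R q p) (f : ρ → Val → Prog (Option (Val × ρ))) (s : ρ) :
    Refines (fun b a => R b.1 a.1 ∧ a.2 = b.2) (q.simulate f s) (p.simulate f s) := by
  induction q generalizing p s with
  | ret o =>
    cases o with
    | none => trivial
    | some b =>
      obtain ⟨a, rfl, hab⟩ := h
      exact ⟨_, rfl, hab, rfl⟩
  | coin k ih =>
    obtain ⟨k', rfl, hk⟩ := h
    exact ⟨_, rfl, fun b => ih b (hk b) s⟩
  | call v k ih =>
    obtain ⟨k', rfl, hk⟩ := h
    have refl : ∀ p : Prog (Option (Val × ρ)), Refines Eq p p := by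
      intro p
      induction p with
      | ret o => cases o with
        | none => trivial
        | some b => exact ⟨_, rfl, rfl⟩
      | coin k ih => exact ⟨_, rfl, ih⟩
      | call v k ih => exact ⟨_, rfl, ih⟩
    exact (refl _).bindO fun b a hab => hab ▸ ih b.1 (hk _) b.2

theorem Prog.Refines.avg_eq {α β : Type} {R : β → α → Prop} {q : Prog (Option β)}
    {p : Prog (Option α)} (h : Refines R q p) (hq : q.AllResults fun o => o.isSome = true)
    {H : β → ℝ≥0∞} {H' : α → ℝ≥0∞} (hH : ∀ b a, R b a → H b = H' a) :
    q.avg (liftO H) = p.avg (liftO H') := by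
  induction q generalizing p with
  | ret o =>
    cases o with
    | none => simp [AllResults] at hq
    | some b =>
      obtain ⟨a, rfl, hab⟩ := h
      exact hH _ _ hab
  | coin k ih =>
    obtain ⟨k', rfl, hk⟩ := h
    simp only [avg_coin]
    rw [ih _ (hk _) (hq _), ih _ (hk _) (hq _)]
  | call v k ih =>
    obtain ⟨k', rfl, hk⟩ := h
    simp only [avg_call]
    exact ih _ (hk _) (hq _)

theorem expect_interp_simulate_redCall {α : Type} (p : Prog (Option α)) (s : Red)
    (H : (α × Red) → FState → ℝ≥0∞) :
    expect ((p.simulate (fun s v => (redCall corr s v).total) s).interp (idealWorld corr).call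
        (s.ideal corr)) (fun x => liftO (fun b => H b x.2) x.1)
      = (p.simulate (fun s v => (redCall corr s v).total) s).avg
          (liftO fun r => H r (r.2.ideal corr)) := by
  induction p generalizing s with
  | ret o => cases o <;> simp [simulate]
  | coin k ih => simp [simulate, ih]
  | call v k ih =>
    rw [simulate, total_bindO, expect_interp_bind, expect_interp_redCall, avg_bind]
    congr 1
    ext r
    exact ih _ _

theorem expect_congr_of_support {α : Type} (p : PMF α) {h h' : α → ℝ≥0∞}
    (H : ∀ a ∈ p.support, h a = h' a) : expect p h = expect p h' := by
  refine tsum_congr fun a => ?_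
  by_cases ha : p a = 0
  · simp [ha]
  · rw [H a ha]

theorem Prog.Refines.and_of_allResults {α β : Type} {R : β → α → Prop} {q : Prog (Option β)}
    {p : Prog (Option α)} (h : Refines R q p) {P : β → Prop}
    (hq : q.AllResults fun o => ∃ b, o = some b ∧ P b) :
    Refines (fun b a => R b a ∧ P b) q p := by
  induction q generalizing p with
  | ret o =>
    obtain ⟨b, rfl, hb⟩ := hq
    obtain ⟨a, rfl, hab⟩ := h
    exact ⟨a, rfl, hab, hb⟩
  | coin k ih =>
    obtain ⟨k', rfl, hk⟩ := h
    exact ⟨_, rfl, fun b => ih b (hk b) (hq b)⟩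
  | call v k ih =>
    obtain ⟨k', rfl, hk⟩ := h
    exact ⟨_, rfl, fun b => ih b (hk b) (hq b)⟩

/-- The two functions need to agree only where the responder's final state fits the result. This
allows trading the actual state of the functionality for the one computed from the reduced state. -/
theorem Prog.Refines.expect_eq_of_support {α β σ : Type} (O : σ → Val → PMF (Val × σ))
    {R : β → α → Prop} {q : Prog (Option β)} {p : Prog (Option α)} (h : Refines R q p)
    (hq : q.AllResults fun o => o.isSome = true) {S : β → σ → Prop} {s : σ}
    (hS : ∀ x ∈ (q.interp O s).support, ∀ b, x.1 = some b → S b x.2)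
    {H : β → σ → ℝ≥0∞} {H' : α → σ → ℝ≥0∞}
    (hH : ∀ b a, R b a → ∀ s, S b s → H b s = H' a s) :
    expect (q.interp O s) (fun x => liftO (fun b => H b x.2) x.1)
      = expect (p.interp O s) (fun x => liftO (fun a => H' a x.2) x.1) := by
  induction q generalizing p s with
  | ret o =>
    cases o with
    | none => simp [AllResults] at hq
    | some b =>
      obtain ⟨a, rfl, hab⟩ := h
      have := hS (some b, s) ((PMF.mem_support_pure_iff _ _).2 rfl) b rfl
      simpa using hH _ _ hab s this
  | coin k ih =>
    obtain ⟨k', rfl, hk⟩ := h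
    simp only [expect_interp_coin]
    have hsup : ∀ b, ∀ x ∈ ((k b).interp O s).support, ∀ b, x.1 = some b → S b x.2 :=
      fun b x hx => hS x ((PMF.mem_support_bind_iff _ _ _).2 ⟨b, by simp [fairCoin], hx⟩)
    rw [ih _ (hk _) (hq _) (hsup _), ih _ (hk _) (hq _) (hsup _)]
  | call v k ih =>
    obtain ⟨k', rfl, hk⟩ := h
    simp only [expect_interp_call]
    exact expect_congr_of_support _ fun r hr => ih _ (hk _) (hq _)
      fun x hx => hS x ((PMF.mem_support_bind_iff _ _ _).2 ⟨r, hr, hx⟩)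

/-- The law of an activation in the ideal world. -/
theorem expect_interp_simActivation (t : ℕ) (s : Store) (σ : Red) (m : Option Val) (notes : Val)
    {f : FState} (hf : (redInput corr σ notes).AllResults fun r => r.2.ideal corr = f)
    (H : ((Store × ℕ) × Red) → FState → ℝ≥0∞) :
    expect ((simActivation corr adv t s σ m notes).interp (idealWorld corr).call f)
        (fun x => liftO (fun b => H b x.2) x.1)
      = (redInput corr σ notes).avg fun r =>
          ((adv.run (Function.update s 0 (activationVal m r.1)) t).simulate
            (fun s v => (redCall corr s v).total) r.2).avg (liftO fun b => H b (b.2.ideal corr)) := by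
  rw [simActivation, total_bindO, expect_interp_bind, expect_interp_redInput]
  refine avg_congr_of_allResults (hf.mono fun r hr => ?_)
  subst hr
  exact expect_interp_simulate_redCall _ _ H

/-- The activation of the simulator in the ideal world has the law of the activation of the
adversary in the reduced world. -/
theorem expect_ideal_activate (hd : Answers corr d C) (hd' : Translates corr d' C') {μ L T n t : ℕ}
    {s : Store} {σ : Red} {s' : Store} (hs : Ready s σ s') (hμ : σ.mu = μ) (hl : adv.Live T n s)
    (hL : σ.table.length + 2 + 2 * T ≤ L) (ht : simCost C C' μ L T ≤ t) (hT : T ≤ t)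
    (m : Option Val) (notes : Val) (hm : envLength (m, notes) ≤ n) (out : Option Bool)
    (F : Val × Option (FState × Store) → ℝ≥0∞) (G : Val × Red × Store → ℝ≥0∞)
    (hF : F (.nil, none) = 0)
    (hFG : ∀ v σ1 s1 s1', Ready s1 σ1 s1' → σ1.mu = μ →
      adv.Live T (n - envLength (m, notes)) s1 →
      σ1.table.length ≤ σ.table.length + 2 + 2 * T → σ1.Inv corr μ →
      G (v, σ1, s1) = F (v, some (σ1.ideal corr, s1')))
    {f : FState} (hf : (redInput corr σ notes).AllResults fun r =>
      r.2.ideal corr = f ∧ r.2.Inv corr μ) :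
    expect (activate (idealWorld corr) (simCmd d d' adv) t f s' m notes out) F
      = (redInput corr σ notes).avg fun r =>
          (redActivate corr adv t r.2 s m r.1 out).avg (liftO G) := by
  classical
  have href := simCmd_refines hd hd' adv hs hμ m notes T t hL (by rw [← simCost]; exact ht)
  have hres := simActivation_results (corr := corr) hl σ m notes hm le_rfl
  have hlaw := expect_interp_simActivation (adv := adv) T s σ m notes
    (hf.mono fun _ h => h.1)
  have hinv : (simActivation corr adv T s σ m notes).AllResults
      fun o => ∀ r, o = some r → r.2.Inv corr μ := by
    rw [simActivation, total_bindO, allResults_bind]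
    refine hf.mono fun r hr => allResults_simulate (I := fun s : Red => s.Inv corr μ)
      (fun s v hs => ?_) _ hr.2
    rw [allResults_total]
    exact (redCall_inv hs v).mono (by simp)
  have hall := (allResults_and.2 ⟨hres, hinv⟩).mono fun o ⟨⟨r, hr, h1⟩, h2⟩ =>
    (⟨r, hr, h1, h2 r hr⟩ : ∃ r, o = some r ∧ adv.Live T (n - envLength (m, notes)) r.1.1 ∧
      r.2.Inv corr μ)
  -- The law of the activation, tested on the indicator of a mismatch, gives expectation zero. So
  -- the functionality ends in the state prescribed by the reduced world.
  have hS : ∀ x ∈ ((simActivation corr adv T s σ m notes).interp (idealWorld corr).call f).support,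
      ∀ b, x.1 = some b → x.2 = b.2.ideal corr := by
    intro x hx b hb
    by_contra hn
    have h0 := hlaw fun b w => if w = b.2.ideal corr then 0 else 1
    rw [avg_eq_zero (allResults_of_forall _ fun r => avg_eq_zero (allResults_of_forall _
      fun o => by cases o <;> simp))] at h0
    simpa [hb, hn] using eq_zero_of_expect_eq_zero h0 hx
  rw [expect_activate _ _ _ _ _ _ _ _ _ hF]
  have heq := (href.and_of_allResults hall).expect_eq_of_support (idealWorld corr).call
    (allResults_isSome_iff.2 (hres.mono fun o ⟨r, hr, _⟩ => ⟨r, hr, trivial⟩))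
    (S := fun b w => w = b.2.ideal corr) hS
    (H := fun b _ => G (.node (outputVal out) (b.1.1 0), b.2, b.1.1))
    (H' := fun a w => F (.node (outputVal out) (a.1 0), some (w, a.1))) (by
      rintro b a ⟨hba, hlive, hbi⟩ w rfl
      rw [hba.out]
      exact hFG _ _ _ _ (.inl hba.rep) hba.mu hlive hba.table hbi)
  refine (heq.symm.trans (hlaw fun b _ =>
    G (.node (outputVal out) (b.1.1 0), b.2, b.1.1))).trans ?_
  congr 1
  ext r
  rw [redActivate, avg_bindO]
  have hsome := AllResults.simulate (h := redCall corr) (P := fun _ => True)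
    ((hl.run_of_le (m, r.1) hm le_rfl).mono fun o ⟨r, hr, _⟩ => ⟨r, hr, trivial⟩) r.2
  -- The adversary halts within `T`, so the limits `T` and `t` give the same average.
  refine (((adv.run_refines_of_le _ hT).simulate _ r.2).avg_eq
    (H' := fun a => G (.node (outputVal out) (a.1.1 0), a.2, a.1.1))
    (allResults_isSome_iff.2 (hsome.mono fun o ⟨r, hr, _⟩ => ⟨r, hr, trivial⟩))
    fun b a hab => by rw [hab.1.1, hab.2]).trans ?_
  exact avg_congr_of_allResults (allResults_of_forall _ fun o => by cases o <;> rfl)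

theorem Cmd.Live.mono {c : Cmd} {T n n' : ℕ} {s : Store} (h : c.Live T n s) (hn : n' ≤ n) :
    c.Live T n' s := fun acts ha => h acts (ha.trans hn)

/-- The budget `n` of the environment pays for everything: it bounds the length of what the
adversary receives, hence its liveness, and the number of turns, hence the size of the table. -/
theorem expect_interp_ideal_turn (hd : Answers corr d C) (hd' : Translates corr d' C')
    {μ L T t : ℕ} (ht : simCost C C' μ L T ≤ t) (hT : T ≤ t) {α : Type} (q : Prog (Option α))
    {Q : ℕ → Option α → Prop} {n : ℕ} (hq : q.Spends Q n) {s : Store} {σ : Red} {s' : Store}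
    (hs : Ready s σ s') (hi : σ.Inv corr μ) (hl : adv.Live T n s)
    (hL : σ.table.length + n * (2 + 2 * T) ≤ L) (H : α → ℝ≥0∞) :
    expect (q.interp (turn (idealWorld corr) (simCmd d d' adv) t) (some (σ.ideal corr, s')))
        (fun y => liftO (fun a => liftO (fun _ => H a) y.2) y.1)
      = (q.simulate (redTurn corr adv t) (σ, s)).avg (liftO fun r => H r.1) := by
  induction q generalizing n s σ s' with
  | ret o => cases o <;> simp [simulate]
  | coin k ih => simp only [expect_interp_coin, simulate, avg_coin, ih _ (hq _) hs hi hl hL]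
  | call v k ih =>
    obtain ⟨hv, hk⟩ := hq
    have hF : expect ((k .nil).interp (turn (idealWorld corr) (simCmd d d' adv) t) none)
        (fun y => liftO (fun a => liftO (fun _ => H a) y.2) y.1) = 0 :=
      expect_interp_turn_none _ _ _ _ _ fun b => by cases b <;> rfl
    obtain ⟨u, rfl⟩ := Nat.exists_eq_add_of_le hv
    have e1 : (v.size + 1 + u) * (2 + 2 * T) = v.size * (2 + 2 * T) + (2 + 2 * T) +
      u * (2 + 2 * T) := by ring
    have hFG : ∀ a : Option Val × Val, envLength a ≤ v.size + 1 → ∀ w σ1 s1 s1',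
        Ready s1 σ1 s1' → σ1.mu = μ → adv.Live T (v.size + 1 + u - envLength a) s1 →
        σ1.table.length ≤ σ.table.length + 2 + 2 * T → σ1.Inv corr μ →
        ((k w).simulate (redTurn corr adv t) (σ1, s1)).avg (liftO fun r => H r.1)
          = expect ((k w).interp (turn (idealWorld corr) (simCmd d d' adv) t)
              (some (σ1.ideal corr, s1')))
              (fun y => liftO (fun a => liftO (fun _ => H a) y.2) y.1) :=
      fun a ha w σ1 s1 s1' hs1 _ hl1 ht1 hi1 => (ih w (hk w) hs1 hi1 (hl1.mono (by omega))
        (by rw [Nat.add_sub_cancel_left]; omega)).symm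
    have hvs : v.snd.size ≤ v.size := v.size_snd_le
    simp only [expect_interp_call, simulate, turn, redTurn, avg_bindO]
    have hreq : ∀ m, EnvReq.ofVal v = .adv m → m = v.snd := by
      intro m
      rw [EnvReq.ofVal]
      split <;> simp +contextual [eq_comm]
    cases hr : EnvReq.ofVal v with
    | adv m =>
      have ha : envLength (some m, .nil) ≤ v.size + 1 := by
        rw [hreq m hr]
        simp [envLength, hvs]
      have h := expect_ideal_activate hd hd' hs hi.mu hl (by omega) ht hT (some m) .nil
        (ha.trans (by omega)) none
        (F := fun a => expect ((k a.1).interp (turn (idealWorld corr) (simCmd d d' adv) t) a.2)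
          (fun y => liftO (fun a => liftO (fun _ => H a) y.2) y.1))
        (G := fun a => ((k a.1).simulate (redTurn corr adv t) a.2).avg (liftO fun r => H r.1))
        hF (hFG _ ha) (f := σ.ideal corr) (by simp [redInput, AllResults, hi])
      refine h.trans ?_
      simp only [redInput, if_true, avg_ret]
      congr 1
    | input P i =>
      have ha : ∀ notes, envLength (none, notes) ≤ v.size + 1 := fun _ => by simp [envLength]
      simp only [idealWorld_input, expect_bind, expect_pure, avg_bind]
      have h := expect_ideal_activate hd hd' hs hi.mu hl (by omega) ht hT none
        (idealInput corr (σ.ideal corr) P i).2.1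
        ((ha _).trans (by omega)) (idealInput corr (σ.ideal corr) P i).1
        (F := fun a => expect ((k a.1).interp (turn (idealWorld corr) (simCmd d d' adv) t) a.2)
          (fun y => liftO (fun a => liftO (fun _ => H a) y.2) y.1))
        (G := fun a => ((k a.1).simulate (redTurn corr adv t) a.2).avg (liftO fun r => H r.1))
        hF (hFG _ (ha _)) (hi.redWorldInput P i)
      refine h.trans ?_
      congr 1

/-- In the ideal world with the simulator, the environment outputs `1` with the same probability
as in the hybrid world. -/
theorem execProb_ideal_eq (hd : Answers corr d C) (hd' : Translates corr d' C') (hadv : adv.IsPPT)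
    {env : Cmd} (henv : env.IsPPTEnv) (μ : ℕ) (z : Bits) :
    execProb (hybridWorld corr μ) env adv μ z (fun b _ => b = true)
      = execProb (idealWorld corr) env (simCmd d d' adv) μ z (fun b _ => b = true) := by
  obtain ⟨p, hp⟩ := hadv.exists_live
  obtain ⟨pe, hpe⟩ := henv
  set n := pe.eval μ
  set T := p.eval (μ + n)
  set L := n * (2 + 2 * T)
  -- Beyond this limit the environment, the adversary and the simulator all halt, and the two
  -- expectations agree for each single limit.
  rw [execProb_eq_iSup _ _ _ _ _ _ (n + T + simCost C C' μ L T),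
    execProb_eq_iSup _ _ _ _ _ _ (n + T + simCost C C' μ L T)]
  congr 2
  funext t
  set t' := t + (n + T + simCost C C' μ L T) with ht'
  have hst : (idealWorld corr).start = (Red.start μ).ideal corr := by
    simp [idealWorld, FState.start, Red.ideal, Red.start, Stage.hasDig, Stage.hasTx, Stage.hasPub,
      Stage.hasInit]
  rw [expect_hybrid_exec, expect_exec, redExec, hst]
  have hsp := (env.run_refines_of_le (initStore μ (.ofBits z)) (show n ≤ t' by omega)).spends
    (hpe μ z) (env.run_spends _ _)
  exact (expect_interp_ideal_turn hd hd' (show simCost C C' μ L T ≤ t' by omega)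
    (show T ≤ t' by omega) _ hsp (.inr ⟨μ, rfl, rfl, rfl⟩) (Red.Inv.start μ) (hp μ n)
    (show _ ≤ L by simp [Red.start, L]) fun r : Store × ℕ =>
      @ite _ ((r.1 0).toBool = true) (Classical.propDecidable _) 1 0).symm

theorem uCRealizes (corr : Finset Party) : UCRealizes corr := by
  intro adv hadv
  obtain ⟨d, C, hd⟩ := exists_answers corr
  obtain ⟨d', C', hd'⟩ := exists_translates corr
  refine ⟨simCmd d d' adv, simCmd_isPPT hd hd' hadv, fun env henv z => ?_⟩
  simp only [execProb_ideal_eq hd hd' hadv henv, sub_self, abs_zero]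
  exact Asymptotics.superpolynomialDecay_zero _ _

end
end MadHtlc

namespace MadHtlc
open scoped ENNReal
open Prog

/-! ## Guessing a preimage -/

/-- All bit strings of length `n`. -/
def allBits : ℕ → Finset Bits
  | 0 => {[]}
  | n + 1 => (allBits n).image (List.cons true) ∪ (allBits n).image (List.cons false)

theorem avg_const_mul {α : Type} (p : Prog α) (c : ℝ≥0∞) (h : α → ℝ≥0∞) :
    (p.avg fun a => c * h a) = c * p.avg h := by
  induction p with
  | ret a => rfl
  | coin k ih => simp only [avg_coin, ih, ← mul_add, mul_div_assoc]
  | call v k ih => simp [ih]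

/-- Scaling by `2 ^ n` turns the average over a random string into a sum over candidates. Candidates
can then be struck from the sum without conditioning or renormalizing. -/
theorem two_pow_mul_avg_drawP (n : ℕ) (g : Bits → ℝ≥0∞) :
    2 ^ n * (drawP n).avg g = ∑ x ∈ allBits n, g x := by
  induction n generalizing g with
  | zero => simp [drawP, allBits]
  | succ n ih =>
    have hd : Disjoint ((allBits n).image (List.cons true))
        ((allBits n).image (List.cons false)) := by
      rw [Finset.disjoint_left]
      intro x hx hx'
      obtain ⟨a, _, rfl⟩ := Finset.mem_image.1 hx
      obtain ⟨b, _, h⟩ := Finset.mem_image.1 hx'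
      simp at h
    rw [allBits, Finset.sum_union hd, Finset.sum_image (by simp), Finset.sum_image (by simp), ← ih,
      ← ih, ← mul_add, drawP, avg_coin, avg_bind, avg_bind, pow_succ, mul_assoc]
    simp only [avg_ret]
    congr 1
    exact ENNReal.mul_div_cancel (by simp) (by simp)

theorem card_allBits (n : ℕ) : ((allBits n).card : ℝ≥0∞) = 2 ^ n := by
  have := two_pow_mul_avg_drawP n fun _ => 1
  rw [avg_const] at this
  simpa using this.symm

/-- A set of strings of length `μ` is hit with probability at most its size divided by `2 ^ μ`. -/
theorem card_mul_avg_drawP_le {μ : ℕ} {L : Finset Bits} (hL : L ⊆ allBits μ) (S : Finset Bits) :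
    (L.card : ℝ≥0∞) * (drawP μ).avg (fun r => if r ∈ S then 1 else 0) ≤ S.card := by
  calc (L.card : ℝ≥0∞) * (drawP μ).avg (fun r => if r ∈ S then 1 else 0)
      ≤ 2 ^ μ * (drawP μ).avg (fun r => if r ∈ S then 1 else 0) := by
        gcongr
        rw [← card_allBits]
        exact_mod_cast Finset.card_le_card hL
    _ = ∑ x ∈ allBits μ, if x ∈ S then 1 else 0 := two_pow_mul_avg_drawP _ _
    _ ≤ S.card := by
        rw [← Finset.sum_filter, Finset.sum_const, nsmul_one]
        exact_mod_cast Finset.card_le_card fun x hx => (Finset.mem_filter.1 hx).2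

/-- Candidates in `S` are given up, at a cost of at most one each. -/
theorem sum_le_sum_sdiff_add_card (L S : Finset Bits) {g : Bits → ℝ≥0∞} (hg : ∀ x, g x ≤ 1) :
    ∑ x ∈ L, g x ≤ ∑ x ∈ L \ S, g x + S.card := by
  rw [← Finset.sum_inter_add_sum_sdiff L S, add_comm]
  gcongr
  calc ∑ x ∈ L ∩ S, g x ≤ ∑ x ∈ L ∩ S, 1 := Finset.sum_le_sum fun x _ => hg x
    _ = (L ∩ S).card := by simp
    _ ≤ S.card := by exact_mod_cast Finset.card_le_card Finset.inter_subset_right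

/-- A fresh random string, chosen independently of `x`, avoids the set `S`, up to a summand
`S.card`. -/
theorem sum_avg_drawP_le {μ : ℕ} {L : Finset Bits} (hL : L ⊆ allBits μ) (S : Finset Bits)
    {g : Bits → Bits → ℝ≥0∞} (hg : ∀ x r, g x r ≤ 1) {k : ℝ≥0∞}
    (h : ∀ r ∉ S, ∑ x ∈ L, g x r ≤ k) :
    ∑ x ∈ L, (drawP μ).avg (g x) ≤ k + S.card := by
  calc ∑ x ∈ L, (drawP μ).avg (g x) = (drawP μ).avg fun r => ∑ x ∈ L, g x r :=
        (avg_sum _ _ _).symm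
    _ ≤ (drawP μ).avg fun r => k + L.card * (if r ∈ S then 1 else 0) := by
        refine avg_mono _ fun r => ?_
        by_cases hr : r ∈ S
        · rw [if_pos hr, mul_one]
          refine le_add_left ?_
          calc ∑ x ∈ L, g x r ≤ ∑ x ∈ L, 1 := Finset.sum_le_sum fun x _ => hg x r
            _ = L.card := by simp
        · rw [if_neg hr, mul_zero, add_zero]
          exact h r hr
    _ ≤ k + S.card := by
        rw [avg_add, avg_const, avg_const_mul]
        gcongr
        exact card_mul_avg_drawP_le hL S

/-! ### The random oracle and a secret query -/

theorem Table.lookup_eq_none {T : Table} {q : Bits} (h : q ∉ T.map Prod.fst) :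
    T.lookup q = none := by
  induction T with
  | nil => rfl
  | cons a T ih =>
    simp only [List.map_cons, List.mem_cons, not_or] at h
    rw [List.lookup, (by simpa using h.1 : (q == a.1) = false)]
    exact ih h.2

theorem Table.mem_of_lookup {T : Table} {q r : Bits} (h : T.lookup q = some r) :
    r ∈ T.map Prod.snd := by
  induction T with
  | nil => simp at h
  | cons a T ih =>
    by_cases hq : q = a.1
    · simp [List.lookup, hq] at h
      simp [h]
    · rw [List.lookup, (by simpa using hq : (q == a.1) = false)] at h
      exact List.mem_cons_of_mem _ (ih h)

theorem Table.lookup_hidden {T1 T2 : Table} {q x D : Bits} (h : q ≠ x) :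
    (T1 ++ (x, D) :: T2).lookup q = (T1 ++ T2).lookup q := by
  induction T1 with
  | nil => simp [List.lookup, (by simpa using h : (q == x) = false)]
  | cons a T ih =>
    rw [List.cons_append, List.cons_append, List.lookup, List.lookup, ih]

/-- The query `x`, with answer `D`, for arbitrary `x ∈ L`, does not show in the rest of the
table. -/
structure HiddenIn (μ : ℕ) (D : Bits) (T1 T2 : Table) (L : Finset Bits) : Prop where
  subset : L ⊆ allBits μ
  query : ∀ x ∈ L, x ∉ (T1 ++ T2).map Prod.fst
  answer : D ∉ (T1 ++ T2).map Prod.snd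

/-- The query costs one for the candidate `x = q`, which is struck. For all other candidates the
oracle answers alike: by an old entry, whose answer is not `D`, or by a fresh string, which is `D`
with probability at most `2 ^ (-μ)` and thus costs one more after scaling. -/
theorem HiddenIn.sum_hashP_le {μ : ℕ} {D : Bits} {T1 T2 : Table} {L : Finset Bits}
    (h : HiddenIn μ D T1 T2 L) (q : Bits) {F : Bits → Bits × Table → ℝ≥0∞} (hF : ∀ x r, F x r ≤ 1)
    {k : ℝ≥0∞} (H : ∀ r T1' L', HiddenIn μ D T1' T2 L' → r ≠ D → T1'.length ≤ T1.length + 1 →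
      ∑ x ∈ L', F x (r, T1' ++ (x, D) :: T2) ≤ k) :
    ∑ x ∈ L, (hashP μ (T1 ++ (x, D) :: T2) q).avg (F x) ≤ k + 2 := by
  have hle : ∀ x, (hashP μ (T1 ++ (x, D) :: T2) q).avg (F x) ≤ 1 := fun x =>
    (avg_mono _ (hF x)).trans_eq (avg_const _ _)
  have hsub : HiddenIn μ D T1 T2 (L \ {q}) :=
    ⟨Finset.sdiff_subset.trans h.subset, fun x hx => h.query x (Finset.sdiff_subset hx), h.answer⟩
  refine (sum_le_sum_sdiff_add_card L {q} hle).trans ?_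
  have hne : ∀ x ∈ L \ {q}, q ≠ x := fun x hx e => by simp [e] at hx
  cases hl : (T1 ++ T2).lookup q with
  | some r =>
    have hr : r ≠ D := fun e => h.answer (e ▸ Table.mem_of_lookup hl)
    calc _ = ∑ x ∈ L \ {q}, F x (r, T1 ++ (x, D) :: T2) + (({q} : Finset Bits).card : ℝ≥0∞) := by
            congr 1
            refine Finset.sum_congr rfl fun x hx => ?_
            rw [hashP, Table.lookup_hidden (hne x hx), hl]
            rfl
      _ ≤ k + 2 := by
        gcongr
        · exact H r T1 _ hsub hr (by omega)
        · simp
  | none =>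
    have hq : ∀ r, r ≠ D → HiddenIn μ D ((q, r) :: T1) T2 (L \ {q}) := fun r hr =>
      ⟨hsub.subset, fun x hx => by
        have := hsub.query x hx
        have := (hne x hx).symm
        simp_all, by
        rw [List.cons_append, List.map_cons, List.mem_cons, not_or]
        exact ⟨hr.symm, h.answer⟩⟩
    calc _ = ∑ x ∈ L \ {q}, (drawP μ).avg (fun r => F x (r, ((q, r) :: T1) ++ (x, D) :: T2))
              + (({q} : Finset Bits).card : ℝ≥0∞) := by
            congr 1
            refine Finset.sum_congr rfl fun x hx => ?_
            rw [hashP, Table.lookup_hidden (hne x hx), hl]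
            simp [avg_bind]
      _ ≤ (k + (({D} : Finset Bits).card : ℝ≥0∞)) + (({q} : Finset Bits).card : ℝ≥0∞) := by
        gcongr
        refine sum_avg_drawP_le hsub.subset {D} (fun _ _ => hF _ _) fun r hr => ?_
        have hr' : r ≠ D := by simpa using hr
        exact H r _ _ (hq r hr') hr' (by simp)
      _ = k + 2 := by
        rw [add_assoc]
        congr 1
        norm_num

/-- For the candidates that survive the query, the answer is not `D`, so the hidden digest has not
been opened. This is the point where a successful guess is excluded. -/
theorem HiddenIn.sum_preimageP_le {μ : ℕ} {D : Bits} {T1 T2 : Table} {L : Finset Bits}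
    (h : HiddenIn μ D T1 T2 L) (p : Option Bits) (d : Bits) {F : Bits → Bool × Table → ℝ≥0∞}
    (hF : ∀ x r, F x r ≤ 1) {k : ℝ≥0∞}
    (H : ∀ b T1' L', HiddenIn μ D T1' T2 L' → (d = D → b = false) →
      T1'.length ≤ T1.length + 1 → ∑ x ∈ L', F x (b, T1' ++ (x, D) :: T2) ≤ k) :
    ∑ x ∈ L, (preimageP μ (T1 ++ (x, D) :: T2) p d).avg (F x) ≤ k + 2 := by
  cases p with
  | none => exact (H false T1 L h (fun _ => rfl) (by omega)).trans (le_add_right le_rfl)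
  | some q =>
    simp only [preimageP, avg_bind]
    refine h.sum_hashP_le q (fun x r => hF _ _) fun r T1' L' h' hr hlen => ?_
    exact H (decide (r = d)) T1' L' h' (fun e => by simp [e, hr]) hlen

/-- Sampling a secret and asking for its answer. -/
theorem sum_hashP_secret_le {μ : ℕ} (T : Table) {F : Bits → Bits × Table → ℝ≥0∞}
    (hF : ∀ x r, F x r ≤ 1) {k : ℝ≥0∞}
    (H : ∀ D L, HiddenIn μ D [] T L → ∑ x ∈ L, F x (D, (x, D) :: T) ≤ k) :
    ∑ x ∈ allBits μ, (hashP μ T x).avg (F x) ≤ k + (2 * T.length : ℕ) := by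
  have hle : ∀ x, (hashP μ T x).avg (F x) ≤ 1 := fun x =>
    (avg_mono _ (hF x)).trans_eq (avg_const _ _)
  have hsub : allBits μ \ (T.map Prod.fst).toFinset ⊆ allBits μ := Finset.sdiff_subset
  have hcard : ∀ f : Bits × Bits → Bits, (T.map f).toFinset.card ≤ T.length := fun f =>
    (List.toFinset_card_le _).trans (by simp)
  -- Two sets of at most `T.length` strings are written off: secrets that were queried before, and
  -- digests that were answers before. For the rest the digest is drawn independently of the secret,
  -- so it can be fixed first.
  calc _ ≤ ∑ x ∈ allBits μ \ (T.map Prod.fst).toFinset, (hashP μ T x).avg (F x)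
            + ((T.map Prod.fst).toFinset.card : ℝ≥0∞) := sum_le_sum_sdiff_add_card _ _ hle
    _ = ∑ x ∈ allBits μ \ (T.map Prod.fst).toFinset, (drawP μ).avg (fun r => F x (r, (x, r) :: T))
            + ((T.map Prod.fst).toFinset.card : ℝ≥0∞) := by
          congr 1
          refine Finset.sum_congr rfl fun x hx => ?_
          rw [hashP, Table.lookup_eq_none (by simpa using (Finset.mem_sdiff.1 hx).2)]
          simp [avg_bind]
    _ ≤ (k + ((T.map Prod.snd).toFinset.card : ℝ≥0∞)) + ((T.map Prod.fst).toFinset.card : ℝ≥0∞) := by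
          gcongr
          refine sum_avg_drawP_le hsub _ (fun _ _ => hF _ _) fun r hr => ?_
          refine H r _ ⟨hsub, fun x hx => ?_, by simpa using hr⟩
          simpa using (Finset.mem_sdiff.1 hx).2
    _ ≤ k + (2 * T.length : ℕ) := by
          rw [add_assoc]
          gcongr
          have h1 := hcard Prod.fst
          have h2 := hcard Prod.snd
          exact_mod_cast (by omega : (T.map Prod.snd).toFinset.card +
            (T.map Prod.fst).toFinset.card ≤ 2 * T.length)

end MadHtlc

set_option linter.unusedSimpArgs false
namespace MadHtlc
open scoped ENNReal
open Prog

/-! ## Corrupted parties cannot publish undisclosed preimages -/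

/-- The two preimages that honest `B` draws. -/
inductive Secret where
  | first | second

def Red.dig (i : Secret) (s : Red) : Bits :=
  match i with
  | .first => s.d1
  | .second => s.d2

/-- The state with the secret replaced by `x`, which is listed in the table behind `T1`. -/
def Red.hide (i : Secret) (s : Red) (T1 T2 : Table) (x : Bits) : Red :=
  match i with
  | .first => { s with
      table := T1 ++ (x, s.d1) :: T2, pa := x, apre := s.apre.map fun _ => x }
  | .second => { s with table := T1 ++ (x, s.d2) :: T2, pb := x }

variable (corr : Finset Party) (i : Secret)

/-- With the transaction, a corrupted party publishes a preimage that was not disclosed. -/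
def RedeemTx.Steals (r : RedeemTx) : Prop :=
  r.party ∈ corr ∧
    match i with
    | .first => r.pubA = false ∧ r.pubAAfter = true ∧ ¬ (Party.A ∈ corr ∧ r.shared = true)
    | .second => r.pubB = false ∧ r.pubBAfter = true

def Red.Clean (s : Red) : Prop := ∀ r ∈ s.log, ¬ r.Steals corr i

/-- The secret need not be protected any more. -/
def Red.Disclosed (s : Red) : Prop :=
  match i with
  | .first => s.pubA = true ∨ (Party.A ∈ corr ∧ s.shared = true)
  | .second => s.pubB = true

/-- The secret was disclosed, and was not stolen before. -/
def Red.Safe (s : Red) : Prop := s.Disclosed corr i ∧ s.Clean corr i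

section hide
variable {corr i} (s : Red) (T1 T2 : Table) (x : Bits)

@[simp] theorem Red.hide_mu : (s.hide i T1 T2 x).mu = s.mu := by cases i <;> rfl
@[simp] theorem Red.hide_stage : (s.hide i T1 T2 x).stage = s.stage := by cases i <;> rfl
@[simp] theorem Red.hide_d1 : (s.hide i T1 T2 x).d1 = s.d1 := by cases i <;> rfl
@[simp] theorem Red.hide_d2 : (s.hide i T1 T2 x).d2 = s.d2 := by cases i <;> rfl
@[simp] theorem Red.hide_pubA : (s.hide i T1 T2 x).pubA = s.pubA := by cases i <;> rfl
@[simp] theorem Red.hide_pubB : (s.hide i T1 T2 x).pubB = s.pubB := by cases i <;> rfl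
@[simp] theorem Red.hide_log : (s.hide i T1 T2 x).log = s.log := by cases i <;> rfl
@[simp] theorem Red.hide_shared : (s.hide i T1 T2 x).shared = s.shared := by cases i <;> rfl
@[simp] theorem Red.hide_table :
    (s.hide i T1 T2 x).table = T1 ++ (x, s.dig i) :: T2 := by cases i <;> rfl

theorem Red.hide_sharedInd : (s.hide i T1 T2 x).sharedInd corr = s.sharedInd corr := by
  cases i <;> simp [hide, sharedInd]

theorem Red.hide_ideal : (s.hide i T1 T2 x).ideal corr = s.ideal corr := by
  cases i <;> simp [hide, ideal]

theorem Red.hide_with_table (T1' : Table) :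
    { s.hide i T1 T2 x with table := T1' ++ (x, s.dig i) :: T2 } = s.hide i T1' T2 x := by
  cases i <;> rfl

theorem Red.hide_redeem (P : Party) (path : RPath) (h1 h2 : Bool) :
    (s.hide i T1 T2 x).redeem corr P path h1 h2 = (s.redeem corr P path h1 h2).hide i T1 T2 x := by
  have h := s.hide_sharedInd (corr := corr) (i := i) T1 T2 x
  rw [redeem, h]
  cases i <;> rfl

end hide

/-! ### Disclosed secrets stay disclosed -/

section safe
variable {corr i}

/-- The publication indicators and the indicator of sharing can only grow. -/
structure Red.Grows (s s' : Red) : Prop where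
  pubA : s.pubA = true → s'.pubA = true
  pubB : s.pubB = true → s'.pubB = true
  shared : s.shared = true → s'.shared = true

theorem Red.Grows.safe {s s' : Red} (h : s.Grows s') (hlog : s'.log = s.log)
    (hs : s.Safe corr i) : s'.Safe corr i := by
  refine ⟨?_, by rw [Clean, hlog]; exact hs.2⟩
  have hd := hs.1
  have h1 := h.pubA
  have h2 := h.pubB
  have h3 := h.shared
  cases i <;> simp only [Disclosed] at hd ⊢ <;> tauto

theorem Red.Safe.redeem {s : Red} (hs : s.Safe corr i) (P : Party) (path : RPath) (h1 h2 : Bool) :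
    (s.redeem corr P path h1 h2).Safe corr i := by
  obtain ⟨hd, hc⟩ := hs
  refine ⟨?_, ?_⟩
  · cases i <;> simp only [Disclosed, Red.redeem, Bool.or_eq_true] at hd ⊢ <;> tauto
  · intro r hr
    rcases List.mem_cons.1 hr with rfl | hr
    · rintro ⟨-, hst⟩
      cases i
      · simp only [Disclosed] at hd
        by_cases hA : Party.A ∈ corr <;> by_cases hB : Party.B ∈ corr <;>
          simp_all [Red.sharedInd]
      · simp_all [Disclosed]
    · exact hc r hr

theorem redSend_safe {s : Red} (hs : s.Safe corr i) (P : Party) (r : GReq) :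
    (redSend corr s P r).AllResults fun r => r.2.Safe corr i := by
  have hst : ∀ s' : Red, s.Grows s' → s'.log = s.log → s'.Safe corr i := fun s' h h' => h.safe h' hs
  cases r with
  | redeem t p1 p2 path =>
    rw [redSend, redRedeem]
    split
    · simp only [allResults_bind, allResults_tellIf]
      refine allResults_of_forall _ fun h1 => allResults_of_forall _ fun h2 => ?_
      exact Red.Safe.redeem (hst { s with table := h2.2 } ⟨id, id, id⟩ rfl) P path _ _
    · exact hs
  | _ =>
    rw [redSend]
    split
    · rw [allResults_bind, allResults_tell]
      exact hst _ ⟨id, id, id⟩ rfl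
    · exact hs

theorem redCall_safe {s : Red} (hs : s.Safe corr i) (v : Val) :
    (redCall corr s v).AllResults fun r => r.2.Safe corr i := by
  unfold redCall
  cases AdvReq.ofVal v with
  | hash q =>
    simp only [redHash, allResults_bind]
    exact allResults_of_forall _ fun r => Red.Grows.safe (s := s) ⟨id, id, id⟩ rfl hs
  | send P r =>
    dsimp only
    split
    · exact redSend_safe hs P r
    · exact hs
  | share x =>
    dsimp only
    split
    · rw [redShare]
      split
      · simp only [allResults_bind, allResults_tellIf]
        exact allResults_of_forall _ fun r => Red.Grows.safe (s := s) ⟨id, id, id⟩ rfl hs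
      · exact hs
    · exact hs

theorem redLeak_safe {s : Red} (hs : s.Safe corr i) (l : FLeak) :
    (redLeak corr s l).AllResults fun r => r.2.Safe corr i := by
  have hst : ∀ s' : Red, s.Grows s' → s'.log = s.log → s'.Safe corr i := fun s' h h' => h.safe h' hs
  cases l with
  | setupB =>
    simp only [redLeak, redSetupB, allResults_bind]
    exact allResults_of_forall _ fun _ => allResults_of_forall _ fun _ => allResults_of_forall _
      fun _ => allResults_of_forall _ fun _ => hst _ ⟨id, id, id⟩ rfl
  | share =>
    rw [redLeak]
    split <;> exact hst _ ⟨id, id, fun _ => rfl⟩ rfl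
  | redeem path P => exact hs.redeem P path _ _
  | _ => exact hst _ ⟨id, id, id⟩ rfl

end safe

/-! ### Bounds -/

/-- The secret was not drawn yet. -/
structure Red.Unused (μ l : ℕ) (s : Red) : Prop where
  stage : s.stage = .start
  mu : s.mu = μ
  table : s.table.length ≤ l
  apre : s.apre = none
  clean : s.Clean corr i

/-- An upper bound for a function of the state, if the secret is chosen at random, in units of
`2 ^ (-μ)`. -/
structure Bounds (μ l : ℕ) (f : Red → ℝ≥0∞) (k : ℝ≥0∞) : Prop where
  le_one : ∀ s, f s ≤ 1
  safe : ∀ s : Red, s.Safe corr i → f s = 0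
  start : ∀ s : Red, s.Unused corr i μ l → 2 ^ μ * f s ≤ k
  hidden : ∀ (s : Red) (T1 T2 : Table) (L : Finset Bits), HiddenIn μ (s.dig i) T1 T2 L →
    s.stage ≠ .start → s.mu = μ → s.Clean corr i → T1.length + T2.length + 1 ≤ l →
    ∑ x ∈ L, f (s.hide i T1 T2 x) ≤ k

/-- The computation increases bounds by at most `c`, and the length of the table from `l` to at
most `l'`. -/
def Step {α : Type} (μ l l' c : ℕ) (m : Red → Prog (α × Red)) : Prop :=
  ∀ (f : α → Red → ℝ≥0∞) (k : ℝ≥0∞), (∀ a, Bounds corr i μ l' (f a) k) →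
    Bounds corr i μ l (fun s => (m s).avg fun r => f r.1 r.2) (k + c)

/-- Large enough for the most expensive step, the drawing of the secret: at most `2 * (l + 1)` for a
table of `l` entries and possibly the other preimage. It also covers the `4` of a redeeming
transaction with its two tests. -/
def stepCost (l : ℕ) : ℕ := 2 * l + 4

section step
variable {corr i} {μ l l' : ℕ}

theorem avg_le_one {α : Type} (p : Prog α) {h : α → ℝ≥0∞} (hh : ∀ a, h a ≤ 1) : p.avg h ≤ 1 :=
  (avg_mono p hh).trans_eq (avg_const p 1)

theorem avg_le_of_allResults {α : Type} {p : Prog α} {h : α → ℝ≥0∞} {k : ℝ≥0∞}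
    (hh : p.AllResults fun a => h a ≤ k) : p.avg h ≤ k :=
  (avg_mono_of_allResults hh).trans_eq (avg_const p k)

theorem two_pow_mul_avg_le {α : Type} {f : α → Red → ℝ≥0∞} {k : ℝ≥0∞}
    (hf : ∀ a, Bounds corr i μ l (f a) k) {p : Prog (α × Red)}
    (hp : p.AllResults fun r => r.2.Unused corr i μ l) :
    2 ^ μ * (p.avg fun r => f r.1 r.2) ≤ k := by
  rw [← avg_const_mul]
  exact avg_le_of_allResults (hp.mono fun r hr => (hf r.1).start r.2 hr)

/-- Before the digests are set, the functionality accepts nothing except from B. -/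
theorem redSend_unused {s : Red} (hs : s.Unused corr i μ l) {P : Party} (hP : P ≠ .B) (r : GReq) :
    redSend corr s P r = .ret (.nil, s) := by
  have := hs.stage
  cases r <;> simp [redSend, redRedeem, hP, this, Stage.hasPub]

theorem redCall_unused (hB : Party.B ∉ corr) {s : Red} (hs : s.Unused corr i μ l) (v : Val) :
    (redCall corr s v).AllResults fun r => r.2.Unused corr i μ (l + 2) := by
  have hs' : s.Unused corr i μ (l + 2) :=
    ⟨hs.stage, hs.mu, hs.table.trans (by omega), hs.apre, hs.clean⟩
  unfold redCall
  cases AdvReq.ofVal v with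
  | hash q =>
    simp only [redHash, allResults_bind]
    refine (hashP_results _ _ _).mono fun r hr => ⟨hs.stage, hs.mu, ?_, hs.apre, hs.clean⟩
    have h1 := hr.2.length
    have h2 := hs.table
    dsimp only
    omega
  | send P r =>
    dsimp only
    split
    next hP => rw [redSend_unused hs (by rintro rfl; exact hB hP)]; exact hs'
    · exact hs'
  | share x => simpa [hB, AllResults] using hs'

/-- Each of the two tests costs `2`. For the surviving candidates the test against the hidden digest
fails, so the indicator of the secret does not change and the new record is no theft. -/
theorem Bounds.hidden_redeem {f : Val → Red → ℝ≥0∞} {k : ℝ≥0∞}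
    (hf : ∀ a, Bounds corr i μ (l + 2) (f a) k) {s : Red} {T1 T2 : Table} {L : Finset Bits}
    (h : HiddenIn μ (s.dig i) T1 T2 L) (hst : s.stage ≠ .start) (hμ : s.mu = μ)
    (hc : s.Clean corr i) (hl : T1.length + T2.length + 1 ≤ l) (P : Party) (t : Tx)
    (p1 p2 : Option Bits) (path : RPath) :
    ∑ x ∈ L, ((redRedeem corr (s.hide i T1 T2 x) P t p1 p2 path).avg fun r => f r.1 r.2)
      ≤ k + stepCost l := by
  have h4 : k + 2 + 2 ≤ k + (stepCost l : ℕ) := by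
    rw [add_assoc, stepCost]
    gcongr
    exact_mod_cast (by omega : 2 + 2 ≤ 2 * l + 4)
  by_cases hcond : s.stage = .initiated ∧ t = ⟨s.d1, s.d2⟩
  · have key : ∀ x, ((redRedeem corr (s.hide i T1 T2 x) P t p1 p2 path).avg fun r => f r.1 r.2)
        = (preimageP μ (T1 ++ (x, s.dig i) :: T2) p1 s.d1).avg fun h1 =>
          (preimageP μ h1.2 p2 s.d2).avg fun h2 =>
            f (redeemNote corr p1 p2 s.d1 s.d2 path P (s.pubA || h1.1) (s.pubB || h2.1))
              ({ s.hide i T1 T2 x with table := h2.2 }.redeem corr P path h1.1 h2.1) := by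
      obtain ⟨hc1, rfl⟩ := hcond
      subst hμ
      intro x
      cases i <;> simp only [redRedeem, Red.hide, hc1, and_self, if_true, avg_bind, avg_tellIf,
        avg_ret] <;> rfl
    simp only [key]
    refine (h.sum_preimageP_le p1 s.d1 (F := fun x h1 => (preimageP μ h1.2 p2 s.d2).avg fun h2 =>
      f (redeemNote corr p1 p2 s.d1 s.d2 path P (s.pubA || h1.1) (s.pubB || h2.1))
        ({ s.hide i T1 T2 x with table := h2.2 }.redeem corr P path h1.1 h2.1)) (k := k + 2)
        (fun x r => avg_le_one _ fun _ => (hf _).le_one _) ?_).trans h4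
    intro b T1' L' h' hb hl'
    refine h'.sum_preimageP_le p2 s.d2 (F := fun x h2 =>
      f (redeemNote corr p1 p2 s.d1 s.d2 path P (s.pubA || b) (s.pubB || h2.1))
        ({ s.hide i T1 T2 x with table := h2.2 }.redeem corr P path b h2.1))
        (fun x r => (hf _).le_one _) ?_
    intro b' T1'' L'' h'' hb' hl''
    simp only [Red.hide_with_table, Red.hide_redeem]
    refine (hf _).hidden (s.redeem corr P path b b') T1'' T2 L'' ?_ hst hμ ?_ (by omega)
    · cases i <;> exact h''
    · intro r hr
      rcases List.mem_cons.1 hr with rfl | hr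
      · rintro ⟨-, hr⟩
        cases i
        · obtain ⟨h1, h2, -⟩ := hr
          change s.pubA = false at h1
          change (s.pubA || b) = true at h2
          simp [h1, hb rfl] at h2
        · obtain ⟨h1, h2⟩ := hr
          change s.pubB = false at h1
          change (s.pubB || b') = true at h2
          simp [h1, hb' rfl] at h2
      · exact hc r hr
  · simp only [redRedeem, Red.hide_stage, Red.hide_d1, Red.hide_d2, hcond, if_false, avg_ret]
    exact ((hf _).hidden s T1 T2 L h hst hμ hc (by omega)).trans (le_add_right le_rfl)

/-- Requests other than redeeming transactions change at most the stage, and what they reveal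
depends on the digests but not on the candidate. -/
theorem Bounds.hidden_redSend {f : Val → Red → ℝ≥0∞} {k : ℝ≥0∞}
    (hf : ∀ a, Bounds corr i μ (l + 2) (f a) k) {s : Red} {T1 T2 : Table} {L : Finset Bits}
    (h : HiddenIn μ (s.dig i) T1 T2 L) (hst : s.stage ≠ .start) (hμ : s.mu = μ)
    (hc : s.Clean corr i) (hl : T1.length + T2.length + 1 ≤ l) {P : Party} (hP : P ≠ .B)
    (r : GReq) :
    ∑ x ∈ L, ((redSend corr (s.hide i T1 T2 x) P r).avg fun r => f r.1 r.2) ≤ k + stepCost l := by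
  have hstage : ∀ (v : Val) (st : Stage), st ≠ .start →
      ∑ x ∈ L, f v ({ s with stage := st }.hide i T1 T2 x) ≤ k + stepCost l := fun v st hst' =>
    ((hf v).hidden { s with stage := st } T1 T2 L (by cases i <;> exact h) hst' hμ hc
      (by omega)).trans (le_add_right le_rfl)
  have hsame : ∑ x ∈ L, f .nil (s.hide i T1 T2 x) ≤ k + stepCost l := hstage .nil s.stage hst
  cases r with
  | setupB d1 d2 => simpa [redSend, hP] using hsame
  | setupA =>
    by_cases hA : P = .A
    · have key : ∀ x, ((redSend corr (s.hide i T1 T2 x) P .setupA).avg fun r => f r.1 r.2)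
          = f (setupANote corr ⟨s.d1, s.d2⟩)
            ({ s with stage := s.stage.afterSetupA }.hide i T1 T2 x) := by
        intro x
        cases i <;> simp [redSend, Red.hide, hA, hst, avg_bind, tell]
      simp only [key]
      refine hstage _ _ ?_
      cases hs : s.stage <;> simp_all [Stage.afterSetupA]
    · simpa [redSend, hA] using hsame
  | publish t =>
    by_cases hcond : P ≠ .M ∧ s.stage = .created ∧ t = ⟨s.d1, s.d2⟩
    · obtain ⟨h1, h2, h3⟩ := hcond
      have key : ∀ x, ((redSend corr (s.hide i T1 T2 x) P (.publish t)).avg fun r => f r.1 r.2)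
          = f (publishNote corr t) ({ s with stage := .published }.hide i T1 T2 x) := by
        intro x
        cases i <;> simp [redSend, Red.hide, h1, h2, h3, avg_bind, tell]
      simp only [key]
      exact hstage _ _ (by simp)
    · simpa [redSend, hcond] using hsame
  | init t =>
    by_cases hcond : P = .M ∧ s.stage.hasPub = true ∧ t = ⟨s.d1, s.d2⟩
    · obtain ⟨h1, h2, h3⟩ := hcond
      have key : ∀ x, ((redSend corr (s.hide i T1 T2 x) P (.init t)).avg fun r => f r.1 r.2)
          = f (initNote corr t) ({ s with stage := .initiated }.hide i T1 T2 x) := by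
        intro x
        cases i <;> simp [redSend, Red.hide, h1, h2, h3, avg_bind, tell]
      simp only [key]
      exact hstage _ _ (by simp)
    · simpa [redSend, hcond] using hsame
  | redeem t p1 p2 path => exact Bounds.hidden_redeem hf h hst hμ hc hl P t p1 p2 path

/-- As B is honest, the adversary can neither set the digests nor send values to A. Only oracle
queries and redeeming transactions touch the secret. -/
theorem step_redCall (hB : Party.B ∉ corr) (v : Val) :
    Step corr i μ l (l + 2) (stepCost l) fun s => redCall corr s v := by
  intro f k hf
  refine ⟨fun s => avg_le_one _ fun r => (hf _).le_one _, fun s hs => avg_eq_zero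
    ((redCall_safe hs v).mono fun r hr => (hf _).safe _ hr), fun s hs =>
    (two_pow_mul_avg_le hf (redCall_unused hB hs v)).trans (le_add_right le_rfl), ?_⟩
  intro s T1 T2 L h hst hμ hc hl
  have hsame : ∑ x ∈ L, f .nil (s.hide i T1 T2 x) ≤ k + stepCost l :=
    ((hf _).hidden s T1 T2 L h hst hμ hc (by omega)).trans (le_add_right le_rfl)
  unfold redCall
  cases AdvReq.ofVal v with
  | hash q =>
    have key : ∀ x, ((redHash (s.hide i T1 T2 x) q).avg fun r => f r.1 r.2)
        = (hashP μ (T1 ++ (x, s.dig i) :: T2) q).avg fun r =>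
            f (.ofBits r.1) { s.hide i T1 T2 x with table := r.2 } := by
      subst hμ
      intro x
      cases i <;> simp only [redHash, Red.hide, avg_bind, avg_ret] <;> rfl
    simp only [key]
    refine (h.sum_hashP_le q (F := fun x r => f (.ofBits r.1)
      { s.hide i T1 T2 x with table := r.2 }) (fun x r => (hf _).le_one _) (k := k) ?_).trans ?_
    · intro r T1' L' h' _ hl'
      simp only [Red.hide_with_table]
      exact (hf _).hidden s T1' T2 L' h' hst hμ hc (by omega)
    · gcongr
      rw [stepCost]
      exact_mod_cast (by omega : 2 ≤ 2 * l + 4)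
  | send P r =>
    dsimp only
    split
    next hP => exact Bounds.hidden_redSend hf h hst hμ hc hl (by rintro rfl; exact hB hP) r
    · exact hsame
  | share x => simpa [hB] using hsame

end step
end MadHtlc

set_option linter.unusedSimpArgs false
namespace MadHtlc
open scoped ENNReal
open Prog

/-! ### Inputs to the parties -/

theorem fStep_leaks (f : FState) (P : Party) (i : PInput) :
    (fStep f P i).1 = [] ∨ ∃ l, (fStep f P i).1 = [l] ∧
      match l with
      | .setupB => f.setupB = false
      | .setupA => f.setupB = true
      | .share | .publish => f.setupA = true
      | .init => f.published = true
      | .redeem _ Q => f.init = true ∧ Q = P := by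
  cases P <;> cases i <;> simp only [fStep] <;> (try split) <;> simp_all

section
variable {corr : Finset Party}

/-- The leakage `l` can occur in the state. -/
structure Red.CanLeak (corr : Finset Party) (s : Red) (l : FLeak) : Prop where
  stage : l = .setupB ↔ s.stage = .start
  honest : ∀ path P, l = .redeem path P → P ∉ corr

/-- The leak depends on the ideal state alone and is chosen before `s`. All candidates for the
secret give the same ideal state (`Red.hide_ideal`), so they all lead to the same case. -/
theorem redWorldInput_cases (f : FState) (P : Party) (i : PInput) :
    (∃ v, ∀ s : Red, s.ideal corr = f → redWorldInput corr s P i = .ret (v, s)) ∨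
      ∃ l, ∀ s : Red, s.ideal corr = f →
        redWorldInput corr s P i = redLeak corr s l ∧ s.CanLeak corr l := by
  by_cases hP : P ∈ corr
  · exact .inl ⟨notesVal [.input P i], fun s _ => by
      rw [redWorldInput, idealInput, if_pos hP, redInput_input]⟩
  rcases fStep_leaks f P i with h | ⟨l, h, hl⟩
  · refine .inl ⟨.nil, fun s hs => ?_⟩
    rw [redWorldInput, idealInput, if_neg hP, hs, h]
    exact redInput_nil s
  · refine .inr ⟨l, fun s hs => ⟨?_, ?_⟩⟩
    · rw [redWorldInput, idealInput, if_neg hP, hs, h]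
      exact redInput_leak s l
    · subst hs
      constructor
      · cases l <;> cases hst : s.stage <;>
          simp_all [Red.ideal, Stage.hasDig, Stage.hasTx, Stage.hasPub, Stage.hasInit]
      · rintro path Q rfl
        exact hl.2 ▸ hP

variable {i : Secret} {μ l l' : ℕ}

theorem Bounds.mono {f : Red → ℝ≥0∞} {k k' : ℝ≥0∞} (h : Bounds corr i μ l' f k) (hl : l ≤ l')
    (hk : k ≤ k') : Bounds corr i μ l f k' :=
  ⟨h.le_one, h.safe, fun s hs => (h.start s ⟨hs.stage, hs.mu, hs.table.trans hl, hs.apre,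
    hs.clean⟩).trans hk, fun s T1 T2 L hL hst hμ hc hl' =>
    (h.hidden s T1 T2 L hL hst hμ hc (hl'.trans hl)).trans hk⟩

theorem Bounds.avg {α : Type} {p : Prog α} {f : α → Red → ℝ≥0∞} {k : ℝ≥0∞}
    (h : p.AllResults fun a => Bounds corr i μ l (f a) k) :
    Bounds corr i μ l (fun s => p.avg fun a => f a s) k := by
  refine ⟨fun s => avg_le_of_allResults (h.mono fun a ha => ha.le_one s),
    fun s hs => avg_eq_zero (h.mono fun a ha => ha.safe s hs), fun s hs => ?_,
    fun s T1 T2 L hL hst hμ hc hl' => ?_⟩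
  · rw [← avg_const_mul]
    exact avg_le_of_allResults (h.mono fun a ha => ha.start s hs)
  · rw [← avg_sum]
    exact avg_le_of_allResults (h.mono fun a ha => ha.hidden s T1 T2 L hL hst hμ hc hl')

/-- Here the secret comes into being: the factor `2 ^ μ` in `start` is spent on turning its random
choice into the sum over candidates in `hidden`. -/
theorem Bounds.redSetupB {f : Val → Red → ℝ≥0∞} {k : ℝ≥0∞}
    (hf : ∀ a, Bounds corr i μ (l + 2) (f a) k) {s : Red} (hs : s.Unused corr i μ l) :
    2 ^ μ * ((redSetupB corr s).avg fun r => f r.1 r.2) ≤ k + stepCost l := by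
  have hT := hs.table
  obtain rfl := hs.mu
  simp only [MadHtlc.redSetupB, avg_bind, avg_ret]
  cases i with
  | first =>
    -- The second preimage is independent of the first, so it is fixed outside the sum. Its own
    -- query comes after that of the secret and is charged like one of the adversary, with `2`.
    rw [two_pow_mul_avg_drawP, ← avg_sum]
    refine avg_le_of_allResults (allResults_of_forall _ fun b => ?_)
    refine (sum_hashP_secret_le s.table (F := fun a ha => (hashP s.mu ha.2 b).avg fun hb =>
      f (setupBNote corr ha.1 hb.1) { s with
        table := hb.2, stage := .digests, d1 := ha.1, d2 := hb.1, pa := a, pb := b })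
      (fun _ _ => avg_le_one _ fun _ => (hf _).le_one _) (k := k + 2) fun D L hL => ?_).trans ?_
    · refine hL.sum_hashP_le b (T1 := []) (F := fun x hb => f (setupBNote corr D hb.1) { s with
          table := hb.2, stage := .digests, d1 := D, d2 := hb.1, pa := x, pb := b })
        (fun _ _ => (hf _).le_one _) fun r T1 L' hL' _ hlen => ?_
      have h := (hf (setupBNote corr D r)).hidden
        { s with stage := .digests, d1 := D, d2 := r, pb := b } T1 s.table L' hL' (by simp) rfl
        hs.clean (by simp at hlen; omega)
      simpa only [Red.hide, hs.apre, Option.map_none] using h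
    · rw [add_assoc, stepCost]
      gcongr
      exact_mod_cast (by omega : 2 + 2 * s.table.length ≤ 2 * l + 4)
  | second =>
    rw [← avg_const_mul]
    refine avg_le_of_allResults (allResults_of_forall _ fun a => ?_)
    rw [two_pow_mul_avg_drawP, ← avg_sum]
    refine avg_le_of_allResults ((hashP_results s.mu s.table a).mono fun ha hha => ?_)
    have hlen := hha.2.length
    refine (sum_hashP_secret_le ha.2 (F := fun b hb =>
      f (setupBNote corr ha.1 hb.1) { s with
        table := hb.2, stage := .digests, d1 := ha.1, d2 := hb.1, pa := a, pb := b })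
      (fun _ _ => (hf _).le_one _) (k := k) fun D L hL => ?_).trans ?_
    · exact (hf (setupBNote corr ha.1 D)).hidden
        { s with stage := .digests, d1 := ha.1, d2 := D, pa := a } [] ha.2 L hL (by simp) rfl
        hs.clean (by simp; omega)
    · rw [stepCost]
      gcongr
      omega

/-- An input to an honest party costs nothing once the secret exists. Either it discloses the
secret, and then the state is safe and contributes zero (`key0`), or what the adversary sees is the
same for all candidates and the state remains hidden (`key`). -/
theorem Bounds.hidden_redLeak {f : Val → Red → ℝ≥0∞} {k : ℝ≥0∞}
    (hf : ∀ a, Bounds corr i μ (l + 2) (f a) k) {s : Red} {T1 T2 : Table} {L : Finset Bits}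
    (h : HiddenIn μ (s.dig i) T1 T2 L) (hst : s.stage ≠ .start) (hμ : s.mu = μ)
    (hc : s.Clean corr i) (hl : T1.length + T2.length + 1 ≤ l) {lk : FLeak}
    (hlk : s.CanLeak corr lk) :
    ∑ x ∈ L, ((redLeak corr (s.hide i T1 T2 x) lk).avg fun r => f r.1 r.2) ≤ k := by
  have key : ∀ (v : Val) (s' : Red), s'.dig i = s.dig i → s'.stage ≠ .start → s'.mu = μ →
      s'.Clean corr i →
      (∀ x, ((redLeak corr (s.hide i T1 T2 x) lk).avg fun r => f r.1 r.2)
        = f v (s'.hide i T1 T2 x)) →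
      ∑ x ∈ L, ((redLeak corr (s.hide i T1 T2 x) lk).avg fun r => f r.1 r.2) ≤ k := by
    intro v s' hd hst' hμ' hc' hx
    simp only [hx]
    exact (hf v).hidden s' T1 T2 L (hd ▸ h) hst' hμ' hc' (by omega)
  have key0 : (∀ x, (redLeak corr (s.hide i T1 T2 x) lk).AllResults fun r => r.2.Safe corr i) →
      ∑ x ∈ L, ((redLeak corr (s.hide i T1 T2 x) lk).avg fun r => f r.1 r.2) ≤ k := by
    intro hs
    refine (Finset.sum_eq_zero fun x _ => ?_).trans_le zero_le
    exact avg_eq_zero ((hs x).mono fun r hr => (hf _).safe _ hr)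
  cases lk with
  | setupB => exact absurd (hlk.stage.1 rfl) hst
  | setupA =>
    refine key (setupANote corr ⟨s.d1, s.d2⟩) { s with stage := .created } (by cases i <;> rfl)
      (by simp) hμ hc fun x => ?_
    cases i <;> rfl
  | publish =>
    refine key (publishNote corr ⟨s.d1, s.d2⟩) { s with stage := .published } (by cases i <;> rfl)
      (by simp) hμ hc fun x => ?_
    cases i <;> rfl
  | init =>
    refine key (initNote corr ⟨s.d1, s.d2⟩) { s with stage := .initiated } (by cases i <;> rfl)
      (by simp) hμ hc fun x => ?_
    cases i <;> rfl
  | share =>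
    by_cases hA : Party.A ∈ corr
    · cases i with
      | first =>
        refine key0 fun x => ?_
        rw [redLeak, if_pos hA]
        exact ⟨.inr ⟨hA, rfl⟩, hc⟩
      | second =>
        refine key (notesVal [.share s.pa]) { s with shared := true } rfl hst hμ hc fun x => ?_
        rw [redLeak, if_pos hA]
        rfl
    · cases i with
      | first =>
        refine key (notesVal [.sent]) { s with shared := true, apre := some [] } rfl hst hμ hc
          fun x => ?_
        rw [redLeak, if_neg hA]
        rfl
      | second =>
        refine key (notesVal [.sent]) { s with shared := true, apre := some s.pa } rfl hst hμ hc
          fun x => ?_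
        rw [redLeak, if_neg hA]
        rfl
  | redeem path P =>
    have hP : P ∉ corr := hlk.honest path P rfl
    have hclean : ∀ h1 h2, (s.redeem corr P path h1 h2).Clean corr i := by
      intro h1 h2 r hr
      rcases List.mem_cons.1 hr with rfl | hr
      · exact fun hs => hP hs.1
      · exact hc r hr
    have hcleanx : ∀ x h1 h2, ((s.hide i T1 T2 x).redeem corr P path h1 h2).Clean corr i := by
      intro x h1 h2
      rw [Red.hide_redeem]
      intro r hr
      exact hclean h1 h2 r (by simpa using hr)
    cases i with
    | first =>
      have hx1 : ∀ x, ((s.hide .first T1 T2 x).preA P).isSome = (s.preA P).isSome := by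
        intro x; cases P <;> simp [Red.hide, Red.preA]
      by_cases hd : path.usesA = true ∧ (s.preA P).isSome = true
      · refine key0 fun x => ⟨?_, hcleanx x _ _⟩
        simp [Red.Disclosed, redHonestRedeem, Red.redeem, hd, hx1]
      · have hn : (if path.usesA then s.preA P else none) = none := by
          split
          · simpa [*] using hd
          · rfl
        have hnx : ∀ x, (if path.usesA then (s.hide .first T1 T2 x).preA P else none) = none := by
          intro x
          have := hx1 x
          split
          · simp_all
          · rfl
        refine key (redHonestRedeem corr s path P).1 (redHonestRedeem corr s path P).2 rfl hst hμ
          (hclean _ _) fun x => ?_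
        have hb : (s.hide .first T1 T2 x).preB P = s.preB P := by cases P <;> rfl
        simp only [redLeak, avg_ret, redHonestRedeem, hn, hnx, hb, Red.hide_redeem, Red.hide_d1,
          Red.hide_d2, Red.hide_pubA, Red.hide_pubB]
    | second =>
      have hx1 : ∀ x, ((s.hide .second T1 T2 x).preB P).isSome = (s.preB P).isSome := by
        intro x; cases P <;> simp [Red.hide, Red.preB]
      by_cases hd : path.usesB = true ∧ (s.preB P).isSome = true
      · refine key0 fun x => ⟨?_, hcleanx x _ _⟩
        simp [Red.Disclosed, redHonestRedeem, Red.redeem, hd, hx1]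
      · have hn : (if path.usesB then s.preB P else none) = none := by
          split
          · simpa [*] using hd
          · rfl
        have hnx : ∀ x, (if path.usesB then (s.hide .second T1 T2 x).preB P else none) = none := by
          intro x
          have := hx1 x
          split
          · simp_all
          · rfl
        refine key (redHonestRedeem corr s path P).1 (redHonestRedeem corr s path P).2 rfl hst hμ
          (hclean _ _) fun x => ?_
        have hb : (s.hide .second T1 T2 x).preA P = s.preA P := by cases P <;> rfl
        simp only [redLeak, avg_ret, redHonestRedeem, hn, hnx, hb, Red.hide_redeem, Red.hide_d1,
          Red.hide_d2, Red.hide_pubA, Red.hide_pubB]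

theorem step_redWorldInput (P : Party) (inp : PInput) :
    Step corr i μ l (l + 2) (stepCost l) fun s => (redWorldInput corr s P inp).bind fun r =>
      .ret ((r.1, (idealInput corr (s.ideal corr) P inp).1), r.2) := by
  intro f k hf
  refine ⟨fun s => avg_le_one _ fun r => (hf _).le_one _, fun s hs => ?_, fun s hs => ?_, ?_⟩
  · rw [avg_bind]
    rcases redWorldInput_cases (s.ideal corr) P inp with ⟨v, h⟩ | ⟨lk, h⟩
    · rw [h s rfl]
      exact (hf _).safe s hs
    · rw [(h s rfl).1]
      exact avg_eq_zero ((redLeak_safe hs lk).mono fun r hr => (hf _).safe _ hr)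
  · rw [avg_bind]
    rcases redWorldInput_cases (s.ideal corr) P inp with ⟨v, h⟩ | ⟨lk, h⟩
    · rw [h s rfl]
      exact ((hf _).mono (by omega) (le_add_right le_rfl)).start s hs
    · obtain ⟨h1, h2⟩ := h s rfl
      obtain rfl := h2.stage.2 hs.stage
      rw [h1]
      exact Bounds.redSetupB
        (f := fun v s' => f (v, (idealInput corr (s.ideal corr) P inp).1) s') (fun _ => hf _) hs
  · intro s T1 T2 L hL hst hμ hc hl
    have hid : ∀ x, (s.hide i T1 T2 x).ideal corr = s.ideal corr := s.hide_ideal T1 T2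
    simp only [avg_bind, avg_ret, hid]
    rcases redWorldInput_cases (s.ideal corr) P inp with ⟨v, h⟩ | ⟨lk, h⟩
    · have h' : ∀ x, redWorldInput corr (s.hide i T1 T2 x) P inp = .ret (v, s.hide i T1 T2 x) :=
        fun x => h _ (hid x)
      simp only [h', avg_ret]
      exact ((hf _).hidden s T1 T2 L hL hst hμ hc (by omega)).trans (le_add_right le_rfl)
    · have h' : ∀ x, redWorldInput corr (s.hide i T1 T2 x) P inp
          = redLeak corr (s.hide i T1 T2 x) lk := fun x => (h _ (hid x)).1
      simp only [h']
      exact (Bounds.hidden_redLeak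
        (f := fun v s' => f (v, (idealInput corr (s.ideal corr) P inp).1) s') (fun _ => hf _) hL
        hst hμ hc hl (h s rfl).2).trans (le_add_right le_rfl)

end
end MadHtlc

namespace MadHtlc
open scoped ENNReal
open Prog

/-! ### Activations of the adversary and executions -/

theorem stepCost_mono {l l' : ℕ} (h : l ≤ l') : stepCost l ≤ stepCost l' := by
  unfold stepCost
  omega

section
variable {corr : Finset Party} {i : Secret} {μ l l' : ℕ}

theorem Bounds.zero (k : ℝ≥0∞) : Bounds corr i μ l (fun _ => 0) k :=
  ⟨fun _ => zero_le, fun _ _ => rfl, by simp, by simp⟩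

theorem Bounds.coin {f : Bool → Red → ℝ≥0∞} {k : ℝ≥0∞} (h : ∀ b, Bounds corr i μ l (f b) k) :
    Bounds corr i μ l (fun s => (f true s + f false s) / 2) k :=
  Bounds.avg (p := .coin .ret) (f := f) h

/-- The bound is pulled back through one message at a time. With message budget `n` there are at
most `n` messages, each adding at most two entries to the table and one `stepCost`. -/
theorem Bounds.simulate (hB : Party.B ∉ corr) {α : Type} {p : Prog (Option α)}
    {Q : ℕ → Option α → Prop} {n : ℕ} (hp : p.Spends Q n) (hl : l + 2 * n ≤ l')
    {f : α → Red → ℝ≥0∞} {k : ℝ≥0∞} (hf : ∀ n a, Q n (some a) → Bounds corr i μ l' (f a) k) :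
    Bounds corr i μ l (fun s => (p.simulate (fun s v => (redCall corr s v).total) s).avg
      (liftO fun r => f r.1 r.2)) (k + (n * stepCost l' : ℕ)) := by
  induction p generalizing n l with
  | ret o =>
    cases o with
    | none => exact .zero _
    | some a => exact (hf n a hp).mono (by omega) (le_add_right le_rfl)
  | coin c ih => exact .coin fun b => ih b (hp b) hl
  | call v c ih =>
    obtain ⟨hv, hc⟩ := hp
    have h := step_redCall (i := i) (μ := μ) (l := l) hB v
      (fun r s => ((c r).simulate (fun s v => (redCall corr s v).total) s).avg
        (liftO fun r => f r.1 r.2)) _ fun r => ih r (hc r) (by omega)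
    simp only [Prog.simulate, total_bindO, avg_bind]
    refine h.mono le_rfl ?_
    rw [add_assoc]
    gcongr
    have h1 := stepCost_mono (show l ≤ l' by omega)
    have h2 : (n - (v.size + 1)) * stepCost l' + stepCost l' ≤ n * stepCost l' := by
      rw [← Nat.succ_mul]
      exact Nat.mul_le_mul_right _ (by omega)
    exact_mod_cast (by omega : (n - (v.size + 1)) * stepCost l' + stepCost l ≤ n * stepCost l')

variable {adv : Cmd} {T t n : ℕ}

/-- The cost is measured by the time `T` that the adversary really needs, not by the limit `t`,
which tends to infinity in the supremum. -/
theorem Bounds.redActivate (hB : Party.B ∉ corr) {st : Store} (hl : adv.Live T n st) (ht : T ≤ t)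
    (m : Option Val) (notes : Val) (hm : envLength (m, notes) ≤ n) (out : Option Bool)
    (hll : l + 2 * T ≤ l') {G : Val → Store → Red → ℝ≥0∞} {k : ℝ≥0∞}
    (hG : ∀ v st, adv.Live T (n - envLength (m, notes)) st → Bounds corr i μ l' (G v st) k) :
    Bounds corr i μ l (fun s => (redActivate corr adv t s st m notes out).avg
      (liftO fun r => G r.1 r.2.2 r.2.1)) (k + (T * stepCost l' : ℕ)) := by
  have hrun := hl.run (m, notes) hm
  have hs := ((adv.run_refines_of_le _ ht).and_of_allResults hrun).spends
    (allResults_isSome_iff.2 (hrun.mono fun o ⟨r, hr, _⟩ => ⟨r, hr, trivial⟩))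
    (adv.run_spends (Function.update st 0 (activationVal m notes)) T)
  have h := Bounds.simulate (i := i) (μ := μ) hB hs hll
    (f := fun (r : Store × ℕ) s => G (.node (outputVal out) (r.1 0)) r.1 s) (k := k) (by
      rintro _ a ⟨b, a', ha, ⟨⟨hab, -⟩, hb⟩, -⟩
      obtain rfl := Option.some_injective _ ha
      exact hG _ _ (hab ▸ hb))
  convert h using 2 with s
  rw [MadHtlc.redActivate, avg_bindO]
  congr 1

/-- A turn consists of one input, if any, and one activation: at most `T + 1` steps and `2 * T + 2`
new table entries. The environment pays at least one unit of its budget `n` for each turn. -/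
theorem Bounds.redExec (hB : Party.B ∉ corr) (ht : T ≤ t) {f : Red → ℝ≥0∞}
    (hf : Bounds corr i μ l' f 0) {α : Type} {q : Prog (Option α)} {Q : ℕ → Option α → Prop}
    (hq : q.Spends Q n) {st : Store} (hl : adv.Live T n st) (hll : l + n * (2 * T + 2) ≤ l') :
    Bounds corr i μ l (fun s => (q.simulate (redTurn corr adv t) (s, st)).avg
      (liftO fun r => f r.2.1)) (n * ((T + 1) * stepCost l') : ℕ) := by
  induction q generalizing n l st with
  | ret o =>
    cases o with
    | none => exact .zero _
    | some a => exact hf.mono (by omega) zero_le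
  | coin c ih => exact .coin fun b => ih b (hq b) hl hll
  | call v c ih =>
    obtain ⟨hv, hc⟩ := hq
    obtain ⟨u, rfl⟩ := Nat.exists_eq_add_of_le hv
    rw [Nat.add_sub_cancel_left] at hc
    have e1 : (v.size + 1 + u) * (2 * T + 2) = v.size * (2 * T + 2) + (2 * T + 2) +
      u * (2 * T + 2) := by ring
    have hG : ∀ a : Option Val × Val, envLength a ≤ v.size + 1 → ∀ w st',
        adv.Live T (v.size + 1 + u - envLength a) st' →
        Bounds corr i μ (l + 2 + 2 * T) (fun s => ((c w).simulate (redTurn corr adv t)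
          (s, st')).avg (liftO fun r => f r.2.1)) (u * ((T + 1) * stepCost l') : ℕ) :=
      fun a ha w st' hst' => ih w (hc w) (hst'.mono (by omega)) (by omega)
    have hcost : u * ((T + 1) * stepCost l') + T * stepCost (l + 2 + 2 * T) + stepCost l
        ≤ (v.size + 1 + u) * ((T + 1) * stepCost l') := by
      have h1 : stepCost (l + 2 + 2 * T) ≤ stepCost l' := stepCost_mono (by omega)
      have h2 : stepCost l ≤ stepCost l' := stepCost_mono (by omega)
      have h3 := Nat.mul_le_mul_left T h1
      have e2 : (v.size + 1 + u) * ((T + 1) * stepCost l') = v.size * ((T + 1) * stepCost l') +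
        (T * stepCost l' + stepCost l') + u * ((T + 1) * stepCost l') := by ring
      omega
    have hvs : v.snd.size ≤ v.size := v.size_snd_le
    have hreq : ∀ m, EnvReq.ofVal v = .adv m → m = v.snd := by
      intro m
      rw [EnvReq.ofVal]
      split <;> simp +contextual [eq_comm]
    simp only [Prog.simulate, redTurn]
    cases hr : EnvReq.ofVal v with
    | adv m =>
      have ha : envLength (some m, .nil) ≤ v.size + 1 := by
        rw [hreq m hr]
        simp [envLength, hvs]
      have h := Bounds.redActivate hB hl ht (some m) .nil (ha.trans (by omega)) none
        (l := l) (by omega) (hG _ ha)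
      simp only [avg_bindO]
      refine h.mono le_rfl ?_
      exact_mod_cast (by omega : u * ((T + 1) * stepCost l') + T * stepCost (l + 2 + 2 * T)
        ≤ (v.size + 1 + u) * ((T + 1) * stepCost l'))
    | input P inp =>
      have ha : ∀ notes, envLength (none, notes) ≤ v.size + 1 := fun _ => by simp [envLength]
      have h := step_redWorldInput (corr := corr) (i := i) (μ := μ) (l := l) P inp
        (fun x s => (MadHtlc.redActivate corr adv t s st none x.1 x.2).avg
          (liftO fun r => ((c r.1).simulate (redTurn corr adv t) (r.2.1, r.2.2)).avg
            (liftO fun r => f r.2.1))) _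
        fun x => Bounds.redActivate hB hl ht none x.1 ((ha _).trans (by omega)) x.2
          (l := l + 2) (by omega) (hG _ (ha _))
      simp only [avg_bind, avg_bindO, avg_ret] at h ⊢
      refine h.mono le_rfl ?_
      exact_mod_cast hcost

open Classical in
/-- In an execution, with an honest `B`, the secret is stolen only with small probability. -/
theorem two_pow_mul_avg_redExec_le (hB : Party.B ∉ corr) {env : Cmd} {z : Bits}
    (henv : (env.run (initStore μ (.ofBits z)) n).AllResults fun o => o.isSome = true)
    (hl : adv.Live T n (initStore μ .nil)) (ht : T ≤ t) (hn : n ≤ t) (i : Secret) :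
    2 ^ μ * (MadHtlc.redExec corr adv t env μ z t).avg
        (liftO fun r => if r.2.1.Clean corr i then 0 else 1)
      ≤ (n * ((T + 1) * stepCost (n * (2 * T + 2))) : ℕ) := by
  have hf : Bounds corr i μ (n * (2 * T + 2))
      (fun s => if s.Clean corr i then 0 else 1) 0 := by
    refine ⟨fun s => ?_, fun s hs => if_pos hs.2, fun s hs => ?_,
      fun s T1 T2 L _ _ _ hc _ => ?_⟩
    · split <;> simp
    · rw [if_pos hs.clean, mul_zero]
    · refine (Finset.sum_eq_zero fun x _ => if_pos ?_).le
      intro r hr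
      exact hc r (by simpa using hr)
  have hsp := (env.run_refines_of_le (initStore μ (.ofBits z)) hn).spends henv
    (env.run_spends _ _)
  exact (Bounds.redExec hB ht hf hsp hl (l := 0) (by omega)).start (Red.start μ)
    ⟨rfl, rfl, by simp [Red.start], rfl, by simp [Red.Clean, Red.start]⟩

/-! ### Valid redeeming transactions are permitted -/

/-- For honest publishers this is exactness. If B is corrupted, it can use the open paths by itself
and others may pool with it, while with corrupted A sharing is counted as true. If B is honest,
absence of theft means that each indicator set by the transaction was set before or, for the first
preimage, that corrupted A had received it; in that case others pool with A. -/
theorem RedeemTx.Exact.permitted {r : RedeemTx} (h : r.Exact corr) (hv : r.valid = true)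
    (hs : Party.B ∉ corr → ∀ i, ¬ r.Steals corr i) : r.Permitted corr := by
  obtain ⟨P, path, pubA, pubB, shared, valid, pubA', pubB'⟩ := r
  obtain ⟨h1, h2, h3⟩ := h
  have hs1 := fun hB => hs hB .first
  have hs2 := fun hB => hs hB .second
  simp only [Steals, Permitted] at *
  by_cases hP : P ∈ corr
  swap
  · exact .inl (by rw [← h3 hP, hv])
  by_cases hB : Party.B ∈ corr
  · cases path <;> cases P <;> simp_all [rPredicate, canRedeem] <;>
      exact .inr ⟨_, hB, rfl⟩
  · specialize hs1 hB
    specialize hs2 hB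
    have hpool : pubB = true → (pubA = true ∨ (Party.A ∈ corr ∧ shared = true)) →
        (path = .depM ∨ path = .colM) → P ≠ .B →
        canRedeem pubA pubB shared P path = true ∨
          (path = .depM ∨ path = .colM) ∧ P ∈ corr ∧
            ∃ Q ∈ corr, canRedeem pubA pubB shared Q path = true := by
      intro hb ha hp hPB
      by_cases hA : Party.A ∈ corr
      · refine .inr ⟨hp, hP, .A, hA, ?_⟩
        rcases hp with rfl | rfl <;> rcases ha with rfl | ⟨-, rfl⟩ <;> simp [canRedeem, hb]
      · left
        have ha' : pubA = true := ha.resolve_right fun h => hA h.1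
        rcases hp with rfl | rfl <;> cases P <;> simp_all [canRedeem]
    have hPB : P ≠ .B := fun h => hB (h ▸ hP)
    cases path with
    | depA =>
      left
      cases P <;> cases pubA <;> simp_all [rPredicate, canRedeem]
    | depB => cases P <;> simp_all [rPredicate]
    | colB => cases P <;> simp_all [rPredicate]
    | _ =>
      have hr : pubA' = true ∧ pubB' = true := by simpa [rPredicate, h1] using hv
      refine hpool ?_ ?_ (by simp) hPB
      · cases pubB <;> simp_all
      · cases pubA <;> simp_all

/-- In an execution, all valid redeeming transactions are permitted, up to a small probability. -/
theorem execProb_not_permitted_le {env : Cmd} {z : Bits}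
    (henv : (env.run (initStore μ (.ofBits z)) n).AllResults fun o => o.isSome = true)
    (hl : adv.Live T n (initStore μ .nil)) :
    execProb (hybridWorld corr μ) env adv μ z
        (fun _ s => ∃ r ∈ s.log, r.valid = true ∧ ¬ r.Permitted corr)
      ≤ (2 * (n * ((T + 1) * stepCost (n * (2 * T + 2)))) : ℕ) * (2⁻¹) ^ μ := by
  classical
  set K := n * ((T + 1) * stepCost (n * (2 * T + 2)))
  rw [execProb_eq_iSup _ _ _ _ _ _ (n + T)]
  have key : ∀ t, n + T ≤ t → expect (exec (hybridWorld corr μ) env adv μ z t)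
      (liftO fun x => @ite _ (∃ r ∈ x.2.log, r.valid = true ∧ ¬ r.Permitted corr)
        (Classical.propDecidable _) 1 0)
        ≤ ((2 * K : ℕ) : ℝ≥0∞) * (2⁻¹) ^ μ := by
    intro t ht
    rw [expect_hybrid_exec (H := fun x =>
      @ite _ (∃ r ∈ x.2.log, r.valid = true ∧ ¬ r.Permitted corr)
        (Classical.propDecidable _) 1 0)]
    by_cases hB : Party.B ∈ corr
    · refine (avg_eq_zero ((redExec_inv env μ z t).mono fun o ho => ?_)).trans_le zero_le
      cases o with
      | none => rfl
      | some r =>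
        refine if_neg ?_
        rintro ⟨x, hx, hv, hn⟩
        exact hn (((ho r rfl).log x hx).permitted hv fun h => absurd hB h)
    · have h : ∀ i, (MadHtlc.redExec corr adv t env μ z t).avg
          (liftO fun r => if r.2.1.Clean corr i then 0 else 1) ≤ (K : ℕ) * (2⁻¹) ^ μ := by
        intro i
        rw [← ENNReal.inv_pow, ← div_eq_mul_inv,
          ENNReal.le_div_iff_mul_le (.inl (by simp)) (.inl (by simp)), mul_comm]
        exact two_pow_mul_avg_redExec_le hB henv hl (by omega) (by omega) i
      -- Union bound over the two secrets: a transaction that is valid but not permitted makes the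
      -- log unclean for one of them.
      calc _ ≤ (MadHtlc.redExec corr adv t env μ z t).avg (fun o =>
              liftO (fun r => if r.2.1.Clean corr .first then 0 else 1) o +
              liftO (fun r => if r.2.1.Clean corr .second then 0 else 1) o) := by
            refine avg_mono_of_allResults ((redExec_inv env μ z t).mono fun o ho => ?_)
            cases o with
            | none => simp
            | some r =>
              by_cases h1 : r.2.1.Clean corr .first <;> by_cases h2 : r.2.1.Clean corr .second
              · simp only [liftO_some]
                rw [if_neg]
                · exact zero_le
                rintro ⟨x, hx, hv, hn⟩
                refine hn (((ho r rfl).log x hx).permitted hv fun _ i => ?_)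
                cases i
                · exact h1 x hx
                · exact h2 x hx
              all_goals
                simp only [liftO_some, h1, h2, if_true, if_false]
                split <;> simp
        _ ≤ K * (2⁻¹) ^ μ + K * (2⁻¹) ^ μ := by
            rw [avg_add]
            exact add_le_add (h .first) (h .second)
        _ = _ := by
            push_cast
            ring
  have h2 : ((2 * K : ℕ) : ℝ≥0∞) * (2⁻¹) ^ μ ≠ ⊤ :=
    ENNReal.mul_ne_top (ENNReal.natCast_ne_top _) (ENNReal.pow_ne_top (by simp))
  refine (ENNReal.toReal_mono h2 (iSup_le fun t =>
    key (t + (n + T)) (by omega))).trans_eq ?_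
  simp

theorem negligible_not_permitted {env adv : Cmd} (henv : env.IsPPTEnv) (hadv : adv.IsPPT)
    (z : ℕ → Bits) :
    Negligible fun μ => execProb (hybridWorld corr μ) env adv μ (z μ)
      (fun _ s => ∃ r ∈ s.log, r.valid = true ∧ ¬ r.Permitted corr) := by
  obtain ⟨p, hp⟩ := hadv.exists_live
  obtain ⟨pe, hpe⟩ := henv
  let pT : Polynomial ℕ := p.comp (.X + pe)
  -- The bound of `execProb_not_permitted_le` with `n` and `T` replaced by the polynomials `pe` and
  -- `pT`, where `pT` evaluates `p` at `μ + n`.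
  let q : Polynomial ℕ := 2 * (pe * ((pT + 1) * (2 * (pe * (2 * pT + 2)) + 4)))
  have hdecay : Negligible fun μ => (2⁻¹ : ℝ) ^ μ := fun k =>
    tendsto_pow_const_mul_const_pow_of_abs_lt_one k (by norm_num [abs_of_pos])
  refine (hdecay.polynomial_mul (q.map (Nat.castRingHom ℝ))).trans_abs_le fun μ => ?_
  have h := execProb_not_permitted_le (corr := corr) (hpe μ (z μ)) (hp μ (pe.eval μ))
  have h0 : 0 ≤ execProb (hybridWorld corr μ) env adv μ (z μ)
      (fun _ s => ∃ r ∈ s.log, r.valid = true ∧ ¬ r.Permitted corr) := ENNReal.toReal_nonneg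
  rw [abs_of_nonneg h0]
  refine (h.trans_eq ?_).trans (le_abs_self _)
  rw [Polynomial.eval_natCast_map]
  simp [q, pT, stepCost]

end
end MadHtlc

/-! ### The three claims together -/

theorem mainTheorem2 (corr : Finset MadHtlc.Party) :
    -- the protocol UC-realizes the ideal functionality
    MadHtlc.UCRealizes corr ∧
    -- only the listed valid redeeming transactions occur, except with negligible probability
    (∀ env adv : MadHtlc.Cmd, env.IsPPTEnv → adv.IsPPT → ∀ z : ℕ → MadHtlc.Bits,
      MadHtlc.Negligible fun μ =>
        MadHtlc.execProb (MadHtlc.hybridWorld corr μ) env adv μ (z μ)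
          (fun _ s => ∃ r ∈ s.log, r.valid = true ∧ ¬ r.Permitted corr)) ∧
    -- in every state that an execution in the hybrid world can reach:
    (∀ (env adv : MadHtlc.Cmd) (μ : ℕ) (z : MadHtlc.Bits) (t : ℕ) (b : Bool)
        (s : MadHtlc.HState),
      some (b, s) ∈ (MadHtlc.exec (MadHtlc.hybridWorld corr μ) env adv μ z t).support →
      -- for honest parties the list is exact, and its items have the stated effects
      (∀ P ∉ corr, ∀ path, s.g.init = true →
        ∀ x ∈ ((MadHtlc.hybridWorld corr μ).input s P (.redeem path)).support,
          x.1 = some (MadHtlc.canRedeem s.g.pubA s.g.pubB (s.shared corr) P path) ∧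
          (x.1 = some true →
            x.2.2.g.pubA = (s.g.pubA || path.usesA) ∧
            x.2.2.g.pubB = (s.g.pubB || path.usesB))) ∧
      -- every valid redeeming transaction so far respects these exact rules if its publisher is
      -- honest, and publishes the preimages that its path involves in any case
      (∀ r ∈ s.log,
        (r.party ∉ corr →
          r.valid = MadHtlc.canRedeem r.pubA r.pubB r.shared r.party r.path) ∧
        (r.valid = true →
          (r.path.usesA = true → r.pubAAfter = true) ∧
          (r.path.usesB = true → r.pubBAfter = true))) ∧
      -- honest `B` can share the first preimage with `A` as long as the contract is not initiated
      (MadHtlc.Party.B ∉ corr → s.g.tx.isSome = true → s.g.init = false →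
        ∀ x ∈ ((MadHtlc.hybridWorld corr μ).input s .B .share).support,
          x.2.2.shared corr = true)) := by
  refine ⟨MadHtlc.uCRealizes corr, ?_, ?_⟩
  · exact fun env adv henv hadv z => MadHtlc.negligible_not_permitted henv hadv z
  · intro env adv μ z t b w hw
    obtain ⟨s, hs, rfl⟩ := MadHtlc.exists_red_of_mem_support hw
    refine ⟨fun P hP path hi => ?_, fun r hr => ?_, fun hB htx hi => ?_⟩
    · rw [MadHtlc.Red.expand_shared]
      refine hs.redeem_exact hP path ?_
      cases hst : s.stage <;> simp_all [MadHtlc.Red.expand, MadHtlc.Stage.hasInit]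
    · have h := hs.log r hr
      exact ⟨h.honest, h.after⟩
    · refine hs.share_exact hB ?_
      cases hst : s.stage <;> simp_all [MadHtlc.Red.expand, MadHtlc.Stage.hasInit,
        MadHtlc.Red.txO, MadHtlc.Stage.hasTx, MadHtlc.Stage.phase]
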